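/- Work with varieties over $\mathbb{C}$. **Six points.** Let $\mathcal{G}\subset(\mathbb{P}^2)^6$ be the open set of ordered sextuples $m=(m_1,\dots,m_6)$ such that no three of the points are collinear and the six points do not lie on a common conic, and let $\mathcal{M}^{\mathrm{sm}}_{C,m}=\mathcal{G}/\!/SL_3(\mathbb{C})$ be the moduli space of smooth marked cubic surfaces. For $m\in\mathcal{G}$ let $Q$ be the unique (irreducible) conic through $m_1,\dots,m_5$. The group $S_5$ acts on $\mathcal{M}^{\mathrm{sm}}_{C,m}$ by permuting $m_1,\dots,m_5$. The group $(\mathbb{Z}/2)^5$ acts as follows: the $i$-th factor replaces $m_i$ by the residual intersection point of the line $\overline{m_im_6}$ with $Q$ (which is $m_i$ itself if the line is tangent to $Q$). **Seven points.** Let $DM(2^5,1^2)$ be the moduli space, i.e. the quotient by $SL_2(\mathbb{C})$, of the stable ordered seven-tuples $(p_1,\dots,p_7)$ of points of $\mathbb{P}^1$, where $p_1,\dots,p_5$ have weight $2$, $p_6,p_7$ have weight $1$, and stable means that the total weight of the points at any one location is less than $6$. Let $DM_{\mathbb{Z}/2}(2^5,1^2)$ be its quotient by the group $\mathbb{Z}/2$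 interchanging $p_6$ and $p_7$; the group $S_5$ acts on it by permuting $p_1,\dots,p_5$. For a multiset $\nu$ of positive integers, let $DM^{\mathrm{gen}}_{\mathbb{Z}/2}(\nu)\subset DM_{\mathbb{Z}/2}(2^5,1^2)$ be the stratum of the classes of configurations for which the total weights at the distinct locations form the multiset $\nu$. **The map.** For $m\in\mathcal{G}$ there are exactly two points $t_1,t_2\in Q$ at which the tangent line to $Q$ passes through $m_6$. Projecting $m_1,\dots,m_5,t_1,t_2$ from $m_6$ to $\mathbb{P}^1$ gives a stable seven-tuple $(p_1,\dots,p_7)$, and this defines a map $$\phi^6_7:\ \mathcal{M}^{\mathrm{sm}}_{C,m}\longrightarrow DM_{\mathbb{Z}/2}(2^5,1^2).$$ **Lemma.** The above rule is a well-defined action of $(\mathbb{Z}/2)^5$ on $\mathcal{M}^{\mathrm{sm}}_{C,m}$ by automorphisms, and its diagonal subgroup acts trivially, so that $(\mathbb{Z}/2)^4\cong(\mathbb{Z}/2)^5/(\mathbb{Z}/2)$ acts; the action of $S_5$ descends to $\mathcal{M}^{\mathrm{sm}}_{C,m}/(\mathbb{Z}/2)^4$. The map $\phi^6_7$ is well defined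 and descends to a dominant, injective, $S_5$-equivariant morphism $$\mathcal{M}^{\mathrm{sm}}_{C,m}/(\mathbb{Z}/2)^4\longrightarrow DM_{\mathbb{Z}/2}(2^5,1^2).$$ Its image is $DM^{\mathrm{gen}}_{\mathbb{Z}/2}(2^5,1^2)\cup DM^{\mathrm{gen}}_{\mathbb{Z}/2}(3,2^4,1)\cup DM^{\mathrm{gen}}_{\mathbb{Z}/2}(3^2,2^3)$, and it is an isomorphism onto its image. -/

import Mathlib

open scoped LinearAlgebra.Projectivization MatrixGroups Topology

noncomputable section

namespace CubicDM

/-! ### Spaces with functions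

A variety over `ℂ` is treated as the set of its closed points, with the Zariski topology and the
sheaf of regular `ℂ`-valued functions. -/

/-- A space with functions over `ℂ`: a topology on `X` and a sheaf of `ℂ`-algebras of `ℂ`-valued
functions.  `regular U f` says that the restriction of `f` to the open set `U` is a section;
the values of `f` outside `U` play no role. -/
structure FunSpace (X : Type) where
  top : TopologicalSpace X
  regular : Set X → (X → ℂ) → Prop
  regular_const : ∀ U, IsOpen[top] U → ∀ c : ℂ, regular U (fun _ => c)
  regular_add : ∀ U, IsOpen[top] U → ∀ f g, regular U f → regular U g → regular U (f + g)
  regular_mul : ∀ U, IsOpen[top] U → ∀ f g, regular U f → regular U g → regular U (f * g)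
  regular_inv : ∀ U, IsOpen[top] U → ∀ f, regular U f →
    IsOpen[top] {x ∈ U | f x ≠ 0} ∧ regular {x ∈ U | f x ≠ 0} f⁻¹
  regular_congr : ∀ U, IsOpen[top] U → ∀ f g, Set.EqOn f g U → regular U f → regular U g
  regular_mono : ∀ U V, IsOpen[top] U → IsOpen[top] V → V ⊆ U → ∀ f, regular U f → regular V f
  regular_local : ∀ U, IsOpen[top] U → ∀ f,
    (∀ x ∈ U, ∃ V, IsOpen[top] V ∧ x ∈ V ∧ V ⊆ U ∧ regular V f) → regular U f

namespace FunSpace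

variable {X Y : Type}

theorem open_inter {t : TopologicalSpace X} {U V : Set X} (hU : IsOpen[t] U) (hV : IsOpen[t] V) :
    IsOpen[t] (U ∩ V) := hU.inter hV

theorem open_of_forall {t : TopologicalSpace X} {U : Set X}
    (h : ∀ x ∈ U, ∃ V, IsOpen[t] V ∧ x ∈ V ∧ V ⊆ U) : IsOpen[t] U :=
  isOpen_iff_forall_mem_open.mpr fun x hx => by
    obtain ⟨V, h1, h2, h3⟩ := h x hx
    exact ⟨V, h3, h1, h2⟩

/-- The Zariski topology of affine space with coordinates indexed by `κ`, generated by the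
non-vanishing loci of polynomials. -/
@[reducible] def zariski (κ : Type) : TopologicalSpace (κ → ℂ) :=
  TopologicalSpace.generateFrom
    {D | ∃ p : MvPolynomial κ ℂ, D = {x | MvPolynomial.eval x p ≠ 0}}

/-- Affine space with coordinates indexed by `κ`: the Zariski topology and the functions that are
locally quotients of polynomials. -/
def affine (κ : Type) : FunSpace (κ → ℂ) where
  top := zariski κ
  regular U f := ∀ x ∈ U, ∃ V, IsOpen[zariski κ] V ∧ x ∈ V ∧ V ⊆ U ∧
    ∃ p q : MvPolynomial κ ℂ, ∀ y ∈ V, MvPolynomial.eval y q ≠ 0 ∧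
      f y = MvPolynomial.eval y p / MvPolynomial.eval y q
  regular_const U hU c x hx := ⟨U, hU, hx, le_rfl, MvPolynomial.C c, 1, by simp⟩
  regular_add U hU f g hf hg x hx := by
    obtain ⟨V, hV, hxV, hVU, p, q, h⟩ := hf x hx
    obtain ⟨W, hW, hxW, hWU, r, s, h'⟩ := hg x hx
    refine ⟨V ∩ W, open_inter hV hW, ⟨hxV, hxW⟩, fun y hy => hVU hy.1, p * s + q * r, q * s, ?_⟩
    rintro y ⟨hyV, hyW⟩
    obtain ⟨h1, h2⟩ := h y hyV
    obtain ⟨h3, h4⟩ := h' y hyW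
    refine ⟨by simp [h1, h3], ?_⟩
    simp only [Pi.add_apply, h2, h4, map_add, map_mul, div_add_div _ _ h1 h3]
  regular_mul U hU f g hf hg x hx := by
    obtain ⟨V, hV, hxV, hVU, p, q, h⟩ := hf x hx
    obtain ⟨W, hW, hxW, hWU, r, s, h'⟩ := hg x hx
    refine ⟨V ∩ W, open_inter hV hW, ⟨hxV, hxW⟩, fun y hy => hVU hy.1, p * r, q * s, ?_⟩
    rintro y ⟨hyV, hyW⟩
    obtain ⟨h1, h2⟩ := h y hyV
    obtain ⟨h3, h4⟩ := h' y hyW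
    refine ⟨by simp [h1, h3], ?_⟩
    simp only [Pi.mul_apply, h2, h4, map_mul, div_mul_div_comm]
  regular_inv U hU f hf := by
    have key : ∀ x ∈ {x ∈ U | f x ≠ 0}, ∃ V, IsOpen[zariski κ] V ∧ x ∈ V ∧
        V ⊆ {x ∈ U | f x ≠ 0} ∧ ∃ p q : MvPolynomial κ ℂ, ∀ y ∈ V, MvPolynomial.eval y q ≠ 0 ∧
        f⁻¹ y = MvPolynomial.eval y p / MvPolynomial.eval y q := by
      rintro x ⟨hx, hfx⟩
      obtain ⟨V, hV, hxV, hVU, p, q, h⟩ := hf x hx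
      refine ⟨V ∩ {x | MvPolynomial.eval x p ≠ 0},
        open_inter hV (TopologicalSpace.isOpen_generateFrom_of_mem ⟨p, rfl⟩), ⟨hxV, ?_⟩, ?_, q, p, ?_⟩
      · intro h0
        exact hfx (by rw [(h x hxV).2, h0, zero_div])
      · rintro y ⟨hyV, hy⟩
        refine ⟨hVU hyV, ?_⟩
        rw [(h y hyV).2]
        exact div_ne_zero hy (h y hyV).1
      · rintro y ⟨hyV, hy⟩
        exact ⟨hy, by rw [Pi.inv_apply, (h y hyV).2, inv_div]⟩
    refine ⟨open_of_forall fun x hx => ?_, key⟩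
    obtain ⟨V, hV, hxV, hVU, -⟩ := key x hx
    exact ⟨V, hV, hxV, hVU⟩
  regular_congr U hU f g hfg hf x hx := by
    obtain ⟨V, hV, hxV, hVU, p, q, h⟩ := hf x hx
    exact ⟨V, hV, hxV, hVU, p, q, fun y hy => ⟨(h y hy).1, (hfg (hVU hy)).symm.trans (h y hy).2⟩⟩
  regular_mono U V hU hV hVU f hf x hx := by
    obtain ⟨W, hW, hxW, hWU, p, q, h⟩ := hf x (hVU hx)
    exact ⟨W ∩ V, open_inter hW hV, ⟨hxW, hx⟩, fun y hy => hy.2, p, q, fun y hy => h y hy.1⟩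
  regular_local U hU f h x hx := by
    obtain ⟨V, hV, hxV, hVU, hf⟩ := h x hx
    obtain ⟨W, hW, hxW, hWV, hpq⟩ := hf x hxV
    exact ⟨W, hW, hxW, hWV.trans hVU, hpq⟩

/-- The structure induced along `i : X → Y`: the induced topology, and the functions that are
locally pulled back from regular functions on `Y`.  For an inclusion `i` it makes `X` a
subvariety of `Y`. -/
def induced (i : X → Y) (S : FunSpace Y) : FunSpace X where
  top := S.top.induced i
  regular U f := ∀ x ∈ U, ∃ V, IsOpen[S.top] V ∧ i x ∈ V ∧ i ⁻¹' V ⊆ U ∧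
    ∃ g, S.regular V g ∧ ∀ y, i y ∈ V → f y = g (i y)
  regular_const U hU c x hx := by
    obtain ⟨V, hV, rfl⟩ := hU
    exact ⟨V, hV, hx, le_rfl, fun _ => c, S.regular_const V hV c, fun _ _ => rfl⟩
  regular_add U hU f g hf hg x hx := by
    obtain ⟨V, hV, hxV, hVU, a, ha, h⟩ := hf x hx
    obtain ⟨W, hW, hxW, hWU, b, hb, h'⟩ := hg x hx
    have hVW : IsOpen[S.top] (V ∩ W) := open_inter hV hW
    refine ⟨V ∩ W, hVW, ⟨hxV, hxW⟩, fun y hy => hVU hy.1, a + b,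
      S.regular_add _ hVW _ _ (S.regular_mono _ _ hV hVW Set.inter_subset_left _ ha)
        (S.regular_mono _ _ hW hVW Set.inter_subset_right _ hb), fun y hy => ?_⟩
    simp [h y hy.1, h' y hy.2]
  regular_mul U hU f g hf hg x hx := by
    obtain ⟨V, hV, hxV, hVU, a, ha, h⟩ := hf x hx
    obtain ⟨W, hW, hxW, hWU, b, hb, h'⟩ := hg x hx
    have hVW : IsOpen[S.top] (V ∩ W) := open_inter hV hW
    refine ⟨V ∩ W, hVW, ⟨hxV, hxW⟩, fun y hy => hVU hy.1, a * b,
      S.regular_mul _ hVW _ _ (S.regular_mono _ _ hV hVW Set.inter_subset_left _ ha)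
        (S.regular_mono _ _ hW hVW Set.inter_subset_right _ hb), fun y hy => ?_⟩
    simp [h y hy.1, h' y hy.2]
  regular_inv U hU f hf := by
    have key : ∀ x ∈ {x ∈ U | f x ≠ 0}, ∃ V, IsOpen[S.top] V ∧ i x ∈ V ∧
        i ⁻¹' V ⊆ {x ∈ U | f x ≠ 0} ∧ ∃ g, S.regular V g ∧ ∀ y, i y ∈ V → f⁻¹ y = g (i y) := by
      rintro x ⟨hx, hfx⟩
      obtain ⟨V, hV, hxV, hVU, g, hg, h⟩ := hf x hx
      obtain ⟨h1, h2⟩ := S.regular_inv V hV g hg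
      refine ⟨{y ∈ V | g y ≠ 0}, h1, ⟨hxV, by rwa [← h x hxV]⟩, ?_, g⁻¹, h2, ?_⟩
      · rintro y ⟨hyV, hy⟩
        exact ⟨hVU hyV, by rwa [h y hyV]⟩
      · rintro y ⟨hyV, hy⟩
        simp [h y hyV]
    refine ⟨open_of_forall fun x hx => ?_, key⟩
    obtain ⟨V, hV, hxV, hVU, -⟩ := key x hx
    exact ⟨i ⁻¹' V, ⟨V, hV, rfl⟩, hxV, hVU⟩
  regular_congr U hU f g hfg hf x hx := by
    obtain ⟨V, hV, hxV, hVU, a, ha, h⟩ := hf x hx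
    exact ⟨V, hV, hxV, hVU, a, ha, fun y hy => (hfg (hVU hy)).symm.trans (h y hy)⟩
  regular_mono U V hU hV hVU f hf x hx := by
    obtain ⟨W, hW, hxW, hWU, a, ha, h⟩ := hf x (hVU hx)
    obtain ⟨V', hV', rfl⟩ := hV
    have hWV : IsOpen[S.top] (W ∩ V') := open_inter hW hV'
    exact ⟨W ∩ V', hWV, ⟨hxW, hx⟩, fun y hy => hy.2, a,
      S.regular_mono _ _ hW hWV Set.inter_subset_left _ ha, fun y hy => h y hy.1⟩
  regular_local U hU f h x hx := by
    obtain ⟨V, hV, hxV, hVU, hf⟩ := h x hx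
    obtain ⟨W, hW, hxW, hWV, hg⟩ := hf x hxV
    exact ⟨W, hW, hxW, hWV.trans hVU, hg⟩

/-- The quotient structure along `π : X → Y`: a set is open, and a function is regular, if and only
if its pullback to `X` is.  For the projection to the orbits of an algebraic group acting with
closed orbits on the stable locus, this is the geometric quotient. -/
def coinduced (π : X → Y) (S : FunSpace X) : FunSpace Y where
  top := S.top.coinduced π
  regular U f := S.regular (π ⁻¹' U) (f ∘ π)
  regular_const U hU c := S.regular_const _ hU c
  regular_add U hU f g hf hg := S.regular_add _ hU _ _ hf hg
  regular_mul U hU f g hf hg := S.regular_mul _ hU _ _ hf hg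
  regular_inv U hU f hf := S.regular_inv _ hU _ hf
  regular_congr U hU f g hfg hf := S.regular_congr _ hU _ _ (fun _ hx => hfg hx) hf
  regular_mono U V hU hV hVU f hf := S.regular_mono _ _ hU hV (Set.preimage_mono hVU) _ hf
  regular_local U hU f h := S.regular_local _ hU _ fun x hx => by
    obtain ⟨V, hV, hxV, hVU, hf⟩ := h (π x) hx
    exact ⟨π ⁻¹' V, hV, hxV, Set.preimage_mono hVU, hf⟩

/-- A morphism: a continuous map that pulls regular functions back to regular functions. -/
structure IsMorphism (S : FunSpace X) (T : FunSpace Y) (φ : X → Y) : Prop where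
  continuous : Continuous[S.top, T.top] φ
  regular : ∀ U, IsOpen[T.top] U → ∀ f, T.regular U f → S.regular (φ ⁻¹' U) (f ∘ φ)

/-- A map is dominant if its image is dense. -/
def IsDominant (T : FunSpace Y) (φ : X → Y) : Prop :=
  @Dense Y T.top (Set.range φ)

end FunSpace

/-! ### Configurations of points in projective space -/

/-- `ι`-indexed families of points of the projective space of dimension `n - 1`. -/
abbrev Config (ι : Type) (n : ℕ) : Type := ι → ℙ ℂ (Fin n → ℂ)

/-- Families of nonzero vectors. -/
abbrev VecConfig (ι : Type) (n : ℕ) : Type := {v : ι → Fin n → ℂ // ∀ i, v i ≠ 0}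

/-- The family of points spanned by a family of nonzero vectors. -/
def VecConfig.toConfig {ι : Type} {n : ℕ} (v : VecConfig ι n) : Config ι n :=
  fun i => Projectivization.mk ℂ (v.1 i) (v.2 i)

/-- The product of projective spaces as a variety: the quotient of an open subset of affine space
by the torus that scales the vectors. -/
def configSpace (ι : Type) (n : ℕ) : FunSpace (Config ι n) :=
  ((FunSpace.affine (ι × Fin n)).induced
    (fun (v : VecConfig ι n) (k : ι × Fin n) => v.1 k.1 k.2)).coinduced VecConfig.toConfig

/-- Relabelling: the point with label `σ i` of `permute σ p` is the point with label `i` of `p`. -/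
def permute {ι : Type} {n : ℕ} (σ : Equiv.Perm ι) (p : Config ι n) : Config ι n :=
  fun i => p (σ.symm i)

theorem permute_permute {ι : Type} {n : ℕ} (σ τ : Equiv.Perm ι) (p : Config ι n) :
    permute (σ * τ) p = permute σ (permute τ p) := rfl

/-! ### Six generic points in the plane -/

/-- The plane point `x` lies on the conic `q = 0`. -/
def OnConic (q : QuadraticForm ℂ (Fin 3 → ℂ)) (x : ℙ ℂ (Fin 3 → ℂ)) : Prop :=
  q x.rep = 0

/-- The line through the point `x` of the conic `q = 0` and the point `w` is tangent to the conic
at `x`, that is, `w` lies on the tangent line `{v | polar q x v = 0}`. -/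
def TangentThrough (q : QuadraticForm ℂ (Fin 3 → ℂ)) (x w : ℙ ℂ (Fin 3 → ℂ)) : Prop :=
  QuadraticMap.polar q x.rep w.rep = 0

/-- Labels of six points: `Sum.inl 0, …, Sum.inl 4` for `m₁, …, m₅`, and `Sum.inr 0` for `m₆`. -/
abbrev SixLabels : Type := Fin 5 ⊕ Fin 1

/-- Six points are generic if no three are collinear and they do not lie on a common conic.
(Two coinciding points would be collinear with any third one.) -/
def IsGeneric (m : Config SixLabels 3) : Prop :=
  (∀ i j k, i ≠ j → i ≠ k → j ≠ k → Projectivization.Independent ![m i, m j, m k]) ∧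
    ¬ ∃ q : QuadraticForm ℂ (Fin 3 → ℂ), q ≠ 0 ∧ ∀ i, OnConic q (m i)

/-- The space of generic configurations of six points, the complement of `Δ`. -/
abbrev GenericSix : Type := {m : Config SixLabels 3 // IsGeneric m}

/-- Projective equivalence of generic configurations. -/
instance genericSetoid : Setoid GenericSix :=
  (MulAction.orbitRel SL(3, ℂ) (Config SixLabels 3)).comap Subtype.val

/-- The moduli space of smooth marked cubic surfaces. -/
def MarkedCubics : Type := Quotient genericSetoid

/-- The class of a generic configuration. -/
def MarkedCubics.mk (m : GenericSix) : MarkedCubics := Quotient.mk genericSetoid m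

/-- The moduli space of smooth marked cubic surfaces as a variety: the quotient by `SL₃(ℂ)` of the
open subset of generic configurations. -/
def markedCubicsSpace : FunSpace MarkedCubics :=
  ((configSpace SixLabels 3).induced (Subtype.val : GenericSix → _)).coinduced MarkedCubics.mk

theorem IsGeneric.permute {m : Config SixLabels 3} (h : IsGeneric m) (σ : Equiv.Perm SixLabels) :
    IsGeneric (permute σ m) := by
  refine ⟨fun i j k hij hik hjk => h.1 _ _ _ (by simpa) (by simpa) (by simpa), ?_⟩
  rintro ⟨q, hq, hm⟩
  exact h.2 ⟨q, hq, fun i => by simpa [CubicDM.permute] using hm (σ i)⟩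

/-- `S₅` permutes `m₁, …, m₅`. -/
instance : MulAction (Equiv.Perm (Fin 5)) GenericSix where
  smul σ m := ⟨permute (Equiv.sumCongr σ 1) m.1, m.2.permute _⟩
  one_smul m := Subtype.ext (by funext i; rcases i with i | i <;> rfl)
  mul_smul σ τ m := Subtype.ext (by funext i; rcases i with i | i <;> rfl)

instance : MulAction (Equiv.Perm (Fin 5)) MarkedCubics where
  smul σ := Quotient.map (σ • ·) (by
    rintro m m' ⟨g, hg⟩
    exact ⟨g, by funext i; exact congrFun hg _⟩)
  one_smul x := by
    induction x using Quotient.inductionOn with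
    | h m => exact congrArg MarkedCubics.mk (one_smul _ m)
  mul_smul σ τ x := by
    induction x using Quotient.inductionOn with
    | h m => exact congrArg MarkedCubics.mk (mul_smul σ τ m)

/-! ### The action of `(ℤ/2)⁴` -/

/-- `b` is the residual intersection with the conic `q = 0` of the line joining a point `w` off the
conic with the point `a` of the conic: the second intersection point, or `a` itself if the line is
tangent. -/
def IsResidual (q : QuadraticForm ℂ (Fin 3 → ℂ)) (w a b : ℙ ℂ (Fin 3 → ℂ)) : Prop :=
  OnConic q b ∧ b.submodule ≤ a.submodule ⊔ w.submodule ∧ (b = a ↔ TangentThrough q a w)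

/-- `m'` arises from `m` by replacing each `mᵢ` with `ε i ≠ 0` by the residual intersection of the
line `mᵢ m₆` with the conic through `m₁, …, m₅`. -/
def IsSwitch (ε : Fin 5 → ZMod 2) (m m' : Config SixLabels 3) : Prop :=
  m' (Sum.inr 0) = m (Sum.inr 0) ∧
  ∃ q : QuadraticForm ℂ (Fin 3 → ℂ), q ≠ 0 ∧ (∀ i, OnConic q (m (Sum.inl i))) ∧
    ∀ i, (ε i = 0 → m' (Sum.inl i) = m (Sum.inl i)) ∧
      (ε i ≠ 0 → IsResidual q (m (Sum.inr 0)) (m (Sum.inl i)) (m' (Sum.inl i)))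

/-- The group `(ℤ/2)⁵` modulo its diagonal. -/
abbrev SwitchGroup : Type :=
  (Fin 5 → ZMod 2) ⧸ AddSubgroup.zmultiples (fun _ => 1 : Fin 5 → ZMod 2)

theorem switchGroup_equiv : Nonempty (SwitchGroup ≃+ (Fin 4 → ZMod 2)) := by
  let f : (Fin 5 → ZMod 2) →+ (Fin 4 → ZMod 2) :=
    { toFun := fun ε i => ε i.castSucc - ε (Fin.last 4)
      map_zero' := by funext i; simp
      map_add' := fun a b => by funext i; simp; ring }
  have hsurj : Function.Surjective f := fun δ =>
    ⟨Fin.snoc (α := fun _ => ZMod 2) δ 0, by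
      funext i
      change Fin.snoc (α := fun _ => ZMod 2) δ 0 i.castSucc -
        Fin.snoc (α := fun _ => ZMod 2) δ 0 (Fin.last 4) = δ i
      rw [Fin.snoc_castSucc, Fin.snoc_last, sub_zero]⟩
  have hker : f.ker = AddSubgroup.zmultiples (fun _ => 1 : Fin 5 → ZMod 2) := by
    ext ε
    rw [AddMonoidHom.mem_ker, AddSubgroup.mem_zmultiples_iff]
    constructor
    · intro h
      refine ⟨(ε (Fin.last 4)).val, ?_⟩
      funext i
      have h1 : ε i = ε (Fin.last 4) := by
        induction i using Fin.lastCases with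
        | last => rfl
        | cast i => exact sub_eq_zero.mp (congrFun h i)
      simp [h1]
    · rintro ⟨k, rfl⟩
      funext i
      simp [f]
  exact ⟨(QuotientAddGroup.quotientAddEquivOfEq hker.symm).trans
    (QuotientAddGroup.quotientKerEquivOfSurjective f hsurj)⟩

/-- The group acts on the moduli space by switching points as in `IsSwitch`. -/
def IsSwitchAction (act : AddAction SwitchGroup MarkedCubics) : Prop :=
  ∀ (ε : Fin 5 → ZMod 2) (m : GenericSix),
    (∃ m' : Config SixLabels 3, IsSwitch ε m.1 m') ∧
    ∀ m' : Config SixLabels 3, IsSwitch ε m.1 m' → ∃ h : IsGeneric m',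
      act.vadd (QuotientAddGroup.mk ε) (MarkedCubics.mk m) = MarkedCubics.mk ⟨m', h⟩

/-! ### Weighted points on the line -/

section Weighted

open Classical in
/-- The total weight of the points of `p` that are located at `x`. -/
def weightAt {ι : Type} [Fintype ι] (μ : ι → ℕ) (p : Config ι 2) (x : ℙ ℂ (Fin 2 → ℂ)) : ℕ :=
  ∑ i, if p i = x then μ i else 0

/-- Stability of weighted points on the line: the weight located at any point is less than half of
the total weight. -/
def IsStable {ι : Type} [Fintype ι] (μ : ι → ℕ) (p : Config ι 2) : Prop :=
  ∀ x, 2 * weightAt μ p x < ∑ i, μ i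

open Classical in
/-- The multiset of the weights of the distinct locations of the points of `p`. -/
def weightType {ι : Type} [Fintype ι] (μ : ι → ℕ) (p : Config ι 2) : Multiset ℕ :=
  (Finset.univ.image p).val.map (weightAt μ p)

abbrev StableConfig {ι : Type} [Fintype ι] (μ : ι → ℕ) : Type := {p : Config ι 2 // IsStable μ p}

instance stableSetoid {ι : Type} [Fintype ι] (μ : ι → ℕ) : Setoid (StableConfig μ) :=
  (MulAction.orbitRel SL(2, ℂ) (Config ι 2)).comap Subtype.val

/-- The moduli space of stable weighted points on the line. -/
def DM {ι : Type} [Fintype ι] (μ : ι → ℕ) : Type := Quotient (stableSetoid μ)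

/-- The class of a stable configuration. -/
def DM.mk {ι : Type} [Fintype ι] {μ : ι → ℕ} (p : StableConfig μ) : DM μ :=
  Quotient.mk (stableSetoid μ) p

/-- The moduli space of stable weighted points as a variety: the quotient by `SL₂(ℂ)` of the open
subset of stable configurations. -/
def dmSpace {ι : Type} [Fintype ι] (μ : ι → ℕ) : FunSpace (DM μ) :=
  ((configSpace ι 2).induced (Subtype.val : StableConfig μ → _)).coinduced DM.mk

end Weighted

/-! ### The space for the weights `(2⁵, 1²)` -/

/-- Labels of seven points: `Sum.inl` for `p₁, …, p₅` and `Sum.inr` for `p₆, p₇`. -/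
abbrev SevenLabels : Type := Fin 5 ⊕ Fin 2

/-- The weights `(2⁵, 1²)`. -/
def mu : SevenLabels → ℕ := Sum.elim (fun _ => 2) (fun _ => 1)

theorem IsStable.permute {p : Config SevenLabels 2} (h : IsStable mu p)
    (σ : Equiv.Perm (Fin 5)) (τ : Equiv.Perm (Fin 2)) :
    IsStable mu (permute (Equiv.sumCongr σ τ) p) := by
  intro x
  have : weightAt mu (CubicDM.permute (Equiv.sumCongr σ τ) p) x = weightAt mu p x := by
    unfold weightAt
    refine Fintype.sum_equiv (Equiv.sumCongr σ τ).symm _ _ fun i => ?_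
    rcases i with i | i <;> rfl
  rw [this]
  exact h x

/-- `S₅` permutes `p₁, …, p₅`, and `S₂ = ℤ/2` permutes `p₆, p₇`. -/
instance : MulAction (Equiv.Perm (Fin 5) × Equiv.Perm (Fin 2)) (StableConfig mu) where
  smul σ p := ⟨permute (Equiv.sumCongr σ.1 σ.2) p.1, p.2.permute _ _⟩
  one_smul p := Subtype.ext (by funext i; rcases i with i | i <;> rfl)
  mul_smul σ τ p := Subtype.ext (by funext i; rcases i with i | i <;> rfl)

instance : MulAction (Equiv.Perm (Fin 5) × Equiv.Perm (Fin 2)) (DM mu) where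
  smul σ := Quotient.map (σ • ·) (by
    rintro p p' ⟨g, hg⟩
    exact ⟨g, by funext i; exact congrFun hg _⟩)
  one_smul x := by
    induction x using Quotient.inductionOn with
    | h p => exact congrArg DM.mk (one_smul _ p)
  mul_smul σ τ x := by
    induction x using Quotient.inductionOn with
    | h p => exact congrArg DM.mk (mul_smul σ τ p)

instance : MulAction (Equiv.Perm (Fin 2)) (DM mu) :=
  MulAction.compHom (DM mu) (MonoidHom.inr (Equiv.Perm (Fin 5)) (Equiv.Perm (Fin 2)))

instance : MulAction (Equiv.Perm (Fin 5)) (DM mu) :=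
  MulAction.compHom (DM mu) (MonoidHom.inl (Equiv.Perm (Fin 5)) (Equiv.Perm (Fin 2)))

theorem smul_smul_comm (σ : Equiv.Perm (Fin 5)) (τ : Equiv.Perm (Fin 2)) (x : DM mu) :
    σ • τ • x = τ • σ • x := by
  change ((σ, 1) : Equiv.Perm (Fin 5) × Equiv.Perm (Fin 2)) •
      ((1, τ) : Equiv.Perm (Fin 5) × Equiv.Perm (Fin 2)) • x =
    ((1, τ) : Equiv.Perm (Fin 5) × Equiv.Perm (Fin 2)) •
      ((σ, 1) : Equiv.Perm (Fin 5) × Equiv.Perm (Fin 2)) • x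
  simp [smul_smul]

/-- The quotient of the space for the weights `(2⁵, 1²)` by the group `S₂ = ℤ/2` that interchanges
the two points of weight one. -/
def DMmod2 : Type := MulAction.orbitRel.Quotient (Equiv.Perm (Fin 2)) (DM mu)

/-- The class of a point of `DM mu`. -/
def DMmod2.mk (x : DM mu) : DMmod2 := Quotient.mk (MulAction.orbitRel _ _) x

/-- The quotient by `ℤ/2` as a variety. -/
def dmMod2Space : FunSpace DMmod2 := (dmSpace mu).coinduced DMmod2.mk

instance : MulAction (Equiv.Perm (Fin 5)) DMmod2 where
  smul σ := Quotient.map (σ • ·) (by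
    rintro x y ⟨τ, rfl⟩
    exact ⟨τ, (smul_smul_comm σ τ y).symm⟩)
  one_smul x := by
    induction x using Quotient.inductionOn with
    | h p => exact congrArg DMmod2.mk (one_smul _ p)
  mul_smul σ τ x := by
    induction x using Quotient.inductionOn with
    | h p => exact congrArg DMmod2.mk (mul_smul σ τ p)

/-- The stratum of the classes of the configurations whose distinct locations carry the
weights `ν`. -/
def stratum (ν : Multiset ℕ) : Set DMmod2 :=
  {y | ∃ p : StableConfig mu, weightType mu p.1 = ν ∧ y = DMmod2.mk (DM.mk p)}

/-- The union of the strata with the weights `(2⁵, 1²)`, `(3, 2⁴, 1)` and `(3², 2³)`. -/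
def smoothStrata : Set DMmod2 :=
  stratum (Multiset.replicate 5 2 + Multiset.replicate 2 1) ∪
    stratum ({3} + Multiset.replicate 4 2 + {1}) ∪
    stratum (Multiset.replicate 2 3 + Multiset.replicate 3 2)

/-! ### From six points in the plane to seven points on the line -/

/-- `p` is obtained from `m` by projection from `m₆` (a linear map `π` with kernel the line `m₆`)
of `m₁, …, m₅` and of the two points of contact of the tangents through `m₆` to the conic through
`m₁, …, m₅`. -/
def IsProjection (m : Config SixLabels 3) (p : Config SevenLabels 2) : Prop :=
  ∃ (q : QuadraticForm ℂ (Fin 3 → ℂ)) (t : Fin 2 → ℙ ℂ (Fin 3 → ℂ))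
    (π : (Fin 3 → ℂ) →ₗ[ℂ] (Fin 2 → ℂ)),
    q ≠ 0 ∧ (∀ i, OnConic q (m (Sum.inl i))) ∧
    t 0 ≠ t 1 ∧ (∀ j, OnConic q (t j) ∧ TangentThrough q (t j) (m (Sum.inr 0))) ∧
    LinearMap.ker π = (m (Sum.inr 0)).submodule ∧
    (∀ i, (p (Sum.inl i)).submodule = (m (Sum.inl i)).submodule.map π) ∧
    (∀ j, (p (Sum.inr j)).submodule = (t j).submodule.map π)

/-- `Φ` is the map induced by `IsProjection` on projective equivalence classes. -/
def IsPhi (Φ : MarkedCubics → DMmod2) : Prop :=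
  ∀ m : GenericSix, (∃ p, IsProjection m.1 p) ∧
    ∀ p, IsProjection m.1 p → ∃ h : IsStable mu p,
      Φ (MarkedCubics.mk m) = DMmod2.mk (DM.mk ⟨p, h⟩)

/-! ### The quotient by `(ℤ/2)⁴` -/

section Quotient

variable [AddAction SwitchGroup MarkedCubics]

/-- The quotient of the moduli space of smooth marked cubic surfaces by the action of `(ℤ/2)⁴`. -/
abbrev CubicsModSwitch : Type := AddAction.orbitRel.Quotient SwitchGroup MarkedCubics

/-- The projection to the quotient. -/
def CubicsModSwitch.mk (x : MarkedCubics) : CubicsModSwitch :=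
  Quotient.mk (AddAction.orbitRel SwitchGroup MarkedCubics) x

/-- The quotient as a variety. -/
def cubicsModSwitchSpace : FunSpace CubicsModSwitch :=
  markedCubicsSpace.coinduced CubicsModSwitch.mk

end Quotient

end CubicDM

end

open CubicDM FunSpace

/-!
Both moduli spaces are quotients of one affine variety, the `Cover`: five points `(a, b, c)` of the
cone `a b = c ^ 2` in three-space whose ratios `a : b` are distinct.  Such data give six points in
the plane, the five points on the conic `x y = z ^ 2` together with `(0 : 0 : 1)`, whose tangents to
the conic are `x = 0` and `y = 0`.  They also give seven points on the line, the projections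
`(a : b)` together with the projections `(1 : 0)` and `(0 : 1)` of the points of contact.  The sign
of `c` is lost in the projection, and changing it is exactly the switch of the point.

*Every configuration comes from the cover.*  A conic through five points, no three of which are
collinear, is unique up to a scalar (`exists_smul_eq_of_conics`) and nondegenerate, and the equation
of its pair of tangents through the sixth point splits after a square root of its discriminant is
adjoined.  This gives coordinates in which the conic and the sixth point have the normal form
(`exists_cover_of_adapted`).  Seven points on the line lie in one of the three strata if and only if
the points of weight two are distinct and so are those of weight one (`weightType_mem_iff`); if the
points of weight one are moved to `(1 : 0)` and `(0 : 1)`, five square roots `c` of `a b` remain to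
be chosen (`exists_cover_of_isSeparated`).

*The fibres agree.*  A projective transformation of the line that preserves the pair `(1 : 0)`,
`(0 : 1)` is diagonal or antidiagonal, and it lifts to the plane up to the signs of the `c`
(`Cover.exists_switch_of_toDM_eq`).  The switches and the projection are intrinsic to the six
points because of the uniqueness of the conic (`Cover.eq_of_isSwitch`,
`Cover.exists_of_isProjection`).

*The varieties agree.*  Both normal forms are polynomial in the homogeneous coordinates and in
square roots of polynomials.  A function that is locally polynomial after square roots are
adjoined, and that does not depend on their choice, is locally polynomial (`locPoly_of_roots`): sum
over all choices of the signs.  Hence openness and regularity on either moduli space can be tested on the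
cover (`Cover.isQuotientOf_toMarked`, `Cover.isQuotientOf_toStrata`), and two quotients of the cover
with the same fibres are isomorphic.  The image is dense since it is the nonvanishing locus of
polynomials in homogeneous coordinates.
-/

noncomputable section

namespace CubicDM

open MvPolynomial

/-! ### Polynomial functions and locally polynomial data -/

/-- The function `f` on affine space is given by a polynomial. -/
def IsPoly {κ : Type} (f : (κ → ℂ) → ℂ) : Prop := ∃ p : MvPolynomial κ ℂ, ∀ x, eval x p = f x

namespace IsPoly

variable {κ : Type} {f g : (κ → ℂ) → ℂ}

theorem const (c : ℂ) : IsPoly (fun _ : κ → ℂ => c) := ⟨C c, by simp⟩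

theorem coord (k : κ) : IsPoly (fun x : κ → ℂ => x k) := ⟨X k, by simp⟩

theorem add (hf : IsPoly f) (hg : IsPoly g) : IsPoly (fun x => f x + g x) := by
  obtain ⟨p, hp⟩ := hf
  obtain ⟨q, hq⟩ := hg
  exact ⟨p + q, fun x => by rw [map_add, hp, hq]⟩

theorem mul (hf : IsPoly f) (hg : IsPoly g) : IsPoly (fun x => f x * g x) := by
  obtain ⟨p, hp⟩ := hf
  obtain ⟨q, hq⟩ := hg
  exact ⟨p * q, fun x => by rw [map_mul, hp, hq]⟩

theorem neg (hf : IsPoly f) : IsPoly (fun x => -f x) := by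
  obtain ⟨p, hp⟩ := hf
  exact ⟨-p, fun x => by rw [map_neg, hp]⟩

theorem sub (hf : IsPoly f) (hg : IsPoly g) : IsPoly (fun x => f x - g x) := by
  simpa only [sub_eq_add_neg] using hf.add hg.neg

theorem pow (hf : IsPoly f) (n : ℕ) : IsPoly (fun x => f x ^ n) := by
  obtain ⟨p, hp⟩ := hf
  exact ⟨p ^ n, fun x => by rw [map_pow, hp]⟩

theorem prod {ι : Type} (s : Finset ι) {F : ι → (κ → ℂ) → ℂ} (h : ∀ i, IsPoly (F i)) :
    IsPoly (fun x => ∏ i ∈ s, F i x) := by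
  choose p hp using h
  exact ⟨∏ i ∈ s, p i, fun x => by simp [hp]⟩

theorem comp {κ' : Type} (hf : IsPoly f) {G : κ → (κ' → ℂ) → ℂ} (hG : ∀ k, IsPoly (G k)) :
    IsPoly (fun x => f (fun k => G k x)) := by
  obtain ⟨p, hp⟩ := hf
  choose r hr using hG
  refine ⟨bind₁ r p, fun x => ?_⟩
  change _ = f fun k => G k x
  rw [← hp, ← MvPolynomial.coe_aeval_eq_eval, ← MvPolynomial.coe_aeval_eq_eval]
  simp only [RingHom.coe_coe, aeval_bind₁]
  congr 2
  funext k
  rw [← hr k x, ← MvPolynomial.coe_aeval_eq_eval]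
  rfl

end IsPoly

/-- Near each point of `U` the function `f` is a fraction with polynomial numerator and
denominator in the coordinates `i`, the nonvanishing of the denominator implying membership
in `U`.  For the structure on `X` induced by the coordinates `i` this says that `U` is open and
that `f` is regular on `U`. -/
def LocPoly {X κ : Type} (i : X → κ → ℂ) (U : Set X) (f : X → ℂ) : Prop :=
  ∀ x ∈ U, ∃ H P : (κ → ℂ) → ℂ, IsPoly H ∧ IsPoly P ∧ H (i x) ≠ 0 ∧
    ∀ y, H (i y) ≠ 0 → y ∈ U ∧ f y * H (i y) = P (i y)

theorem isOpen_zariski_iff {κ : Type} {V : Set (κ → ℂ)} :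
    IsOpen[zariski κ] V ↔
      ∀ x ∈ V, ∃ H : (κ → ℂ) → ℂ, IsPoly H ∧ H x ≠ 0 ∧ ∀ y, H y ≠ 0 → y ∈ V := by
  constructor
  · intro hV
    induction hV with
    | basic s hs =>
      obtain ⟨p, rfl⟩ := hs
      exact fun x hx => ⟨fun y => eval y p, ⟨p, fun _ => rfl⟩, hx, fun y hy => hy⟩
    | univ => exact fun x _ => ⟨fun _ => 1, .const 1, one_ne_zero, fun y _ => trivial⟩
    | inter s t _ _ hs ht =>
      rintro x ⟨hxs, hxt⟩
      obtain ⟨H, hH, h1, h2⟩ := hs x hxs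
      obtain ⟨H', hH', h1', h2'⟩ := ht x hxt
      exact ⟨fun y => H y * H' y, hH.mul hH', mul_ne_zero h1 h1', fun y hy =>
        ⟨h2 y (left_ne_zero_of_mul hy), h2' y (right_ne_zero_of_mul hy)⟩⟩
    | sUnion S _ hS =>
      rintro x ⟨s, hs, hx⟩
      obtain ⟨H, hH, h1, h2⟩ := hS s hs x hx
      exact ⟨H, hH, h1, fun y hy => ⟨s, hs, h2 y hy⟩⟩
  · intro h
    refine open_of_forall fun x hx => ?_
    obtain ⟨H, ⟨p, hp⟩, h1, h2⟩ := h x hx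
    exact ⟨{y | eval y p ≠ 0}, TopologicalSpace.isOpen_generateFrom_of_mem ⟨p, rfl⟩,
      by rwa [Set.mem_ofPred_eq, hp], fun y hy => h2 y (by rwa [← hp])⟩

section Induced

variable {X κ : Type} {i : X → κ → ℂ} {U : Set X} {f : X → ℂ}

theorem LocPoly.isOpen (h : LocPoly i U f) : IsOpen[((affine κ).induced i).top] U := by
  refine open_of_forall fun x hx => ?_
  obtain ⟨H, P, hH, -, h1, h2⟩ := h x hx
  exact ⟨i ⁻¹' {w | H w ≠ 0}, ⟨{w | H w ≠ 0}, isOpen_zariski_iff.2 fun w hw =>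
    ⟨H, hH, hw, fun _ h => h⟩, rfl⟩, h1, fun y hy => (h2 y hy).1⟩

theorem LocPoly.regular (h : LocPoly i U f) : ((affine κ).induced i).regular U f := by
  intro x hx
  obtain ⟨H, P, hH, hP, h1, h2⟩ := h x hx
  refine ⟨{w | H w ≠ 0}, isOpen_zariski_iff.2 fun w hw => ⟨H, hH, hw, fun _ h => h⟩, h1,
    fun y hy => (h2 y hy).1, fun w => P w / H w, ?_, fun y hy => ?_⟩
  · obtain ⟨p, hp⟩ := hP
    obtain ⟨q, hq⟩ := hH
    refine fun w hw => ⟨{w | H w ≠ 0}, isOpen_zariski_iff.2 fun w hw => ⟨H, ⟨q, hq⟩, hw,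
      fun _ h => h⟩, hw, le_rfl, p, q, fun y hy => ⟨by rwa [hq], by rw [hp, hq]⟩⟩
  · rw [eq_div_iff hy, (h2 y hy).2]

theorem locPoly_of_regular (hf : ((affine κ).induced i).regular U f) : LocPoly i U f := by
  intro x hx
  obtain ⟨V, hV, hxV, hVU, g, hg, hfg⟩ := hf x hx
  obtain ⟨W, hW, hxW, hWV, p, q, hpq⟩ := hg (i x) hxV
  obtain ⟨H, hH, h1, h2⟩ := isOpen_zariski_iff.1 hW (i x) hxW
  refine ⟨fun w => H w * eval w q, fun w => H w * eval w p, hH.mul ⟨q, fun _ => rfl⟩,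
    hH.mul ⟨p, fun _ => rfl⟩, mul_ne_zero h1 (hpq _ hxW).1, fun y hy => ?_⟩
  have hyW := h2 _ (left_ne_zero_of_mul hy)
  refine ⟨hVU (hWV hyW), ?_⟩
  have hq := (hpq _ hyW).1
  rw [hfg y (hWV hyW), (hpq _ hyW).2]
  field_simp

end Induced

/-! ### Descent along square roots -/

section Roots

variable {κ ι : Type}

/-- Change of sign of the square roots with `ε j = true`. -/
def flipSigns (ε : ι → Bool) (s : ι → ℂ) : ι → ℂ := fun j => if ε j then -s j else s j

theorem flipSigns_sq (ε : ι → Bool) (s : ι → ℂ) (j : ι) : flipSigns ε s j ^ 2 = s j ^ 2 := by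
  unfold flipSigns
  split_ifs <;> ring

variable [Fintype ι] [DecidableEq ι]

/-- A polynomial in `x` and square roots `s j` of the polynomials `K j` of `x` becomes a polynomial
in `x` when it is summed over all choices of the signs of the roots. -/
theorem IsPoly.trace {K : ι → (κ → ℂ) → ℂ} (hK : ∀ j, IsPoly (K j)) {A : (κ ⊕ ι → ℂ) → ℂ}
    (hA : IsPoly A) : ∃ T : (κ → ℂ) → ℂ, IsPoly T ∧ ∀ x s, (∀ j, s j ^ 2 = K j x) →
      ∑ ε : ι → Bool, A (Sum.elim x (flipSigns ε s)) = T x := by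
  obtain ⟨p, hp⟩ := hA
  obtain rfl : (fun w => eval w p) = A := funext hp
  clear hp
  induction p using MvPolynomial.induction_on' with
  | add p q hp hq =>
    obtain ⟨T, hT, h⟩ := hp
    obtain ⟨T', hT', h'⟩ := hq
    refine ⟨_, hT.add hT', fun x s hs => ?_⟩
    simp only [map_add, Finset.sum_add_distrib]
    rw [← h x s hs, ← h' x s hs]
  | monomial m c =>
    have key : ∀ j, ∃ T : (κ → ℂ) → ℂ, IsPoly T ∧ ∀ x (t : ℂ), t ^ 2 = K j x →
        (-t) ^ m (Sum.inr j) + t ^ m (Sum.inr j) = T x := by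
      intro j
      rcases Nat.even_or_odd (m (Sum.inr j)) with he | ho
      · obtain ⟨r, hr⟩ := he
        refine ⟨fun x => K j x ^ r + K j x ^ r, ((hK j).pow r).add ((hK j).pow r), ?_⟩
        intro x t ht
        have : m (Sum.inr j) = 2 * r := by omega
        rw [this, pow_mul, pow_mul, neg_sq, ht]
      · exact ⟨fun _ => 0, .const 0, fun x t _ => by rw [ho.neg_pow]; ring⟩
    choose T hT h using key
    let M : (κ → ℂ) → ℂ := fun x => m.prod fun k n => Sum.elim (fun k => x k) (fun _ => 1) k ^ n
    have hM : IsPoly M := by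
      refine IsPoly.prod _ fun k => IsPoly.pow ?_ _
      rcases k with k | k
      · exact .coord k
      · exact .const 1
    refine ⟨fun x => c * M x * ∏ j, T j x, ((IsPoly.const c).mul hM).mul (IsPoly.prod _ hT), ?_⟩
    intro x s hs
    have hsplit : ∀ t : ι → ℂ, eval (Sum.elim x t) (monomial m c) =
        c * M x * ∏ j, t j ^ m (Sum.inr j) := by
      intro t
      have h2 : ∏ j, t j ^ m (Sum.inr j) =
          m.prod fun k n => Sum.elim (fun _ => 1) (fun j => t j) k ^ n := by
        classical
        rw [Finsupp.prod, ← Finset.prod_subset (Finset.subset_univ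
          ((Finset.univ : Finset ι).filter fun j => Sum.inr j ∈ m.support))]
        · symm
          refine (Finset.prod_subset (s₁ := ((Finset.univ : Finset ι).filter
            fun j => Sum.inr j ∈ m.support).map ⟨Sum.inr, Sum.inr_injective⟩) ?_ ?_).symm.trans ?_
          · intro k hk
            simp only [Finset.mem_map, Finset.mem_filter] at hk
            obtain ⟨j, hj, rfl⟩ := hk
            exact hj.2
          · rintro (k | k) hk hk'
            · simp
            · exact (hk' (Finset.mem_map.2 ⟨k, by simpa using hk, rfl⟩)).elim
          · simp
        · intro j _ hj
          simp at hj
          simp [hj]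
      rw [eval_monomial, h2, mul_assoc]
      congr 1
      simp only [M, Finsupp.prod, ← Finset.prod_mul_distrib, ← mul_pow]
      refine Finset.prod_congr rfl fun k _ => ?_
      rcases k with k | k <;> simp
    simp only [hsplit, ← Finset.mul_sum]
    congr 1
    rw [← Finset.prod_congr rfl fun j _ => h j x (s j) (hs j)]
    have := Finset.prod_univ_sum (fun _ : ι => (Finset.univ : Finset Bool))
      (fun j b => (if b then -s j else s j) ^ m (Sum.inr j))
    simp only [Fintype.univ_bool, Finset.mem_singleton, Bool.true_eq_false, not_false_eq_true,
      Finset.sum_insert, if_true, Finset.sum_singleton, Bool.false_eq_true, if_false] at this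
    rw [this]
    refine Finset.sum_congr ?_ fun ε _ => rfl
    ext ε
    simp

/-- Data that are locally polynomial in the coordinates and in square roots of polynomials in the
coordinates, for every choice of the roots, are locally polynomial in the coordinates.
Multiplication by `∏ (t j + s j)` singles out the given choice `s` among all the choices of signs
at the given point, so that the sum over the signs does not vanish there. -/
theorem locPoly_of_roots {X : Type} {i : X → κ → ℂ} {U : Set X} {f : X → ℂ}
    {K : ι → (κ → ℂ) → ℂ} (hK : ∀ j, IsPoly (K j))
    (h : ∀ x ∈ U, ∃ s : ι → ℂ, (∀ j, s j ^ 2 = K j (i x)) ∧ ∃ A B : (κ ⊕ ι → ℂ) → ℂ,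
      IsPoly A ∧ IsPoly B ∧ A (Sum.elim (i x) s) ≠ 0 ∧
      ∀ y t, (∀ j, t j ^ 2 = K j (i y)) → A (Sum.elim (i y) t) ≠ 0 →
        y ∈ U ∧ f y * A (Sum.elim (i y) t) = B (Sum.elim (i y) t)) :
    LocPoly i U f := by
  intro x hx
  obtain ⟨s, hs, A, B, hA, hB, hAx, hAB⟩ := h x hx
  let c : (κ ⊕ ι → ℂ) → ℂ := fun w => ∏ j, if s j = 0 then 1 else w (Sum.inr j) + s j
  have hc : IsPoly c := by
    refine IsPoly.prod _ fun j => ?_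
    split_ifs
    · exact .const 1
    · exact (IsPoly.coord _).add (.const _)
  obtain ⟨T, hT, hT'⟩ := IsPoly.trace hK (hc.mul hA)
  -- the factor `A` makes both sides of `f * A = B` vanish where `A` vanishes
  obtain ⟨R, hR, hR'⟩ := IsPoly.trace hK (hc.mul (hA.mul hA))
  obtain ⟨Q, hQ, hQ'⟩ := IsPoly.trace hK (hc.mul (hA.mul hB))
  have hcs : c (Sum.elim (i x) s) ≠ 0 := by
    refine Finset.prod_ne_zero_iff.2 fun j _ => ?_
    split_ifs with h0
    · exact one_ne_zero
    · simpa [← two_mul] using h0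
  refine ⟨R, Q, hR, hQ, ?_, fun y hy => ?_⟩
  · rw [← hR' _ _ hs]
    have hterm : ∀ ε : ι → Bool, c (Sum.elim (i x) (flipSigns ε s)) *
        (A (Sum.elim (i x) (flipSigns ε s)) * A (Sum.elim (i x) (flipSigns ε s))) =
        if ∀ j, ε j = true → s j = 0 then c (Sum.elim (i x) s) *
          (A (Sum.elim (i x) s) * A (Sum.elim (i x) s)) else 0 := by
      intro ε
      split_ifs with h0
      · have : flipSigns ε s = s := by
          funext j
          unfold flipSigns
          split_ifs with h1
          · simp [h0 j h1]
          · rfl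
        rw [this]
      · push Not at h0
        obtain ⟨j, hj, hj'⟩ := h0
        have : c (Sum.elim (i x) (flipSigns ε s)) = 0 := by
          refine Finset.prod_eq_zero (Finset.mem_univ j) ?_
          simp [hj', flipSigns, hj]
        rw [this, zero_mul]
    simp only [hterm, ← Finset.sum_filter, Finset.sum_const, nsmul_eq_mul]
    refine mul_ne_zero ?_ (mul_ne_zero hcs (mul_ne_zero hAx hAx))
    rw [Nat.cast_ne_zero, Finset.card_ne_zero]
    exact ⟨fun _ => false, by simp⟩
  · choose t ht using fun j => IsSquare.exists_sq (K j (i y)) (IsAlgClosed.exists_eq_mul_self _)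
    have ht : ∀ j, t j ^ 2 = K j (i y) := fun j => (ht j).symm
    have htε : ∀ ε j, flipSigns ε t j ^ 2 = K j (i y) := fun ε j => by rw [flipSigns_sq, ht]
    rw [← hR' _ _ ht] at hy ⊢
    rw [← hQ' _ _ ht]
    constructor
    · obtain ⟨ε, -, hε⟩ := Finset.exists_ne_zero_of_sum_ne_zero hy
      exact (hAB y _ (htε ε) (left_ne_zero_of_mul (right_ne_zero_of_mul hε))).1
    · rw [Finset.mul_sum]
      refine Finset.sum_congr rfl fun ε _ => ?_
      by_cases h0 : A (Sum.elim (i y) (flipSigns ε t)) = 0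
      · rw [h0]
        ring
      · rw [← (hAB y _ (htε ε) h0).2]
        ring

/-- Locally polynomial data on `Z` give locally polynomial data on `X` if, locally on `X`, a
polynomial map from `X` with adjoined square roots to `Z` is compatible with the data. -/
theorem LocPoly.transfer {X Z l : Type} {i : X → κ → ℂ} {j : Z → l → ℂ} {U : Set X} {f : X → ℂ}
    {W : Set Z} {g : Z → ℂ} (hg : LocPoly j W g) {K : ι → (κ → ℂ) → ℂ} (hK : ∀ j, IsPoly (K j))
    (h : ∀ x ∈ U, ∃ (D : (κ ⊕ ι → ℂ) → ℂ) (N : l → (κ ⊕ ι → ℂ) → ℂ), IsPoly D ∧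
      (∀ k, IsPoly (N k)) ∧ (∀ s, (∀ j, s j ^ 2 = K j (i x)) → D (Sum.elim (i x) s) ≠ 0) ∧
      ∀ y s, (∀ j, s j ^ 2 = K j (i y)) → D (Sum.elim (i y) s) ≠ 0 →
        ∃ z, (∀ k, j z k = N k (Sum.elim (i y) s)) ∧ (y ∈ U ↔ z ∈ W) ∧ f y = g z) :
    LocPoly i U f := by
  refine locPoly_of_roots hK fun x hx => ?_
  obtain ⟨D, N, hD, hN, hDx, hDN⟩ := h x hx
  choose s hs using fun j => IsSquare.exists_sq (K j (i x)) (IsAlgClosed.exists_eq_mul_self _)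
  have hs : ∀ j, s j ^ 2 = K j (i x) := fun j => (hs j).symm
  refine ⟨s, hs, ?_⟩
  obtain ⟨z, hz, hxz, -⟩ := hDN x s hs (hDx s hs)
  obtain ⟨H, P, hH, hP, h1, h2⟩ := hg z (hxz.1 hx)
  refine ⟨fun w => D w * H (fun k => N k w), fun w => D w * P (fun k => N k w),
    hD.mul (hH.comp hN), hD.mul (hP.comp hN), ?_, fun y t ht hne => ?_⟩
  · refine mul_ne_zero (hDx s hs) ?_
    rwa [← funext hz]
  · obtain ⟨z', hz', hyz, hfg⟩ := hDN y t ht (left_ne_zero_of_mul hne)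
    have hne' := right_ne_zero_of_mul hne
    simp only [← hz'] at hne' ⊢
    obtain ⟨h3, h4⟩ := h2 z' hne'
    refine ⟨hyz.2 h3, ?_⟩
    rw [hfg, ← h4]
    ring

end Roots

/-! ### Morphisms and quotients of spaces with functions -/

namespace FunSpace

variable {X Y W : Type} {S : FunSpace X} {T : FunSpace Y} {R : FunSpace W}

theorem IsMorphism.comp {φ : X → Y} {ψ : Y → W} (hψ : IsMorphism T R ψ) (hφ : IsMorphism S T φ) :
    IsMorphism S R (ψ ∘ φ) where
  continuous := @Continuous.comp _ _ _ S.top T.top R.top _ _ hψ.continuous hφ.continuous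
  regular U hU f hf := hφ.regular _ (@IsOpen.preimage _ _ T.top R.top _ hψ.continuous _ hU) _
    (hψ.regular U hU f hf)

theorem isMorphism_induced (i : X → Y) : IsMorphism (T.induced i) T i where
  continuous := @continuous_induced_dom _ _ i T.top
  regular U hU f hf _ hx := ⟨U, hU, hx, le_rfl, f, hf, fun _ _ => rfl⟩

theorem isMorphism_coinduced (π : X → Y) : IsMorphism S (S.coinduced π) π where
  continuous := @continuous_coinduced_rng _ _ π S.top
  regular _ _ _ hf := hf

/-- A map into a subvariety is a morphism if the composite with the inclusion is one. -/
theorem IsMorphism.codRestrict {i : Y → W} {φ : X → Y} (h : IsMorphism S R (i ∘ φ)) :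
    IsMorphism S (R.induced i) φ where
  continuous := (@continuous_induced_rng _ _ _ i φ R.top S.top).2 h.continuous
  regular U hU f hf := by
    have hc : Continuous[S.top, (R.induced i).top] φ :=
      (@continuous_induced_rng _ _ _ i φ R.top S.top).2 h.continuous
    have hU' : IsOpen[S.top] (φ ⁻¹' U) := @IsOpen.preimage _ _ S.top (R.induced i).top _ hc _ hU
    refine S.regular_local _ hU' _ fun x hx => ?_
    obtain ⟨V, hV, hxV, hVU, g, hg, hfg⟩ := hf (φ x) hx
    have hV' : IsOpen[S.top] (i ∘ φ ⁻¹' V) :=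
      @IsOpen.preimage _ _ S.top R.top _ h.continuous _ hV
    exact ⟨i ∘ φ ⁻¹' V, hV', hxV, fun y hy => hVU hy,
      S.regular_congr _ hV' _ _ (fun y hy => (hfg (φ y) hy).symm) (h.regular V hV g hg)⟩

/-- `π` exhibits `T` as the quotient of `S`: openness and regularity can be tested after pulling
back along `π`. -/
structure IsQuotientOf (S : FunSpace X) (T : FunSpace Y) (π : X → Y) : Prop where
  isMorphism : IsMorphism S T π
  descend : ∀ U f, IsOpen[S.top] (π ⁻¹' U) → S.regular (π ⁻¹' U) (f ∘ π) →
    IsOpen[T.top] U ∧ T.regular U f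

theorem isQuotientOf_coinduced (π : X → Y) : IsQuotientOf S (S.coinduced π) π :=
  ⟨isMorphism_coinduced π, fun _ _ h h' => ⟨h, h'⟩⟩

theorem IsQuotientOf.comp {π : X → Y} {ρ : Y → W} (hρ : IsQuotientOf T R ρ)
    (hπ : IsQuotientOf S T π) : IsQuotientOf S R (ρ ∘ π) where
  isMorphism := hρ.isMorphism.comp hπ.isMorphism
  descend U f h h' := by
    obtain ⟨h1, h2⟩ := hπ.descend (ρ ⁻¹' U) (f ∘ ρ) h h'
    exact hρ.descend U f h1 h2

theorem IsQuotientOf.isMorphism_of_comp {π : X → Y} (hπ : IsQuotientOf S T π) {φ : Y → W}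
    (h : IsMorphism S R (φ ∘ π)) : IsMorphism T R φ where
  continuous := by
    refine (@continuous_def _ _ T.top R.top _).2 fun U hU => ?_
    have hU' : IsOpen[S.top] (π ⁻¹' (φ ⁻¹' U)) :=
      @IsOpen.preimage _ _ S.top R.top _ h.continuous _ hU
    exact (hπ.descend _ (fun _ => 0) hU' (S.regular_const _ hU' 0)).1
  regular U hU f hf := by
    have hU' : IsOpen[S.top] (π ⁻¹' (φ ⁻¹' U)) :=
      @IsOpen.preimage _ _ S.top R.top _ h.continuous _ hU
    exact (hπ.descend _ (f ∘ φ) hU' (h.regular U hU f hf)).2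

/-- A polynomial map is a morphism for the structures induced by coordinates. -/
theorem isMorphism_of_isPoly {κ l : Type} {i : X → κ → ℂ} {j : Y → l → ℂ} {φ : X → Y}
    (N : l → (κ → ℂ) → ℂ) (hN : ∀ k, IsPoly (N k)) (h : ∀ x k, j (φ x) k = N k (i x)) :
    IsMorphism ((affine κ).induced i) ((affine l).induced j) φ := by
  have key : ∀ U f, LocPoly j U f → LocPoly i (φ ⁻¹' U) (f ∘ φ) := by
    intro U f hf x hx
    obtain ⟨H, P, hH, hP, h1, h2⟩ := hf (φ x) hx
    refine ⟨fun w => H fun k => N k w, fun w => P fun k => N k w, hH.comp hN, hP.comp hN, ?_, ?_⟩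
    · simpa only [← h x] using h1
    · intro y hy
      simp only [← h y] at hy ⊢
      exact h2 (φ y) hy
  constructor
  · refine (@continuous_def _ _ ((affine κ).induced i).top ((affine l).induced j).top _).2
      fun U hU => ?_
    exact (key U (fun _ => 0)
      (locPoly_of_regular (((affine l).induced j).regular_const U hU 0))).isOpen
  · exact fun U hU f hf => (key U f (locPoly_of_regular hf)).regular

end FunSpace

/-! ### Conics in the plane -/

/-- The determinant of three vectors. -/
def det3 (u v w : Fin 3 → ℂ) : ℂ :=
  u 0 * (v 1 * w 2 - v 2 * w 1) - u 1 * (v 0 * w 2 - v 2 * w 0) + u 2 * (v 0 * w 1 - v 1 * w 0)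

theorem linearIndependent_iff_det3 {u v w : Fin 3 → ℂ} :
    LinearIndependent ℂ ![u, v, w] ↔ det3 u v w ≠ 0 := by
  have h := Matrix.linearIndependent_rows_iff_isUnit (A := Matrix.of ![u, v, w])
  rw [Matrix.isUnit_iff_isUnit_det, isUnit_iff_ne_zero] at h
  change LinearIndependent ℂ (Matrix.of ![u, v, w]).row ↔ _
  rw [h, Matrix.det_fin_three]
  refine not_congr (Eq.congr_left ?_)
  simp [det3]
  ring

/-- The linear form `det3 u v`. -/
def det3Lin (u v : Fin 3 → ℂ) : (Fin 3 → ℂ) →ₗ[ℂ] ℂ where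
  toFun := det3 u v
  map_add' x y := by simp [det3]; ring
  map_smul' c x := by simp [det3]; ring

@[simp] theorem det3Lin_apply (u v x : Fin 3 → ℂ) : det3Lin u v x = det3 u v x := rfl

theorem det3_cramer (u v w x : Fin 3 → ℂ) :
    det3 u v w • x = det3 x v w • u + det3 u x w • v + det3 u v x • w := by
  funext i
  fin_cases i <;> simp [det3] <;> ring

theorem det3_smul (a b c : ℂ) (u v w : Fin 3 → ℂ) :
    det3 (a • u) (b • v) (c • w) = a * b * c * det3 u v w := by
  simp [det3]; ring

section Polar

variable (q : QuadraticForm ℂ (Fin 3 → ℂ))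

theorem polar_self' (x : Fin 3 → ℂ) : QuadraticMap.polar q x x = 2 * q x := by
  rw [QuadraticMap.polar_self, two_nsmul, two_mul]

theorem polar_eq_sum (x y : Fin 3 → ℂ) : QuadraticMap.polar q x y =
    ∑ i, ∑ j, x i * y j * QuadraticMap.polar q (Pi.single i 1) (Pi.single j 1) := by
  have h := LinearMap.BilinForm.sum_repr_mul_repr_mul (B := QuadraticMap.polarBilin q)
    (Pi.basisFun ℂ (Fin 3)) x y
  rw [QuadraticMap.polarBilin_apply_apply] at h
  rw [← h, Finsupp.sum_fintype _ _ (by simp)]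
  refine Finset.sum_congr rfl fun i _ => ?_
  rw [Finsupp.sum_fintype _ _ (by simp)]
  simp [mul_assoc]

/-- The determinant of the Gram matrix of the polar form. -/
def gramDet : ℂ :=
  det3 (fun j => QuadraticMap.polar q (Pi.single 0 1) (Pi.single j 1))
    (fun j => QuadraticMap.polar q (Pi.single 1 1) (Pi.single j 1))
    (fun j => QuadraticMap.polar q (Pi.single 2 1) (Pi.single j 1))

/-- The polarization of the equation of the pair of tangents from `w` to the conic `q = 0`. -/
def tangentForm (w x y : Fin 3 → ℂ) : ℂ :=
  QuadraticMap.polar q x w * QuadraticMap.polar q y w -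
    QuadraticMap.polar q w w * QuadraticMap.polar q x y

/-- The entries of the Gram matrix, as variables for polynomial identities. -/
theorem exists_gram : ∃ a b c d e f : ℂ,
    (∀ x y : Fin 3 → ℂ, QuadraticMap.polar q x y = a * x 0 * y 0 + b * x 1 * y 1 + c * x 2 * y 2 +
      d * (x 0 * y 1 + x 1 * y 0) + e * (x 0 * y 2 + x 2 * y 0) + f * (x 1 * y 2 + x 2 * y 1)) ∧
    gramDet q = a * (b * c - f * f) - d * (d * c - f * e) + e * (d * f - b * e) := by
  refine ⟨QuadraticMap.polar q (Pi.single 0 1) (Pi.single 0 1),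
    QuadraticMap.polar q (Pi.single 1 1) (Pi.single 1 1),
    QuadraticMap.polar q (Pi.single 2 1) (Pi.single 2 1),
    QuadraticMap.polar q (Pi.single 0 1) (Pi.single 1 1),
    QuadraticMap.polar q (Pi.single 0 1) (Pi.single 2 1),
    QuadraticMap.polar q (Pi.single 1 1) (Pi.single 2 1), fun x y => ?_, ?_⟩
  · rw [polar_eq_sum]
    simp only [Fin.sum_univ_three]
    rw [QuadraticMap.polar_comm q (Pi.single 1 1) (Pi.single 0 1),
      QuadraticMap.polar_comm q (Pi.single 2 1) (Pi.single 0 1),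
      QuadraticMap.polar_comm q (Pi.single 2 1) (Pi.single 1 1)]
    ring
  · simp only [gramDet, det3]
    rw [QuadraticMap.polar_comm q (Pi.single 1 1) (Pi.single 0 1),
      QuadraticMap.polar_comm q (Pi.single 2 1) (Pi.single 0 1),
      QuadraticMap.polar_comm q (Pi.single 2 1) (Pi.single 1 1)]

/-- The discriminant of the pair of tangents from `w`. -/
theorem tangentForm_disc (w x y : Fin 3 → ℂ) :
    tangentForm q w x y ^ 2 - tangentForm q w x x * tangentForm q w y y =
      -(QuadraticMap.polar q w w * gramDet q) * det3 x y w ^ 2 := by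
  obtain ⟨a, b, c, d, e, f, hB, hG⟩ := exists_gram q
  simp only [tangentForm, hB, hG, det3]
  ring

/-- The determinant of the Gram matrix under a change of basis. -/
theorem det3_gram (u v w : Fin 3 → ℂ) :
    det3 (fun j => QuadraticMap.polar q u (![u, v, w] j))
      (fun j => QuadraticMap.polar q v (![u, v, w] j))
      (fun j => QuadraticMap.polar q w (![u, v, w] j)) = gramDet q * det3 u v w ^ 2 := by
  obtain ⟨a, b, c, d, e, f, hB, hG⟩ := exists_gram q
  simp only [hB, hG, det3, Matrix.cons_val]
  ring

variable {q}

theorem tangentForm_comm (w x y : Fin 3 → ℂ) : tangentForm q w x y = tangentForm q w y x := by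
  rw [tangentForm, tangentForm, QuadraticMap.polar_comm q x y, mul_comm (QuadraticMap.polar q x w)]

theorem tangentForm_add_left (w x y z : Fin 3 → ℂ) :
    tangentForm q w (x + y) z = tangentForm q w x z + tangentForm q w y z := by
  simp only [tangentForm, QuadraticMap.polar_add_left]
  ring

theorem tangentForm_smul_left (c : ℂ) (w x z : Fin 3 → ℂ) :
    tangentForm q w (c • x) z = c * tangentForm q w x z := by
  simp only [tangentForm, QuadraticMap.polar_smul_left, smul_eq_mul]
  ring

theorem tangentForm_self_left (w x : Fin 3 → ℂ) : tangentForm q w w x = 0 := by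
  rw [tangentForm, QuadraticMap.polar_comm q w x]
  ring

/-- A conic through five points, no three of which are collinear, vanishes identically if two of
the points are conjugate.  In coordinates with the first three points as basis its equation is
`b x z + c y z`, and the last two points force `b = c = 0`. -/
theorem eq_zero_of_polar_eq_zero {p : Fin 5 → Fin 3 → ℂ}
    (hp : ∀ i j k, i ≠ j → i ≠ k → j ≠ k → det3 (p i) (p j) (p k) ≠ 0) (hq : ∀ i, q (p i) = 0)
    (h : QuadraticMap.polar q (p 0) (p 1) = 0) : q = 0 := by
  have h012 := hp 0 1 2 (by decide) (by decide) (by decide)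
  have key : ∀ x, det3 (p 0) (p 1) (p 2) ^ 2 * q x = det3 (p 0) (p 1) x *
      (det3 x (p 1) (p 2) * QuadraticMap.polar q (p 0) (p 2) +
        det3 (p 0) x (p 2) * QuadraticMap.polar q (p 1) (p 2)) := by
    intro x
    have h1 : QuadraticMap.polar q (det3 (p 0) (p 1) (p 2) • x) (det3 (p 0) (p 1) (p 2) • x) =
      2 * (det3 (p 0) (p 1) (p 2) ^ 2 * q x) := by
      rw [QuadraticMap.polar_smul_left, QuadraticMap.polar_smul_right, polar_self']
      simp only [smul_eq_mul]
      ring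
    have h2 : (2 : ℂ) ≠ 0 := two_ne_zero
    rw [← mul_right_inj' h2, ← h1, det3_cramer]
    simp only [QuadraticMap.polar_add_left, QuadraticMap.polar_add_right,
      QuadraticMap.polar_smul_left, QuadraticMap.polar_smul_right, polar_self', hq, smul_eq_mul,
      QuadraticMap.polar_comm q (p 1) (p 0), QuadraticMap.polar_comm q (p 2) (p 0),
      QuadraticMap.polar_comm q (p 2) (p 1), h]
    ring
  have h3 := key (p 3)
  have h4 := key (p 4)
  rw [hq, mul_zero, eq_comm, mul_eq_zero, or_iff_right (hp _ _ _ (by decide) (by decide)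
    (by decide))] at h3 h4
  have hne : det3 (p 0) (p 1) (p 2) * det3 (p 3) (p 4) (p 2) ≠ 0 :=
    mul_ne_zero h012 (hp _ _ _ (by decide) (by decide) (by decide))
  -- the determinant of the two linear equations `h3` and `h4`
  have hpl : det3 (p 3) (p 1) (p 2) * det3 (p 0) (p 4) (p 2) -
      det3 (p 4) (p 1) (p 2) * det3 (p 0) (p 3) (p 2) =
      det3 (p 0) (p 1) (p 2) * det3 (p 3) (p 4) (p 2) := by
    simp only [det3]
    ring
  have hb : QuadraticMap.polar q (p 0) (p 2) = 0 := by
    refine (mul_eq_zero.1 ?_).resolve_left hne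
    rw [← hpl]
    linear_combination det3 (p 0) (p 4) (p 2) * h3 - det3 (p 0) (p 3) (p 2) * h4
  have hc : QuadraticMap.polar q (p 1) (p 2) = 0 := by
    refine (mul_eq_zero.1 ?_).resolve_left hne
    rw [← hpl]
    linear_combination det3 (p 3) (p 1) (p 2) * h4 - det3 (p 4) (p 1) (p 2) * h3
  ext x
  have hx := key x
  rw [hb, hc, mul_zero, mul_zero, add_zero, mul_zero, mul_eq_zero,
    or_iff_right (pow_ne_zero 2 h012)] at hx
  simpa using hx

/-- Two conics through five points, no three of which are collinear, are proportional. -/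
theorem exists_smul_eq_of_conics {p : Fin 5 → Fin 3 → ℂ}
    (hp : ∀ i j k, i ≠ j → i ≠ k → j ≠ k → det3 (p i) (p j) (p k) ≠ 0) (hq : ∀ i, q (p i) = 0)
    (hq0 : q ≠ 0) {q' : QuadraticForm ℂ (Fin 3 → ℂ)} (hq' : ∀ i, q' (p i) = 0) :
    ∃ c : ℂ, q' = c • q := by
  have h0 : QuadraticMap.polar q (p 0) (p 1) ≠ 0 := fun h =>
    hq0 (eq_zero_of_polar_eq_zero hp hq h)
  refine ⟨QuadraticMap.polar q' (p 0) (p 1) / QuadraticMap.polar q (p 0) (p 1), ?_⟩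
  rw [← sub_eq_zero]
  refine eq_zero_of_polar_eq_zero hp (fun i => by simp [hq, hq']) ?_
  simp only [QuadraticMap.polar, _root_.sub_apply, _root_.smul_apply, smul_eq_mul]
    at h0 ⊢
  field_simp
  ring

end Polar

/-- The conic through five points, as a member of the pencil of the conics through the first
four. -/
def conicThrough (p : Fin 5 → Fin 3 → ℂ) : QuadraticForm ℂ (Fin 3 → ℂ) :=
  (det3 (p 0) (p 2) (p 4) * det3 (p 1) (p 3) (p 4)) •
      QuadraticMap.linMulLin (det3Lin (p 0) (p 1)) (det3Lin (p 2) (p 3)) -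
    (det3 (p 0) (p 1) (p 4) * det3 (p 2) (p 3) (p 4)) •
      QuadraticMap.linMulLin (det3Lin (p 0) (p 2)) (det3Lin (p 1) (p 3))

theorem polar_conicThrough (p : Fin 5 → Fin 3 → ℂ) (x y : Fin 3 → ℂ) :
    QuadraticMap.polar (conicThrough p) x y =
      det3 (p 0) (p 2) (p 4) * det3 (p 1) (p 3) (p 4) *
        (det3 (p 0) (p 1) x * det3 (p 2) (p 3) y + det3 (p 0) (p 1) y * det3 (p 2) (p 3) x) -
      det3 (p 0) (p 1) (p 4) * det3 (p 2) (p 3) (p 4) *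
        (det3 (p 0) (p 2) x * det3 (p 1) (p 3) y + det3 (p 0) (p 2) y * det3 (p 1) (p 3) x) := by
  simp only [QuadraticMap.polar, conicThrough, _root_.sub_apply, _root_.smul_apply,
    QuadraticMap.linMulLin_apply, map_add, det3Lin_apply, smul_eq_mul]
  ring

theorem conicThrough_apply_self (p : Fin 5 → Fin 3 → ℂ) (i : Fin 5) :
    conicThrough p (p i) = 0 := by
  have h1 : ∀ u v : Fin 3 → ℂ, det3 u v u = 0 := fun u v => by simp only [det3]; ring
  have h2 : ∀ u v : Fin 3 → ℂ, det3 u v v = 0 := fun u v => by simp only [det3]; ring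
  simp only [conicThrough, _root_.sub_apply, _root_.smul_apply,
    QuadraticMap.linMulLin_apply, det3Lin_apply, smul_eq_mul]
  fin_cases i <;> simp only [Fin.isValue, Fin.zero_eta, Fin.mk_one, Fin.reduceFinMk, h1, h2] <;>
    ring

section Generic

variable {p : Fin 5 → Fin 3 → ℂ}
  (hp : ∀ i j k, i ≠ j → i ≠ k → j ≠ k → det3 (p i) (p j) (p k) ≠ 0)
include hp

theorem polar_conicThrough_ne_zero :
    QuadraticMap.polar (conicThrough p) (p 0) (p 1) ≠ 0 ∧
    QuadraticMap.polar (conicThrough p) (p 0) (p 2) ≠ 0 ∧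
    QuadraticMap.polar (conicThrough p) (p 1) (p 2) ≠ 0 := by
  have h1 : ∀ u v : Fin 3 → ℂ, det3 u v u = 0 := fun u v => by simp only [det3]; ring
  have h2 : ∀ u v : Fin 3 → ℂ, det3 u v v = 0 := fun u v => by simp only [det3]; ring
  have hp' : ∀ i j k, i ≠ j ∧ i ≠ k ∧ j ≠ k → det3 (p i) (p j) (p k) ≠ 0 :=
    fun i j k h => hp i j k h.1 h.2.1 h.2.2
  -- the Plücker relation `[024][134] - [014][234] = [034][124]`
  have h12 : QuadraticMap.polar (conicThrough p) (p 1) (p 2) =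
      det3 (p 0) (p 1) (p 2) * det3 (p 1) (p 2) (p 3) *
        (det3 (p 0) (p 3) (p 4) * det3 (p 1) (p 2) (p 4)) := by
    rw [polar_conicThrough]
    simp only [det3]
    ring
  rw [h12, polar_conicThrough, polar_conicThrough]
  simp only [h1, h2, zero_mul, mul_zero, add_zero, zero_add, zero_sub, sub_zero]
  exact ⟨neg_ne_zero.2 (mul_ne_zero (mul_ne_zero (hp' _ _ _ (by decide)) (hp' _ _ _ (by decide)))
      (mul_ne_zero (hp' _ _ _ (by decide)) (hp' _ _ _ (by decide)))),
    (mul_ne_zero (mul_ne_zero (hp' _ _ _ (by decide)) (hp' _ _ _ (by decide)))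
      (mul_ne_zero (hp' _ _ _ (by decide)) (hp' _ _ _ (by decide)))),
    (mul_ne_zero (mul_ne_zero (hp' _ _ _ (by decide)) (hp' _ _ _ (by decide)))
      (mul_ne_zero (hp' _ _ _ (by decide)) (hp' _ _ _ (by decide))))⟩

theorem conicThrough_ne_zero : conicThrough p ≠ 0 := by
  intro h
  apply (polar_conicThrough_ne_zero hp).1
  simp [h, QuadraticMap.polar]

/-- The conic is nondegenerate: in the basis of the first three points its Gram matrix has zero
diagonal and nonzero entries `x`, `y`, `z` off the diagonal, hence determinant `2 x y z`. -/
theorem gramDet_conicThrough_ne_zero : gramDet (conicThrough p) ≠ 0 := by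
  obtain ⟨h1, h2, h3⟩ := polar_conicThrough_ne_zero hp
  have h := det3_gram (conicThrough p) (p 0) (p 1) (p 2)
  intro h0
  rw [h0, zero_mul] at h
  simp only [det3, Matrix.cons_val, polar_self', conicThrough_apply_self,
    QuadraticMap.polar_comm _ (p 1) (p 0), QuadraticMap.polar_comm _ (p 2) (p 0),
    QuadraticMap.polar_comm _ (p 2) (p 1)] at h
  refine mul_ne_zero (mul_ne_zero h1 h2) h3 ?_
  linear_combination h / 2

end Generic

/-! ### Coordinates adapted to a conic and a point off it -/

/-- Coordinates in which the conic `q = 0` has the equation `x y = z ^ 2` and the point `w` is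
`(0, 0, 1)`.  The first two are equations of the tangents through `w`, obtained by factoring
`tangentForm` with the help of a vector `e` off the tangents and the square root `s` of the
discriminant; the third is the equation of the polar of `w`. -/
def adapted (q : QuadraticForm ℂ (Fin 3 → ℂ)) (w e : Fin 3 → ℂ) (s : ℂ) :
    (Fin 3 → ℂ) →ₗ[ℂ] (Fin 3 → ℂ) where
  toFun x := ![tangentForm q w x e + s * det3 e w x,
    tangentForm q w e e * (tangentForm q w x e - s * det3 e w x),
    tangentForm q w e e * QuadraticMap.polar q x w]
  map_add' x y := by
    have := (det3Lin e w).map_add x y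
    simp only [det3Lin_apply] at this
    funext i
    fin_cases i <;> simp [tangentForm_add_left, this, QuadraticMap.polar_add_left] <;> ring
  map_smul' c x := by
    have := (det3Lin e w).map_smul c x
    simp only [det3Lin_apply, smul_eq_mul] at this
    funext i
    fin_cases i <;> simp [tangentForm_smul_left, this, QuadraticMap.polar_smul_left] <;> ring

section Adapted

variable {q : QuadraticForm ℂ (Fin 3 → ℂ)} {w e : Fin 3 → ℂ} {s : ℂ}

theorem adapted_apply (x : Fin 3 → ℂ) : adapted q w e s x =
    ![tangentForm q w x e + s * det3 e w x,
      tangentForm q w e e * (tangentForm q w x e - s * det3 e w x),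
      tangentForm q w e e * QuadraticMap.polar q x w] := rfl

theorem adapted_self :
    adapted q w e s w = ![0, 0, tangentForm q w e e * QuadraticMap.polar q w w] := by
  have : det3 e w w = 0 := by simp only [det3]; ring
  rw [adapted_apply, tangentForm_self_left, this]
  simp

theorem adapted_conic (hs : s ^ 2 = -(QuadraticMap.polar q w w * gramDet q)) {x : Fin 3 → ℂ}
    (hx : q x = 0) :
    adapted q w e s x 2 ^ 2 = adapted q w e s x 0 * adapted q w e s x 1 := by
  have h := tangentForm_disc q w x e
  have h2 : tangentForm q w x x = QuadraticMap.polar q x w ^ 2 := by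
    rw [tangentForm, polar_self' q x, hx]
    ring
  have h3 : det3 e w x = det3 x e w := by simp only [det3]; ring
  rw [← hs, h2] at h
  simp only [adapted_apply, Matrix.cons_val, h3]
  linear_combination -tangentForm q w e e * h

theorem adapted_injective (hs : s ≠ 0) (he : tangentForm q w e e ≠ 0)
    (hw : QuadraticMap.polar q w w ≠ 0) : Function.Injective (adapted q w e s) := by
  rw [← LinearMap.ker_eq_bot, LinearMap.ker_eq_bot']
  intro x hx
  have h0 := congrFun hx 0
  have h1 := congrFun hx 1
  have h2 := congrFun hx 2
  simp only [adapted_apply, Matrix.cons_val, Pi.zero_apply] at h0 h1 h2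
  rw [mul_eq_zero, or_iff_right he] at h1 h2
  have hT : tangentForm q w x e = 0 := by linear_combination (h0 + h1) / 2
  have hd : det3 e w x = 0 := by
    refine (mul_eq_zero.1 ?_).resolve_left hs
    linear_combination (h0 - h1) / 2
  obtain ⟨y, hy⟩ : ∃ y, det3 e w y ≠ 0 := by
    by_contra! hy
    have h3 := hy (Pi.single 0 1)
    have h4 := hy (Pi.single 1 1)
    have h5 := hy (Pi.single 2 1)
    simp [det3] at h3 h4 h5
    obtain ⟨k, hk⟩ : ∃ k, w k ≠ 0 := by
      by_contra! h
      obtain rfl : w = 0 := funext h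
      simp at hw
    have : e = (e k / w k) • w := by
      funext l
      fin_cases k <;> fin_cases l <;> simp at hk ⊢ <;> field_simp <;>
        first
        | linear_combination h3 | linear_combination -h3 | linear_combination h4
        | linear_combination -h4 | linear_combination h5 | linear_combination -h5
    rw [this, tangentForm_smul_left, tangentForm_self_left, mul_zero] at he
    exact he rfl
  have hc := det3_cramer e w y x
  rw [hd, zero_smul, add_zero] at hc
  have ha : det3 x w y = 0 := by
    have := congrArg (fun v => tangentForm q w v e) hc
    simp only [tangentForm_add_left, tangentForm_smul_left, tangentForm_self_left, hT, mul_zero,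
      add_zero] at this
    exact (mul_eq_zero.1 this.symm).resolve_right he
  have hb : det3 e x y = 0 := by
    have := congrArg (fun v => QuadraticMap.polar q v w) hc
    simp only [QuadraticMap.polar_add_left, QuadraticMap.polar_smul_left, h2, ha, smul_eq_mul,
      mul_zero, zero_mul, zero_add] at this
    exact (mul_eq_zero.1 this.symm).resolve_right hw
  rw [ha, hb, zero_smul, zero_smul, add_zero] at hc
  exact (smul_eq_zero.1 hc).resolve_left hy

/-- The equation of the pair of tangents from a point off a nondegenerate conic does not vanish
identically, since its discriminant does not vanish. -/
theorem exists_tangentForm_ne_zero (hw : QuadraticMap.polar q w w ≠ 0) (hq : gramDet q ≠ 0)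
    {x y : Fin 3 → ℂ} (hxy : det3 x y w ≠ 0) : ∃ e, tangentForm q w e e ≠ 0 := by
  by_contra! h
  have h1 := h (x + y)
  rw [tangentForm_add_left, tangentForm_comm w x, tangentForm_comm w y, tangentForm_add_left,
    tangentForm_add_left, h x, h y, tangentForm_comm w y x] at h1
  have h2 : tangentForm q w x y = 0 := by linear_combination h1 / 2
  have h3 := tangentForm_disc q w x y
  rw [h x, h2] at h3
  refine mul_ne_zero (neg_ne_zero.2 (mul_ne_zero hw hq)) (pow_ne_zero 2 hxy) ?_
  rw [← h3]
  ring

end Adapted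

/-! ### Points, conics and linear maps -/

theorem onConic_mk {q : QuadraticForm ℂ (Fin 3 → ℂ)} {v : Fin 3 → ℂ} (hv : v ≠ 0) :
    OnConic q (Projectivization.mk ℂ v hv) ↔ q v = 0 := by
  obtain ⟨a, ha⟩ := Projectivization.exists_smul_eq_mk_rep ℂ v hv
  rw [OnConic, ← ha, Units.smul_def, QuadraticMap.map_smul, smul_eq_zero]
  simp

theorem tangentThrough_mk {q : QuadraticForm ℂ (Fin 3 → ℂ)} {v w : Fin 3 → ℂ} (hv : v ≠ 0)
    (hw : w ≠ 0) : TangentThrough q (Projectivization.mk ℂ v hv) (Projectivization.mk ℂ w hw) ↔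
      QuadraticMap.polar q v w = 0 := by
  obtain ⟨a, ha⟩ := Projectivization.exists_smul_eq_mk_rep ℂ v hv
  obtain ⟨b, hb⟩ := Projectivization.exists_smul_eq_mk_rep ℂ w hw
  rw [TangentThrough, ← ha, ← hb, Units.smul_def, Units.smul_def, QuadraticMap.polar_smul_left,
    QuadraticMap.polar_smul_right, smul_eq_zero, smul_eq_zero]
  simp

theorem independent_mk_iff {u v w : Fin 3 → ℂ} (hu : u ≠ 0) (hv : v ≠ 0) (hw : w ≠ 0) :
    Projectivization.Independent ![Projectivization.mk ℂ u hu, Projectivization.mk ℂ v hv,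
      Projectivization.mk ℂ w hw] ↔ det3 u v w ≠ 0 := by
  obtain ⟨a, ha⟩ := Projectivization.exists_smul_eq_mk_rep ℂ u hu
  obtain ⟨b, hb⟩ := Projectivization.exists_smul_eq_mk_rep ℂ v hv
  obtain ⟨c, hc⟩ := Projectivization.exists_smul_eq_mk_rep ℂ w hw
  have : Projectivization.rep ∘ ![Projectivization.mk ℂ u hu, Projectivization.mk ℂ v hv,
      Projectivization.mk ℂ w hw] = ![(a : ℂ) • u, (b : ℂ) • v, (c : ℂ) • w] := by
    funext i
    fin_cases i
    · exact ha.symm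
    · exact hb.symm
    · exact hc.symm
  rw [Projectivization.independent_iff, this, linearIndependent_iff_det3, det3_smul]
  simp

/-- Over `ℂ` an invertible linear map can be scaled to have determinant one. -/
theorem exists_specialLinear {n : ℕ} (hn : n ≠ 0) (f : (Fin n → ℂ) →ₗ[ℂ] (Fin n → ℂ))
    (hf : Function.Injective f) : ∃ g : SL(n, ℂ), ∀ (v : Fin n → ℂ) (hv : v ≠ 0) (hfv : f v ≠ 0),
      g • Projectivization.mk ℂ v hv = Projectivization.mk ℂ (f v) hfv := by
  have hd : LinearMap.det f ≠ 0 := by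
    have : IsUnit f := (LinearMap.isUnit_iff_ker_eq_bot f).2 (LinearMap.ker_eq_bot.2 hf)
    exact (LinearMap.isUnit_det f this).ne_zero
  obtain ⟨c, hc⟩ := IsAlgClosed.exists_pow_nat_eq (LinearMap.det f)⁻¹ (Nat.pos_of_ne_zero hn)
  refine ⟨⟨c • LinearMap.toMatrix' f, ?_⟩, fun v hv hfv => ?_⟩
  · rw [Matrix.det_smul, Fintype.card_fin, hc, LinearMap.det_toMatrix', inv_mul_cancel₀ hd]
  · refine (Projectivization.mk_eq_mk_iff' ℂ _ _ _ _).2 ⟨c, ?_⟩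
    change _ = (c • LinearMap.toMatrix' f).mulVec v
    rw [Matrix.smul_mulVec, ← Matrix.toLin'_apply, Matrix.toLin'_toMatrix']

/-- The linear automorphism given by a matrix of determinant one. -/
def slLin {n : ℕ} (g : SL(n, ℂ)) : (Fin n → ℂ) →ₗ[ℂ] (Fin n → ℂ) := Matrix.toLin' g.1

theorem slLin_apply {n : ℕ} (g : SL(n, ℂ)) (v : Fin n → ℂ) : slLin g v = g • v := rfl

theorem slLin_injective {n : ℕ} (g : SL(n, ℂ)) : Function.Injective (slLin g) :=
  MulAction.injective g

theorem smul_submodule {n : ℕ} (g : SL(n, ℂ)) (x : ℙ ℂ (Fin n → ℂ)) :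
    (g • x).submodule = x.submodule.map (slLin g) := by
  induction x using Projectivization.ind with
  | h v hv =>
    rw [Projectivization.smul_mk, Projectivization.submodule_mk, Projectivization.submodule_mk,
      Submodule.map_span, Set.image_singleton, slLin_apply]

theorem onConic_smul {q : QuadraticForm ℂ (Fin 3 → ℂ)} (g : SL(3, ℂ)) (x : ℙ ℂ (Fin 3 → ℂ)) :
    OnConic q (g • x) ↔ OnConic (q.comp (slLin g)) x := by
  induction x using Projectivization.ind with
  | h v hv =>
    rw [Projectivization.smul_mk, onConic_mk, onConic_mk]
    rfl

theorem tangentThrough_smul {q : QuadraticForm ℂ (Fin 3 → ℂ)} (g : SL(3, ℂ))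
    (x w : ℙ ℂ (Fin 3 → ℂ)) :
    TangentThrough q (g • x) (g • w) ↔ TangentThrough (q.comp (slLin g)) x w := by
  induction x using Projectivization.ind with
  | h v hv =>
    induction w using Projectivization.ind with
    | h u hu =>
      rw [Projectivization.smul_mk, Projectivization.smul_mk, tangentThrough_mk,
        tangentThrough_mk]
      simp [QuadraticMap.polar, slLin_apply, smul_add]

theorem comp_slLin_ne_zero {q : QuadraticForm ℂ (Fin 3 → ℂ)} (g : SL(3, ℂ)) (hq : q ≠ 0) :
    q.comp (slLin g) ≠ 0 := by
  intro h
  apply hq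
  ext x
  have := congrArg (fun r : QuadraticForm ℂ (Fin 3 → ℂ) => r (g⁻¹ • x)) h
  simpa [slLin_apply] using this

/-- Genericity in terms of the nonvanishing of polynomials in homogeneous coordinates. -/
theorem isGeneric_toConfig_iff {v : VecConfig SixLabels 3} : IsGeneric v.toConfig ↔
    (∀ i j k, i ≠ j → i ≠ k → j ≠ k → det3 (v.1 i) (v.1 j) (v.1 k) ≠ 0) ∧
      conicThrough (fun i => v.1 (Sum.inl i)) (v.1 (Sum.inr 0)) ≠ 0 := by
  have h1 : (∀ i j k, i ≠ j → i ≠ k → j ≠ k →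
      Projectivization.Independent ![v.toConfig i, v.toConfig j, v.toConfig k]) ↔
      ∀ i j k, i ≠ j → i ≠ k → j ≠ k → det3 (v.1 i) (v.1 j) (v.1 k) ≠ 0 := by
    simp only [VecConfig.toConfig, independent_mk_iff]
  rw [IsGeneric, h1]
  refine and_congr_right fun hdet => ?_
  have hp : ∀ i j k : Fin 5, i ≠ j → i ≠ k → j ≠ k →
      det3 (v.1 (Sum.inl i)) (v.1 (Sum.inl j)) (v.1 (Sum.inl k)) ≠ 0 :=
    fun i j k hij hik hjk => hdet _ _ _ (by simpa) (by simpa) (by simpa)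
  rw [← not_iff_not, not_not, not_not]
  simp only [VecConfig.toConfig, onConic_mk]
  constructor
  · rintro ⟨q, hq, hqv⟩
    obtain ⟨c, hc⟩ := exists_smul_eq_of_conics hp (fun i => hqv (Sum.inl i)) hq
      (conicThrough_apply_self _)
    rw [hc, _root_.smul_apply, hqv, smul_zero]
  · refine fun h => ⟨_, conicThrough_ne_zero hp, ?_⟩
    rintro (i | i)
    · exact conicThrough_apply_self (fun i => v.1 (Sum.inl i)) i
    · rwa [Subsingleton.elim i 0]

theorem exists_toConfig_eq {ι : Type} {n : ℕ} (p : Config ι n) :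
    ∃ v : VecConfig ι n, v.toConfig = p :=
  ⟨⟨fun i => (p i).rep, fun i => (p i).rep_nonzero⟩,
    funext fun i => Projectivization.mk_rep (p i)⟩

/-! ### The common cover -/

/-- Five points `(a, b, c)` of the cone `a b = c ^ 2` with distinct ratios `a : b`.  They stand both
for six points in the plane, namely the five points on the conic `x y = z ^ 2` together with
`(0, 0, 1)`, and for seven points on the line, namely the ratios `a : b` together with `1 : 0` and
`0 : 1`. -/
def Cover : Type := {z : Fin 5 → Fin 3 → ℂ // (∀ i, z i 2 ^ 2 = z i 0 * z i 1) ∧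
  ∀ i j, i ≠ j → z i 0 * z j 1 - z j 0 * z i 1 ≠ 0}

namespace Cover

/-- The coordinates on the cover. -/
def coord (z : Cover) (k : Fin 5 × Fin 3) : ℂ := z.1 k.1 k.2

/-- The cover as a variety. -/
def space : FunSpace Cover := (affine (Fin 5 × Fin 3)).induced coord

theorem fst_or_snd_ne_zero (z : Cover) (i : Fin 5) : z.1 i 0 ≠ 0 ∨ z.1 i 1 ≠ 0 := by
  obtain ⟨j, hj⟩ := exists_ne i
  by_contra! h
  apply z.2.2 i j hj.symm
  rw [h.1, h.2]
  ring

/-- The vectors that represent the six points in the plane. -/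
def sixVec (z : Cover) : VecConfig SixLabels 3 :=
  ⟨Sum.elim z.1 fun _ => ![0, 0, 1], by
    rintro (i | i) h
    · rcases z.fst_or_snd_ne_zero i with h' | h' <;> exact h' (congrFun h _)
    · exact one_ne_zero (congrFun h 2)⟩

/-- The vectors that represent the seven points on the line. -/
def sevenVec (z : Cover) : VecConfig SevenLabels 2 :=
  ⟨Sum.elim (fun i => ![z.1 i 0, z.1 i 1]) ![![1, 0], ![0, 1]], by
    rintro (i | i) h
    · rcases z.fst_or_snd_ne_zero i with h' | h'
      · exact h' (congrFun h 0)
      · exact h' (congrFun h 1)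
    · fin_cases i
      · exact one_ne_zero (congrFun h 0)
      · exact one_ne_zero (congrFun h 1)⟩

/-- The conic `x y = z ^ 2`. -/
def conic : QuadraticForm ℂ (Fin 3 → ℂ) :=
  QuadraticMap.linMulLin (LinearMap.proj 0) (LinearMap.proj 1) -
    QuadraticMap.linMulLin (LinearMap.proj 2) (LinearMap.proj 2)

theorem conic_apply (x : Fin 3 → ℂ) : conic x = x 0 * x 1 - x 2 * x 2 := rfl

theorem polar_conic (x y : Fin 3 → ℂ) :
    QuadraticMap.polar conic x y = x 0 * y 1 + x 1 * y 0 - 2 * x 2 * y 2 := by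
  simp only [QuadraticMap.polar, conic_apply, Pi.add_apply]
  ring

theorem conic_ne_zero : conic ≠ 0 := by
  intro h
  have := congrArg (fun r : QuadraticForm ℂ (Fin 3 → ℂ) => r ![0, 0, 1]) h
  simp [conic_apply] at this

theorem conic_apply_self (z : Cover) (i : Fin 5) : conic (z.1 i) = 0 := by
  rw [conic_apply, ← z.2.1]
  ring

/-- With the parametrization `(s ^ 2, t ^ 2, s t)` of the conic the determinant of three points is a
Vandermonde determinant. -/
theorem det3_ne_zero (z : Cover) (i j k : Fin 5) (hij : i ≠ j) (hik : i ≠ k) (hjk : j ≠ k) :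
    det3 (z.1 i) (z.1 j) (z.1 k) ≠ 0 := by
  have par : ∀ i, ∃ s t : ℂ, z.1 i 0 = s ^ 2 ∧ z.1 i 1 = t ^ 2 ∧ z.1 i 2 = s * t := by
    intro i
    obtain ⟨s, hs⟩ := IsAlgClosed.exists_pow_nat_eq (z.1 i 0) two_pos
    obtain ⟨t, ht⟩ := IsAlgClosed.exists_pow_nat_eq (z.1 i 1) two_pos
    have h := z.2.1 i
    rw [← hs, ← ht, ← mul_pow, sq_eq_sq_iff_eq_or_eq_neg] at h
    rcases h with h | h
    · exact ⟨s, t, hs.symm, ht.symm, h⟩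
    · exact ⟨s, -t, hs.symm, by rw [neg_sq, ht], by rw [h, mul_neg]⟩
  obtain ⟨s1, t1, h1, h1', h1''⟩ := par i
  obtain ⟨s2, t2, h2, h2', h2''⟩ := par j
  obtain ⟨s3, t3, h3, h3', h3''⟩ := par k
  have e12 := z.2.2 i j hij
  have e13 := z.2.2 i k hik
  have e23 := z.2.2 j k hjk
  rw [h1, h1', h2, h2'] at e12
  rw [h1, h1', h3, h3'] at e13
  rw [h2, h2', h3, h3'] at e23
  have f12 : s1 * t2 - s2 * t1 ≠ 0 := fun h => e12 (by linear_combination (s1 * t2 + s2 * t1) * h)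
  have f13 : s1 * t3 - s3 * t1 ≠ 0 := fun h => e13 (by linear_combination (s1 * t3 + s3 * t1) * h)
  have f23 : s2 * t3 - s3 * t2 ≠ 0 := fun h => e23 (by linear_combination (s2 * t3 + s3 * t2) * h)
  have : det3 (z.1 i) (z.1 j) (z.1 k) =
      -((s1 * t2 - s2 * t1) * (s1 * t3 - s3 * t1) * (s2 * t3 - s3 * t2)) := by
    simp only [det3, h1, h1', h1'', h2, h2', h2'', h3, h3', h3'']
    ring
  rw [this]
  exact neg_ne_zero.2 (mul_ne_zero (mul_ne_zero f12 f13) f23)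

theorem exists_eq_smul_conic (z : Cover) {q : QuadraticForm ℂ (Fin 3 → ℂ)}
    (hq : ∀ i, q (z.1 i) = 0) : ∃ c : ℂ, q = c • conic :=
  exists_smul_eq_of_conics z.det3_ne_zero z.conic_apply_self conic_ne_zero hq

theorem isGeneric (z : Cover) : IsGeneric z.sixVec.toConfig := by
  have hw : ∀ i j, i ≠ j → det3 (z.1 i) (z.1 j) ![0, 0, 1] ≠ 0 := by
    intro i j hij
    have := z.2.2 i j hij
    have h : det3 (z.1 i) (z.1 j) ![0, 0, 1] = z.1 i 0 * z.1 j 1 - z.1 j 0 * z.1 i 1 := by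
      simp [det3]
      ring
    rwa [h]
  have rot : ∀ u v w : Fin 3 → ℂ, det3 u v w = det3 v w u := fun u v w => by
    simp only [det3]; ring
  rw [isGeneric_toConfig_iff]
  constructor
  · rintro (i | i) (j | j) (k | k) hij hik hjk
    · exact z.det3_ne_zero i j k (by simpa using hij) (by simpa using hik) (by simpa using hjk)
    · exact hw i j (by simpa using hij)
    · rw [rot, rot]
      exact hw k i (by simpa using hik.symm)
    · exact (hjk (by rw [Subsingleton.elim j k])).elim
    · rw [rot]
      exact hw j k (by simpa using hjk)
    · exact (hik (by rw [Subsingleton.elim i k])).elim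
    · exact (hij (by rw [Subsingleton.elim i j])).elim
    · exact (hij (by rw [Subsingleton.elim i j])).elim
  · obtain ⟨c, hc⟩ := z.exists_eq_smul_conic (conicThrough_apply_self z.1)
    change conicThrough z.1 ![0, 0, 1] ≠ 0
    have h0 := conicThrough_ne_zero z.det3_ne_zero
    rw [hc] at h0 ⊢
    have : c ≠ 0 := by
      rintro rfl
      exact h0 (zero_smul _ _)
    simpa [conic_apply] using this

/-- The six points in the plane. -/
def toSix (z : Cover) : GenericSix := ⟨z.sixVec.toConfig, z.isGeneric⟩

/-- The class of the six points in the plane. -/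
def toMarked (z : Cover) : MarkedCubics := MarkedCubics.mk z.toSix

end Cover

/-- Adapted coordinates move a generic configuration to one that comes from the cover. -/
theorem exists_cover_of_adapted {v : VecConfig SixLabels 3} (hv : IsGeneric v.toConfig)
    {e : Fin 3 → ℂ} {s : ℂ}
    (he : tangentForm (conicThrough fun i => v.1 (Sum.inl i)) (v.1 (Sum.inr 0)) e e ≠ 0)
    (hs : s ^ 2 = -(QuadraticMap.polar (conicThrough fun i => v.1 (Sum.inl i)) (v.1 (Sum.inr 0))
      (v.1 (Sum.inr 0)) * gramDet (conicThrough fun i => v.1 (Sum.inl i)))) :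
    ∃ z : Cover, (∀ i, z.1 i = adapted (conicThrough fun i => v.1 (Sum.inl i)) (v.1 (Sum.inr 0)) e s
      (v.1 (Sum.inl i))) ∧ ∃ g : SL(3, ℂ), g • v.toConfig = z.sixVec.toConfig := by
  obtain ⟨hdet, hw⟩ := isGeneric_toConfig_iff.1 hv
  have hp : ∀ i j k : Fin 5, i ≠ j → i ≠ k → j ≠ k →
      det3 (v.1 (Sum.inl i)) (v.1 (Sum.inl j)) (v.1 (Sum.inl k)) ≠ 0 :=
    fun i j k hij hik hjk => hdet _ _ _ (by simpa) (by simpa) (by simpa)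
  have hw' : QuadraticMap.polar (conicThrough fun i => v.1 (Sum.inl i)) (v.1 (Sum.inr 0))
      (v.1 (Sum.inr 0)) ≠ 0 := by
    rw [polar_self']
    exact mul_ne_zero two_ne_zero hw
  have hs0 : s ≠ 0 := by
    rintro rfl
    rw [zero_pow two_ne_zero, eq_comm, neg_eq_zero, mul_eq_zero] at hs
    exact hs.elim hw' (gramDet_conicThrough_ne_zero hp)
  have hinj := adapted_injective hs0 he hw'
  set F := adapted (conicThrough fun i => v.1 (Sum.inl i)) (v.1 (Sum.inr 0)) e s
  have hFw : F (v.1 (Sum.inr 0)) = _ := adapted_self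
  set c := tangentForm (conicThrough fun i => v.1 (Sum.inl i)) (v.1 (Sum.inr 0)) e e *
    QuadraticMap.polar (conicThrough fun i => v.1 (Sum.inl i)) (v.1 (Sum.inr 0)) (v.1 (Sum.inr 0))
  refine ⟨⟨fun i => F (v.1 (Sum.inl i)), fun i => adapted_conic hs (conicThrough_apply_self _ i),
    fun i j hij h0 => ?_⟩, fun i => rfl, ?_⟩
  · have h1 := linearIndependent_iff_det3.2 (hdet (Sum.inl i) (Sum.inl j) (Sum.inr 0) (by simpa)
      (by simp) (by simp))
    have h2 := h1.map' F (LinearMap.ker_eq_bot.2 hinj)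
    have h3 : F ∘ ![v.1 (Sum.inl i), v.1 (Sum.inl j), v.1 (Sum.inr 0)] =
        ![F (v.1 (Sum.inl i)), F (v.1 (Sum.inl j)), F (v.1 (Sum.inr 0))] := by
      funext k
      fin_cases k <;> rfl
    rw [h3, linearIndependent_iff_det3, hFw] at h2
    apply h2
    simp only [det3, Matrix.cons_val]
    linear_combination c * h0
  · obtain ⟨g, hg⟩ := exists_specialLinear three_ne_zero F hinj
    refine ⟨g, funext ?_⟩
    rintro (i | i)
    · exact hg _ _ _
    · refine (hg _ (v.2 _) ((map_ne_zero_iff F hinj).2 (v.2 _))).trans ?_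
      obtain rfl := Subsingleton.elim i 0
      refine (Projectivization.mk_eq_mk_iff' _ _ _ _ _).2 ⟨c, ?_⟩
      refine Eq.trans ?_ hFw.symm
      change c • ![0, 0, 1] = _
      simp

/-- Each generic configuration admits an auxiliary vector for `exists_cover_of_adapted`; the vector
serves for all nearby configurations. -/
theorem exists_tangentForm_conicThrough_ne_zero {v : VecConfig SixLabels 3}
    (hv : IsGeneric v.toConfig) : ∃ e,
      tangentForm (conicThrough fun i => v.1 (Sum.inl i)) (v.1 (Sum.inr 0)) e e ≠ 0 := by
  obtain ⟨hdet, hw⟩ := isGeneric_toConfig_iff.1 hv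
  refine exists_tangentForm_ne_zero ?_ (gramDet_conicThrough_ne_zero
    fun i j k hij hik hjk => hdet _ _ _ (by simpa) (by simpa) (by simpa))
    (hdet (Sum.inl 0) (Sum.inl 1) (Sum.inr 0) (by simp) (by simp) (by simp))
  rw [polar_self']
  exact mul_ne_zero two_ne_zero hw

theorem exists_cover_of_isGeneric {m : Config SixLabels 3} (hm : IsGeneric m) :
    ∃ (z : Cover) (g : SL(3, ℂ)), g • m = z.sixVec.toConfig := by
  obtain ⟨v, rfl⟩ := exists_toConfig_eq m
  obtain ⟨e, he⟩ := exists_tangentForm_conicThrough_ne_zero hm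
  obtain ⟨s, hs⟩ := IsAlgClosed.exists_pow_nat_eq (-(QuadraticMap.polar
    (conicThrough fun i => v.1 (Sum.inl i)) (v.1 (Sum.inr 0))
      (v.1 (Sum.inr 0)) * gramDet (conicThrough fun i => v.1 (Sum.inl i)))) two_pos
  obtain ⟨z, -, g, hg⟩ := exists_cover_of_adapted hm he hs
  exact ⟨z, g, hg⟩

theorem MarkedCubics.mk_eq_of_smul_eq {m m' : GenericSix} (g : SL(3, ℂ)) (h : g • m.1 = m'.1) :
    MarkedCubics.mk m = MarkedCubics.mk m' :=
  (Quotient.sound (s := genericSetoid) ⟨g, h⟩ :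
    MarkedCubics.mk m' = MarkedCubics.mk m).symm

theorem MarkedCubics.exists_smul_eq {m m' : GenericSix}
    (h : MarkedCubics.mk m = MarkedCubics.mk m') : ∃ g : SL(3, ℂ), g • m.1 = m'.1 :=
  Quotient.exact (s := genericSetoid) h.symm

theorem Cover.toMarked_surjective : Function.Surjective Cover.toMarked := by
  intro x
  induction x using Quotient.inductionOn with
  | h m =>
    obtain ⟨z, g, hg⟩ := exists_cover_of_isGeneric m.2
    exact ⟨z, (MarkedCubics.mk_eq_of_smul_eq g hg).symm⟩

/-! ### The moduli space of six points as a quotient of the cover -/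

section PolynomialDependence

variable {κ : Type} {u v w : (κ → ℂ) → Fin 3 → ℂ} (hu : ∀ k, IsPoly fun x => u x k)
  (hv : ∀ k, IsPoly fun x => v x k) (hw : ∀ k, IsPoly fun x => w x k)
  {p : (κ → ℂ) → Fin 5 → Fin 3 → ℂ} (hp : ∀ i k, IsPoly fun x => p x i k)

include hu hv hw in
theorem isPoly_det3 : IsPoly fun x => det3 (u x) (v x) (w x) := by
  unfold det3
  exact (((hu 0).mul (((hv 1).mul (hw 2)).sub ((hv 2).mul (hw 1)))).sub
    ((hu 1).mul (((hv 0).mul (hw 2)).sub ((hv 2).mul (hw 0))))).add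
    ((hu 2).mul (((hv 0).mul (hw 1)).sub ((hv 1).mul (hw 0))))

include hp hu hv in
theorem isPoly_polar_conicThrough :
    IsPoly fun x => QuadraticMap.polar (conicThrough (p x)) (u x) (v x) := by
  have hd : ∀ i j k, IsPoly fun x => det3 (p x i) (p x j) (p x k) := fun i j k =>
    isPoly_det3 (hp i) (hp j) (hp k)
  have hdu : ∀ i j, IsPoly fun x => det3 (p x i) (p x j) (u x) := fun i j =>
    isPoly_det3 (hp i) (hp j) hu
  have hdv : ∀ i j, IsPoly fun x => det3 (p x i) (p x j) (v x) := fun i j =>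
    isPoly_det3 (hp i) (hp j) hv
  simp only [polar_conicThrough]
  exact (((hd _ _ _).mul (hd _ _ _)).mul
      (((hdu _ _).mul (hdv _ _)).add ((hdv _ _).mul (hdu _ _)))).sub
    (((hd _ _ _).mul (hd _ _ _)).mul
      (((hdu _ _).mul (hdv _ _)).add ((hdv _ _).mul (hdu _ _))))

include hp hu hv hw in
theorem isPoly_tangentForm :
    IsPoly fun x => tangentForm (conicThrough (p x)) (u x) (v x) (w x) := by
  unfold tangentForm
  exact ((isPoly_polar_conicThrough hv hu hp).mul (isPoly_polar_conicThrough hw hu hp)).sub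
    ((isPoly_polar_conicThrough hu hu hp).mul (isPoly_polar_conicThrough hv hw hp))

include hp in
theorem isPoly_gramDet : IsPoly fun x => gramDet (conicThrough (p x)) := by
  unfold gramDet
  have h : ∀ i j, IsPoly fun x => QuadraticMap.polar (conicThrough (p x))
      (Pi.single i 1) (Pi.single j 1) := fun i j =>
    isPoly_polar_conicThrough (u := fun _ => Pi.single i 1) (v := fun _ => Pi.single j 1)
      (fun _ => .const _) (fun _ => .const _) hp
  exact isPoly_det3
    (u := fun x j => QuadraticMap.polar (conicThrough (p x)) (Pi.single 0 1) (Pi.single j 1))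
    (v := fun x j => QuadraticMap.polar (conicThrough (p x)) (Pi.single 1 1) (Pi.single j 1))
    (w := fun x j => QuadraticMap.polar (conicThrough (p x)) (Pi.single 2 1) (Pi.single j 1))
    (h 0) (h 1) (h 2)

include hp hu hv hw in
theorem isPoly_adapted {s : (κ → ℂ) → ℂ} (hs : IsPoly s) (k : Fin 3) :
    IsPoly fun x => adapted (conicThrough (p x)) (u x) (v x) (s x) (w x) k := by
  have h1 := isPoly_tangentForm hu hw hv hp
  have h2 := hs.mul (isPoly_det3 hv hu hw)
  have h3 := isPoly_tangentForm hu hv hv hp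
  have h4 := isPoly_polar_conicThrough hw hu hp
  simp only [adapted_apply]
  fin_cases k
  · exact h1.add h2
  · exact h3.mul (h1.sub h2)
  · exact h3.mul h4

end PolynomialDependence

/-- The homogeneous coordinates of a family of points. -/
def vecCoord {ι : Type} {n : ℕ} (v : VecConfig ι n) (k : ι × Fin n) : ℂ := v.1 k.1 k.2

open Classical in
/-- Openness and regularity on a quotient of a space of configurations can be tested in
homogeneous coordinates. -/
theorem IsQuotientOf.descend_vecConfig {ι Y : Type} {n : ℕ} {P : Config ι n → Prop}
    {T : FunSpace Y} {π : {m // P m} → Y}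
    (hπ : IsQuotientOf ((configSpace ι n).induced Subtype.val) T π) {U : Set Y} {f : Y → ℂ}
    (h : LocPoly vecCoord {v : VecConfig ι n | ∃ h : P v.toConfig, π ⟨_, h⟩ ∈ U}
      (fun v => if h : P v.toConfig then f (π ⟨_, h⟩) else 0)) :
    IsOpen[T.top] U ∧ T.regular U f := by
  let O : Set (Config ι n) := {m | ∃ h : P m, π ⟨m, h⟩ ∈ U}
  let F : Config ι n → ℂ := fun m => if h : P m then f (π ⟨m, h⟩) else 0
  have hO : IsOpen[(configSpace ι n).top] O := h.isOpen
  have hF : (configSpace ι n).regular O F := h.regular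
  have hval := isMorphism_induced (T := configSpace ι n) (Subtype.val : {m // P m} → _)
  have hpre : π ⁻¹' U = Subtype.val ⁻¹' O := by
    ext m
    exact ⟨fun hm => ⟨m.2, hm⟩, fun ⟨_, hm⟩ => hm⟩
  have hfun : f ∘ π = F ∘ Subtype.val := by
    funext m
    simp only [F, Function.comp_apply, dif_pos m.2]
  refine hπ.descend U f ?_ ?_
  · rw [hpre]
    exact @IsOpen.preimage _ _ ((configSpace ι n).induced Subtype.val).top (configSpace ι n).top _
      hval.continuous _ hO
  · rw [hpre, hfun]
    exact hval.regular O hO F hF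

theorem isMorphism_toConfig {ι : Type} {n : ℕ} :
    IsMorphism ((affine (ι × Fin n)).induced vecCoord) (configSpace ι n) VecConfig.toConfig :=
  isMorphism_coinduced _

namespace Cover

theorem isMorphism_sixVec :
    IsMorphism space ((affine (SixLabels × Fin 3)).induced vecCoord) sixVec := by
  refine isMorphism_of_isPoly (fun k x => Sum.elim (fun i => x (i, k.2))
    (fun _ => (![0, 0, 1] : Fin 3 → ℂ) k.2) k.1) ?_ ?_
  · rintro ⟨i | i, k⟩
    · exact .coord _
    · exact .const _
  · rintro z ⟨i | i, k⟩ <;> rfl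

theorem isMorphism_toMarked : IsMorphism space markedCubicsSpace toMarked := by
  have h : IsMorphism space (configSpace SixLabels 3) (Subtype.val ∘ toSix) :=
    isMorphism_toConfig.comp isMorphism_sixVec
  exact (isMorphism_coinduced MarkedCubics.mk).comp h.codRestrict

/-- The polynomial whose nonvanishing means that six points are generic. -/
def genericPoly (p : SixLabels → Fin 3 → ℂ) : ℂ :=
  (∏ t : SixLabels × SixLabels × SixLabels,
    if t.1 ≠ t.2.1 ∧ t.1 ≠ t.2.2 ∧ t.2.1 ≠ t.2.2 then det3 (p t.1) (p t.2.1) (p t.2.2) else 1) *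
  QuadraticMap.polar (conicThrough fun i => p (Sum.inl i)) (p (Sum.inr 0)) (p (Sum.inr 0))

theorem genericPoly_ne_zero_iff {v : VecConfig SixLabels 3} :
    genericPoly v.1 ≠ 0 ↔ IsGeneric v.toConfig := by
  rw [isGeneric_toConfig_iff, genericPoly, mul_ne_zero_iff, Finset.prod_ne_zero_iff, polar_self',
    mul_ne_zero_iff, and_iff_right (two_ne_zero : (2 : ℂ) ≠ 0)]
  refine and_congr_left fun _ => ⟨fun h i j k hij hik hjk => ?_, fun h t _ => ?_⟩
  · have := h (i, j, k) (Finset.mem_univ _)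
    rwa [if_pos ⟨hij, hik, hjk⟩] at this
  · split_ifs with ht
    · exact h _ _ _ ht.1 ht.2.1 ht.2.2
    · exact one_ne_zero

theorem isPoly_genericPoly {κ : Type} {p : (κ → ℂ) → SixLabels → Fin 3 → ℂ}
    (hp : ∀ i k, IsPoly fun x => p x i k) : IsPoly fun x => genericPoly (p x) := by
  unfold genericPoly
  refine IsPoly.mul (IsPoly.prod _ fun t => ?_) (isPoly_polar_conicThrough
    (p := fun x i => p x (Sum.inl i)) (u := fun x => p x (Sum.inr 0))
    (v := fun x => p x (Sum.inr 0)) (hp _) (hp _) fun i => hp (Sum.inl i))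
  split_ifs
  · exact isPoly_det3 (u := fun x => p x t.1) (v := fun x => p x t.2.1)
      (w := fun x => p x t.2.2) (hp _) (hp _) (hp _)
  · exact .const _

/-- The discriminant of the pair of tangents from the sixth point to the conic through the
first five. -/
def tangentDisc (p : SixLabels → Fin 3 → ℂ) : ℂ :=
  -(QuadraticMap.polar (conicThrough fun i => p (Sum.inl i)) (p (Sum.inr 0)) (p (Sum.inr 0)) *
    gramDet (conicThrough fun i => p (Sum.inl i)))

theorem isPoly_tangentDisc {κ : Type} {p : (κ → ℂ) → SixLabels → Fin 3 → ℂ}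
    (hp : ∀ i k, IsPoly fun x => p x i k) : IsPoly fun x => tangentDisc (p x) :=
  ((isPoly_polar_conicThrough (p := fun x i => p x (Sum.inl i)) (u := fun x => p x (Sum.inr 0))
    (v := fun x => p x (Sum.inr 0)) (hp _) (hp _) fun i => hp (Sum.inl i)).mul
    (isPoly_gramDet (p := fun x i => p x (Sum.inl i)) fun i => hp (Sum.inl i))).neg

theorem isQuotientOf_toMarked : IsQuotientOf space markedCubicsSpace toMarked := by
  classical
  refine ⟨isMorphism_toMarked, fun U f hU hf => ?_⟩
  refine IsQuotientOf.descend_vecConfig (isQuotientOf_coinduced MarkedCubics.mk) ?_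
  refine (locPoly_of_regular hf).transfer (ι := Unit)
    (K := fun _ x => tangentDisc fun i k => x (i, k)) ?_ ?_
  · exact fun _ => isPoly_tangentDisc (p := fun x i k => x (i, k)) fun _ _ => .coord _
  · rintro v ⟨hv, -⟩
    obtain ⟨e, he⟩ := exists_tangentForm_conicThrough_ne_zero hv
    refine ⟨fun x => genericPoly (fun i k => x (Sum.inl (i, k))) *
      tangentForm (conicThrough fun i k => x (Sum.inl (Sum.inl i, k)))
        (fun k => x (Sum.inl (Sum.inr 0, k))) e e,
      fun l x => adapted (conicThrough fun i k => x (Sum.inl (Sum.inl i, k)))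
        (fun k => x (Sum.inl (Sum.inr 0, k))) e (x (Sum.inr ()))
        (fun k => x (Sum.inl (Sum.inl l.1, k))) l.2, ?_, ?_, ?_, ?_⟩
    · exact (isPoly_genericPoly (p := fun x i k => x (Sum.inl (i, k))) fun _ _ => .coord _).mul
        (isPoly_tangentForm (p := fun x i k => x (Sum.inl (Sum.inl i, k)))
          (u := fun x k => x (Sum.inl (Sum.inr 0, k))) (v := fun _ => e) (w := fun _ => e)
          (fun _ => .coord _) (fun _ => .const _) (fun _ => .const _) (fun _ _ => .coord _))
    · exact fun l => isPoly_adapted (p := fun x i k => x (Sum.inl (Sum.inl i, k)))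
        (u := fun x k => x (Sum.inl (Sum.inr 0, k))) (v := fun _ => e)
        (w := fun x k => x (Sum.inl (Sum.inl l.1, k))) (s := fun x => x (Sum.inr ()))
        (fun _ => .coord _) (fun _ => .const _) (fun _ => .coord _) (fun _ _ => .coord _)
        (.coord _) l.2
    · exact fun s _ => mul_ne_zero (genericPoly_ne_zero_iff.2 hv) he
    · intro y s hs hD
      have hy : IsGeneric y.toConfig := genericPoly_ne_zero_iff.1 (left_ne_zero_of_mul hD)
      obtain ⟨z, hz, g, hg⟩ := exists_cover_of_adapted hy (right_ne_zero_of_mul hD) (hs ())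
      have hcls : MarkedCubics.mk ⟨y.toConfig, hy⟩ = z.toMarked :=
        MarkedCubics.mk_eq_of_smul_eq g hg
      refine ⟨z, fun l => congrFun (hz l.1) l.2, ?_, ?_⟩
      · rw [Set.mem_preimage, ← hcls]
        exact ⟨fun ⟨_, h⟩ => h, fun h => ⟨hy, h⟩⟩
      · rw [dif_pos hy, hcls]
        rfl

end Cover

/-! ### The switches -/

theorem IsGeneric.of_smul {m : Config SixLabels 3} {g : SL(3, ℂ)} (h : IsGeneric (g • m)) :
    IsGeneric m := by
  obtain ⟨v, rfl⟩ := exists_toConfig_eq m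
  refine ⟨fun i j k hij hik hjk => ?_, fun ⟨q, hq, hm⟩ => h.2 ?_⟩
  · have h1 := h.1 i j k hij hik hjk
    have h2 : ∀ i, (g • v.toConfig) i = Projectivization.mk ℂ (slLin g (v.1 i))
      ((map_ne_zero_iff _ (slLin_injective g)).2 (v.2 i)) := fun i => rfl
    rw [h2, h2, h2, independent_mk_iff, ← linearIndependent_iff_det3] at h1
    have h3 : ![slLin g (v.1 i), slLin g (v.1 j), slLin g (v.1 k)] =
        slLin g ∘ ![v.1 i, v.1 j, v.1 k] := by
      funext l
      fin_cases l <;> rfl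
    rw [h3] at h1
    simp only [VecConfig.toConfig]
    rw [independent_mk_iff, ← linearIndependent_iff_det3]
    exact LinearIndependent.of_comp _ h1
  · refine ⟨q.comp (slLin g⁻¹), comp_slLin_ne_zero _ hq, fun i => ?_⟩
    rw [← onConic_smul]
    simpa using hm i

theorem IsResidual.of_smul {q : QuadraticForm ℂ (Fin 3 → ℂ)} {w a b : ℙ ℂ (Fin 3 → ℂ)}
    {g : SL(3, ℂ)} (h : IsResidual q (g • w) (g • a) (g • b)) :
    IsResidual (q.comp (slLin g)) w a b := by
  obtain ⟨h1, h2, h3⟩ := h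
  refine ⟨(onConic_smul g b).1 h1, ?_, ?_⟩
  · rwa [smul_submodule, smul_submodule, smul_submodule, ← Submodule.map_sup,
      Submodule.map_le_map_iff_of_injective (slLin_injective g)] at h2
  · rwa [smul_left_cancel_iff, tangentThrough_smul] at h3

theorem IsSwitch.of_smul {ε : Fin 5 → ZMod 2} {m m' : Config SixLabels 3} {g : SL(3, ℂ)}
    (h : IsSwitch ε (g • m) (g • m')) : IsSwitch ε m m' := by
  obtain ⟨h6, q, hq, hqm, h⟩ := h
  refine ⟨smul_left_cancel g h6, q.comp (slLin g), comp_slLin_ne_zero g hq,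
    fun i => (onConic_smul g _).1 (hqm i), fun i => ⟨fun h0 => ?_, fun h0 => ?_⟩⟩
  · exact smul_left_cancel g ((h i).1 h0)
  · exact ((h i).2 h0).of_smul

theorem IsSwitch.smul {ε : Fin 5 → ZMod 2} {m m' : Config SixLabels 3} (g : SL(3, ℂ))
    (h : IsSwitch ε m m') : IsSwitch ε (g • m) (g • m') := by
  refine IsSwitch.of_smul (g := g⁻¹) ?_
  rwa [inv_smul_smul, inv_smul_smul]

namespace Cover

theorem ext' {z z' : Cover} (h : ∀ i k, z.1 i k = z'.1 i k) : z = z' :=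
  Subtype.ext (funext fun i => funext (h i))

theorem ne_zero (z : Cover) (i : Fin 5) : z.1 i ≠ 0 := z.sixVec.2 (Sum.inl i)

/-- On the cover the switches change the signs of the third coordinates. -/
def switch (ε : Fin 5 → ZMod 2) (z : Cover) : Cover :=
  ⟨fun i => ![z.1 i 0, z.1 i 1, if ε i = 0 then z.1 i 2 else -z.1 i 2], fun i => by
    have := z.2.1 i
    simp only [Matrix.cons_val]
    split_ifs
    · exact this
    · rwa [neg_sq], fun i j hij => z.2.2 i j hij⟩

theorem switch_apply (ε : Fin 5 → ZMod 2) (z : Cover) (i : Fin 5) : (switch ε z).1 i =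
    ![z.1 i 0, z.1 i 1, if ε i = 0 then z.1 i 2 else -z.1 i 2] := rfl

theorem switch_zero (z : Cover) : switch 0 z = z :=
  ext' fun i k => by fin_cases k <;> simp [switch_apply]

theorem switch_add (ε δ : Fin 5 → ZMod 2) (z : Cover) :
    switch (ε + δ) z = switch ε (switch δ z) := by
  have h2 : ∀ a : ZMod 2, a = 0 ∨ a = 1 := by decide
  have h11 : (1 : ZMod 2) + 1 = 0 := by decide
  refine ext' fun i k => ?_
  rcases h2 (ε i) with h | h <;> rcases h2 (δ i) with h' | h' <;> fin_cases k <;>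
    simp [switch_apply, h, h', h11]

theorem isMorphism_switch (ε : Fin 5 → ZMod 2) : IsMorphism space space (switch ε) := by
  refine isMorphism_of_isPoly (fun l x => (![x (l.1, 0), x (l.1, 1),
    if ε l.1 = 0 then x (l.1, 2) else -x (l.1, 2)] : Fin 3 → ℂ) l.2) ?_ fun _ _ => rfl
  rintro ⟨i, k⟩
  fin_cases k
  · exact .coord _
  · exact .coord _
  · by_cases h : ε i = 0
    · simpa [h] using IsPoly.coord _
    · simpa [h] using (IsPoly.coord _).neg

/-- A linear map that matches the representing vectors up to scalars matches the classes. -/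
theorem toMarked_eq_of_linearMap {z z' : Cover} (f : (Fin 3 → ℂ) →ₗ[ℂ] (Fin 3 → ℂ))
    (hf : Function.Injective f) (h : ∀ i, ∃ c : ℂ, c • z'.1 i = f (z.1 i))
    (hw : ∃ c : ℂ, c • ![0, 0, 1] = f ![0, 0, 1]) : z.toMarked = z'.toMarked := by
  obtain ⟨g, hg⟩ := exists_specialLinear three_ne_zero f hf
  refine MarkedCubics.mk_eq_of_smul_eq g (funext fun i => ?_)
  refine (hg _ (z.sixVec.2 i) ((map_ne_zero_iff f hf).2 (z.sixVec.2 i))).trans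
    ((Projectivization.mk_eq_mk_iff' ℂ _ _ _ _).2 ?_)
  rcases i with i | i
  · exact h i
  · exact hw

theorem toMarked_switch_one (z : Cover) : (switch 1 z).toMarked = z.toMarked := by
  let f : (Fin 3 → ℂ) →ₗ[ℂ] (Fin 3 → ℂ) :=
    { toFun := fun x => ![x 0, x 1, -x 2]
      map_add' := fun x y => by
        funext k
        fin_cases k <;> simp [add_comm]
      map_smul' := fun c x => by
        funext k
        fin_cases k <;> simp }
  have hf : ∀ x, f (f x) = x := fun x => by
    funext k
    fin_cases k <;> simp [f]
  refine toMarked_eq_of_linearMap f (Function.LeftInverse.injective hf) (fun i => ⟨1, ?_⟩)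
    ⟨-1, ?_⟩
  · funext k
    fin_cases k <;> simp [f, switch_apply]
  · funext k
    fin_cases k <;> simp [f]

theorem onConic_sixVec (z : Cover) (i : Fin 5) : OnConic conic (z.sixVec.toConfig (Sum.inl i)) :=
  (onConic_mk _).2 (z.conic_apply_self i)

theorem isSwitch_switch (ε : Fin 5 → ZMod 2) (z : Cover) :
    IsSwitch ε z.sixVec.toConfig (switch ε z).sixVec.toConfig := by
  refine ⟨rfl, conic, conic_ne_zero, z.onConic_sixVec, fun i => ⟨fun h => ?_, fun h => ?_⟩⟩
  · refine (Projectivization.mk_eq_mk_iff' ℂ _ _ _ _).2 ⟨1, ?_⟩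
    rw [one_smul]
    funext k
    fin_cases k <;> simp [sixVec, switch_apply, h]
  · have hsw : (switch ε z).1 i = ![z.1 i 0, z.1 i 1, -z.1 i 2] := by
      rw [switch_apply, if_neg h]
    refine ⟨(switch ε z).onConic_sixVec i, ?_, ?_⟩
    · simp only [VecConfig.toConfig, Projectivization.submodule_mk]
      rw [Submodule.span_singleton_le_iff_mem, Submodule.mem_sup]
      refine ⟨z.1 i, Submodule.mem_span_singleton_self _, (-2 * z.1 i 2) • ![0, 0, 1],
        Submodule.smul_mem _ _ (Submodule.mem_span_singleton_self _), ?_⟩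
      refine Eq.trans ?_ hsw.symm
      funext k
      fin_cases k <;> simp
      ring
    · simp only [VecConfig.toConfig]
      rw [Projectivization.mk_eq_mk_iff', tangentThrough_mk, polar_conic]
      change (∃ c : ℂ, c • z.1 i = (switch ε z).1 i) ↔
        z.1 i 0 * 0 + z.1 i 1 * 0 - 2 * z.1 i 2 * 1 = 0
      rw [hsw]
      constructor
      · rintro ⟨c, hc⟩
        have h0 : c * z.1 i 0 = z.1 i 0 := congrFun hc 0
        have h1 : c * z.1 i 1 = z.1 i 1 := congrFun hc 1
        have h2 : c * z.1 i 2 = -z.1 i 2 := congrFun hc 2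
        have hc1 : c = 1 := by
          rcases z.fst_or_snd_ne_zero i with h' | h'
          · exact mul_right_cancel₀ h' (by rw [h0, one_mul])
          · exact mul_right_cancel₀ h' (by rw [h1, one_mul])
        rw [hc1] at h2
        linear_combination -h2
      · intro h0
        have h2 : z.1 i 2 = 0 := by linear_combination -h0 / 2
        refine ⟨1, ?_⟩
        funext k
        fin_cases k <;> simp [h2]

theorem eq_of_isSwitch {ε : Fin 5 → ZMod 2} {z : Cover} {m : Config SixLabels 3}
    (h : IsSwitch ε z.sixVec.toConfig m) : m = (switch ε z).sixVec.toConfig := by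
  obtain ⟨h6, q, hq, hqz, h⟩ := h
  obtain ⟨c, rfl⟩ := z.exists_eq_smul_conic fun i => (onConic_mk (z.ne_zero i)).1 (hqz i)
  have hc : c ≠ 0 := by
    rintro rfl
    exact hq (zero_smul _ _)
  funext l
  rcases l with i | i
  · by_cases h0 : ε i = 0
    · rw [(h i).1 h0]
      refine (Projectivization.mk_eq_mk_iff' ℂ _ _ _ _).2 ⟨1, ?_⟩
      rw [one_smul]
      funext k
      fin_cases k <;> simp [sixVec, switch_apply, h0]
    · obtain ⟨h1, h2, h3⟩ := (h i).2 h0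
      have hsw : (switch ε z).1 i = ![z.1 i 0, z.1 i 1, -z.1 i 2] := by
        rw [switch_apply, if_neg h0]
      generalize hb : m (Sum.inl i) = b at h1 h2 h3
      induction b using Projectivization.ind with
      | h u hu =>
        rw [onConic_mk, _root_.smul_apply, smul_eq_mul, mul_eq_zero, or_iff_right hc,
          conic_apply] at h1
        simp only [VecConfig.toConfig, Projectivization.submodule_mk] at h2
        rw [Submodule.span_singleton_le_iff_mem, Submodule.mem_sup] at h2
        obtain ⟨_, hy, _, hy', hyu⟩ := h2
        obtain ⟨α, rfl⟩ := Submodule.mem_span_singleton.1 hy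
        obtain ⟨β, rfl⟩ := Submodule.mem_span_singleton.1 hy'
        have hu' : α • z.1 i + β • ![0, 0, 1] = u := hyu
        have u0 : α * z.1 i 0 = u 0 := by rw [← hu']; simp
        have u1 : α * z.1 i 1 = u 1 := by rw [← hu']; simp
        have u2 : α * z.1 i 2 + β = u 2 := by rw [← hu']; simp
        have hβ : β * (2 * α * z.1 i 2 + β) = 0 := by
          rw [← u0, ← u1, ← u2] at h1
          linear_combination -h1 - α ^ 2 * z.2.1 i
        refine (Projectivization.mk_eq_mk_iff' ℂ _ _ _ _).2 ⟨α, ?_⟩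
        refine (congrArg (α • ·) hsw).trans ?_
        rcases mul_eq_zero.1 hβ with hβ | hβ
        -- the line meets the conic in the given point only, hence is tangent
        · have heq : Projectivization.mk ℂ u hu = z.sixVec.toConfig (Sum.inl i) := by
            refine (Projectivization.mk_eq_mk_iff' ℂ _ _ _ _).2 ⟨α, ?_⟩
            change α • z.1 i = u
            rw [← hu', hβ]
            simp
          have ht := h3.1 heq
          simp only [VecConfig.toConfig] at ht
          rw [tangentThrough_mk] at ht
          have ht' : c * (z.1 i 0 * 0 + z.1 i 1 * 0 - 2 * z.1 i 2 * 1) = 0 := by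
            refine Eq.trans ?_ ht
            have := polar_conic (z.1 i) ![0, 0, 1]
            simp only [Matrix.cons_val] at this
            rw [← this]
            simp only [QuadraticMap.polar, _root_.smul_apply, smul_eq_mul, sixVec, Sum.elim_inl,
              Sum.elim_inr]
            ring
          have h20 : z.1 i 2 = 0 := by
            have := (mul_eq_zero.1 ht').resolve_left hc
            linear_combination -this / 2
          funext k
          fin_cases k
          · simpa using u0
          · simpa using u1
          · simp [← u2, h20, hβ]
        · funext k
          fin_cases k
          · simpa using u0
          · simpa using u1
          · simp [← u2]
            linear_combination -hβ
  · rw [Subsingleton.elim i 0, h6]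
    rfl

theorem toMarked_switch_congr {z z' : Cover} (h : z.toMarked = z'.toMarked)
    (ε : Fin 5 → ZMod 2) : (switch ε z).toMarked = (switch ε z').toMarked := by
  obtain ⟨g, hg⟩ := MarkedCubics.exists_smul_eq h
  have h1 := (isSwitch_switch ε z).smul g
  have h2 : g • z.sixVec.toConfig = z'.sixVec.toConfig := hg
  rw [h2] at h1
  exact MarkedCubics.mk_eq_of_smul_eq g (eq_of_isSwitch h1)

end Cover

/-- The switches on the moduli space of marked cubic surfaces. -/
def switchMarked (ε : Fin 5 → ZMod 2) (x : MarkedCubics) : MarkedCubics :=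
  (Cover.switch ε (Function.surjInv Cover.toMarked_surjective x)).toMarked

theorem switchMarked_toMarked (ε : Fin 5 → ZMod 2) (z : Cover) :
    switchMarked ε z.toMarked = (Cover.switch ε z).toMarked :=
  Cover.toMarked_switch_congr (Function.surjInv_eq _ _) ε

theorem switchMarked_zero (x : MarkedCubics) : switchMarked 0 x = x := by
  obtain ⟨z, rfl⟩ := Cover.toMarked_surjective x
  rw [switchMarked_toMarked, Cover.switch_zero]

theorem switchMarked_add (ε δ : Fin 5 → ZMod 2) (x : MarkedCubics) :
    switchMarked (ε + δ) x = switchMarked ε (switchMarked δ x) := by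
  obtain ⟨z, rfl⟩ := Cover.toMarked_surjective x
  rw [switchMarked_toMarked, switchMarked_toMarked, switchMarked_toMarked, Cover.switch_add]

theorem switchMarked_diagonal {ε : Fin 5 → ZMod 2}
    (hε : ε ∈ AddSubgroup.zmultiples (fun _ => 1 : Fin 5 → ZMod 2)) (x : MarkedCubics) :
    switchMarked ε x = x := by
  obtain ⟨k, rfl⟩ := AddSubgroup.mem_zmultiples_iff.1 hε
  have h2 : ∀ a : ZMod 2, a = 0 ∨ a = 1 := by decide
  have hk : (k • (fun _ => 1 : Fin 5 → ZMod 2)) = fun _ => (k : ZMod 2) := by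
    funext i
    simp
  rw [hk]
  rcases h2 k with h | h <;> rw [h]
  · exact switchMarked_zero x
  · obtain ⟨z, rfl⟩ := Cover.toMarked_surjective x
    rw [switchMarked_toMarked]
    exact z.toMarked_switch_one

/-- The action of `(ℤ/2)⁵` modulo its diagonal by switches. -/
@[reducible] def switchAction : AddAction SwitchGroup MarkedCubics where
  vadd a x := Quotient.liftOn' a (fun ε => switchMarked ε x) fun ε δ h => by
    rw [QuotientAddGroup.leftRel_apply] at h
    have : δ = ε + (-ε + δ) := by abel
    rw [this, switchMarked_add, switchMarked_diagonal h]
  zero_vadd x := switchMarked_zero x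
  add_vadd a b x := by
    induction a using Quotient.inductionOn' with
    | h ε =>
      induction b using Quotient.inductionOn' with
      | h δ => exact switchMarked_add ε δ x

theorem switchAction_mk (ε : Fin 5 → ZMod 2) (x : MarkedCubics) :
    switchAction.vadd (QuotientAddGroup.mk ε) x = switchMarked ε x := rfl

theorem isSwitchAction_switchAction : IsSwitchAction switchAction := by
  intro ε m
  obtain ⟨z, g, hg⟩ := exists_cover_of_isGeneric m.2
  refine ⟨⟨g⁻¹ • (Cover.switch ε z).sixVec.toConfig, ?_⟩, fun m' hm' => ?_⟩
  · refine IsSwitch.of_smul (g := g) ?_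
    rw [hg, smul_inv_smul]
    exact Cover.isSwitch_switch ε z
  · have h1 := hm'.smul g
    rw [hg] at h1
    have h2 := Cover.eq_of_isSwitch h1
    have h3 : IsGeneric m' := IsGeneric.of_smul (g := g) (by
      rw [h2]
      exact (Cover.switch ε z).isGeneric)
    refine ⟨h3, ?_⟩
    have h4 : MarkedCubics.mk m = z.toMarked := MarkedCubics.mk_eq_of_smul_eq g hg
    rw [switchAction_mk, h4, switchMarked_toMarked]
    exact (MarkedCubics.mk_eq_of_smul_eq (m := ⟨m', h3⟩) g h2).symm

theorem isMorphism_switchMarked (ε : Fin 5 → ZMod 2) :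
    IsMorphism markedCubicsSpace markedCubicsSpace (switchMarked ε) := by
  refine Cover.isQuotientOf_toMarked.isMorphism_of_comp ?_
  have h : switchMarked ε ∘ Cover.toMarked = Cover.toMarked ∘ Cover.switch ε :=
    funext fun z => switchMarked_toMarked ε z
  rw [h]
  exact Cover.isMorphism_toMarked.comp (Cover.isMorphism_switch ε)

/-! ### Seven points on the line -/

/-- The condition on seven points on the line that describes the three strata: the points of weight
two are distinct, and so are the points of weight one. -/
def IsSeparated (p : Config SevenLabels 2) : Prop :=
  (∀ i j, i ≠ j → p (Sum.inl i) ≠ p (Sum.inl j)) ∧ p (Sum.inr 0) ≠ p (Sum.inr 1)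

theorem sum_mu : ∑ l, mu l = 12 := by decide

theorem IsSeparated.isStable {p : Config SevenLabels 2} (h : IsSeparated p) : IsStable mu p := by
  classical
  intro x
  have h1 : (∑ i : Fin 5, if p (Sum.inl i) = x then 2 else 0) ≤ 2 := by
    rw [← Finset.sum_filter, Finset.sum_const, smul_eq_mul]
    have : (Finset.univ.filter fun i : Fin 5 => p (Sum.inl i) = x).card ≤ 1 := by
      refine Finset.card_le_one.2 fun i hi j hj => ?_
      by_contra hij
      exact h.1 i j hij ((Finset.mem_filter.1 hi).2.trans (Finset.mem_filter.1 hj).2.symm)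
    omega
  have h2 : (∑ j : Fin 2, if p (Sum.inr j) = x then 1 else 0) ≤ 2 := by
    rw [Fin.sum_univ_two]
    split_ifs <;> omega
  have h3 : weightAt mu p x = (∑ i : Fin 5, if p (Sum.inl i) = x then 2 else 0) +
      ∑ j : Fin 2, if p (Sum.inr j) = x then 1 else 0 := by
    unfold weightAt
    rw [Fintype.sum_sum_type]
    simp only [mu, Sum.elim_inl, Sum.elim_inr]
  rw [sum_mu]
  omega

theorem IsSeparated.smul {p : Config SevenLabels 2} (h : IsSeparated p) (g : SL(2, ℂ)) :
    IsSeparated (g • p) :=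
  ⟨fun i j hij he => h.1 i j hij (smul_left_cancel g he), fun he => h.2 (smul_left_cancel g he)⟩

theorem IsSeparated.permute {p : Config SevenLabels 2} (h : IsSeparated p)
    (σ : Equiv.Perm (Fin 5)) (τ : Equiv.Perm (Fin 2)) :
    IsSeparated (permute (Equiv.sumCongr σ τ) p) := by
  refine ⟨fun i j hij => h.1 _ _ (by simpa), ?_⟩
  have key : ∀ k l : Fin 2, k ≠ l → p (Sum.inr k) ≠ p (Sum.inr l) := by
    intro k l hkl
    fin_cases k <;> fin_cases l
    · exact absurd rfl hkl
    · exact h.2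
    · exact h.2.symm
    · exact absurd rfl hkl
  exact key _ _ (by simp)

theorem weightAt_mem_weightType {p : Config SevenLabels 2} (l : SevenLabels) :
    weightAt mu p (p l) ∈ weightType mu p := by
  classical
  refine Multiset.mem_map.2 ⟨p l, ?_, rfl⟩
  rw [Finset.mem_val]
  convert Finset.mem_image_of_mem p (Finset.mem_univ l)

/-- Coinciding points of weight two would give a weight at least four, and coinciding points of
weight one would make all weights even. -/
theorem isSeparated_of_weightType {p : Config SevenLabels 2} (h3 : ∀ k ∈ weightType mu p, k ≤ 3)
    (hodd : ∃ k ∈ weightType mu p, Odd k) : IsSeparated p := by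
  classical
  constructor
  · intro i j hij he
    have h1 := h3 _ (weightAt_mem_weightType (p := p) (Sum.inl i))
    have h2 : ∑ l ∈ {Sum.inl i, Sum.inl j}, (if p l = p (Sum.inl i) then mu l else 0) ≤
        weightAt mu p (p (Sum.inl i)) := by
      unfold weightAt
      exact Finset.sum_le_sum_of_subset (Finset.subset_univ _)
    rw [Finset.sum_pair (by simpa using hij), if_pos rfl, if_pos he.symm] at h2
    have h4 : ∀ i, mu (Sum.inl i) = 2 := fun _ => rfl
    rw [h4, h4] at h2
    omega
  · intro he
    obtain ⟨k, hk, hodd⟩ := hodd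
    obtain ⟨x, -, rfl⟩ := Multiset.mem_map.1 hk
    refine Nat.not_even_iff_odd.2 hodd ?_
    unfold weightAt
    rw [Fintype.sum_sum_type, Fin.sum_univ_two, ← he]
    refine Even.add (Finset.even_sum _ fun i _ => ?_) ?_
    · split_ifs <;> simp [mu]
    · split_ifs <;> simp [mu]

/-- The weight type depends only on the coincidences, recorded by the map `c` that sends each label
to a representative of the labels of the points at the same location. -/
theorem weightType_eq_of_representatives {p : Config SevenLabels 2} {c : SevenLabels → SevenLabels}
    (hc : ∀ l, p (c l) = p l) (hinj : ∀ k l, p (c k) = p (c l) → c k = c l) :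
    weightType mu p =
      (Finset.univ.image c).val.map fun l => ∑ k, if c k = l then mu k else 0 := by
  classical
  have h1 : Finset.univ.image p = (Finset.univ.image c).image p := by
    rw [Finset.image_image]
    exact Finset.image_congr fun l _ => (hc l).symm
  have h2 : ((Finset.univ.image c).image p).val = (Finset.univ.image c).val.map p := by
    refine Finset.image_val_of_injOn ?_
    simp only [Finset.coe_image, Finset.coe_univ, Set.image_univ]
    rintro _ ⟨k, rfl⟩ _ ⟨l, rfl⟩ h
    exact hinj k l h
  have h3 : weightType mu p = (Finset.univ.image p).val.map (weightAt mu p) := by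
    unfold weightType
    congr!
  rw [h3, h1, h2, Multiset.map_map]
  refine Multiset.map_congr rfl fun l hl => ?_
  rw [Finset.mem_val] at hl
  obtain ⟨l, -, rfl⟩ := Finset.mem_image.1 hl
  simp only [Function.comp_apply, weightAt]
  refine Finset.sum_congr rfl fun k _ => ?_
  have : p k = p (c l) ↔ c k = c l := by
    rw [← hc k]
    exact ⟨hinj k l, fun h => by rw [h]⟩
  simp only [this]

/-- The representatives when the points of weight one coincide with the points of weight two with
the labels `a` and `b`, if any. -/
def representative (a b : Option (Fin 5)) : SevenLabels → SevenLabels :=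
  Sum.elim Sum.inl ![a.elim (Sum.inr 0) Sum.inl, b.elim (Sum.inr 1) Sum.inl]

theorem weights_representative : ∀ a b : Option (Fin 5), (a = none ∨ a ≠ b) →
    ((Finset.univ.image (representative a b)).val.map fun l =>
        ∑ k, if representative a b k = l then mu k else 0) ∈
      ({Multiset.replicate 5 2 + Multiset.replicate 2 1,
        {3} + Multiset.replicate 4 2 + {1},
        Multiset.replicate 2 3 + Multiset.replicate 3 2} : Set (Multiset ℕ)) := by
  simp only [Set.mem_insert_iff, Set.mem_singleton_iff]
  decide

theorem weightType_mem_iff {p : Config SevenLabels 2} : weightType mu p ∈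
      ({Multiset.replicate 5 2 + Multiset.replicate 2 1,
        {3} + Multiset.replicate 4 2 + {1},
        Multiset.replicate 2 3 + Multiset.replicate 3 2} : Set (Multiset ℕ)) ↔
    IsSeparated p := by
  constructor
  · rintro (h | h | h) <;> refine isSeparated_of_weightType ?_ ?_ <;> rw [h]
    · decide
    · exact ⟨1, by decide, odd_one⟩
    · decide
    · exact ⟨1, by decide, odd_one⟩
    · decide
    · exact ⟨3, by decide, by decide⟩
  · intro h
    have hex : ∀ j : Fin 2, ∃ a : Option (Fin 5), ∀ i,
        a = some i ↔ p (Sum.inr j) = p (Sum.inl i) := by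
      intro j
      by_cases hj : ∃ i, p (Sum.inr j) = p (Sum.inl i)
      · obtain ⟨i, hi⟩ := hj
        refine ⟨some i, fun k => ?_⟩
        rw [hi, Option.some_inj]
        exact ⟨fun h => by rw [h], fun he => by_contra fun hik => h.1 i k hik he⟩
      · push Not at hj
        exact ⟨none, fun i => by simpa using hj i⟩
    obtain ⟨a, ha⟩ := hex 0
    obtain ⟨b, hb⟩ := hex 1
    have hab : a = none ∨ a ≠ b := by
      rcases a with _ | i
      · exact Or.inl rfl
      · exact Or.inr fun he => h.2 (((ha i).1 rfl).trans ((hb i).1 he.symm).symm)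
    rw [weightType_eq_of_representatives (c := representative a b)]
    · exact weights_representative a b hab
    · rintro (i | j)
      · rfl
      · fin_cases j
        · rcases a with _ | i
          · rfl
          · exact ((ha i).1 rfl).symm
        · rcases b with _ | i
          · rfl
          · exact ((hb i).1 rfl).symm
    · have hl : ∀ l, (∃ i, representative a b l = Sum.inl i) ∨
          (representative a b l = Sum.inr 0 ∧ a = none) ∨
          (representative a b l = Sum.inr 1 ∧ b = none) := by
        rintro (i | j)
        · exact Or.inl ⟨i, rfl⟩
        · fin_cases j
          · rcases a with _ | i
            · exact Or.inr (Or.inl ⟨rfl, rfl⟩)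
            · exact Or.inl ⟨i, rfl⟩
          · rcases b with _ | i
            · exact Or.inr (Or.inr ⟨rfl, rfl⟩)
            · exact Or.inl ⟨i, rfl⟩
      have ha' : a = none → ∀ i, p (Sum.inr 0) ≠ p (Sum.inl i) := fun h0 i he => by
        simpa [h0] using (ha i).2 he
      have hb' : b = none → ∀ i, p (Sum.inr 1) ≠ p (Sum.inl i) := fun h0 i he => by
        simpa [h0] using (hb i).2 he
      intro k l he
      rcases hl k with ⟨i, hi⟩ | ⟨hk, hk'⟩ | ⟨hk, hk'⟩ <;>
        rcases hl l with ⟨i', hi'⟩ | ⟨hl, hl'⟩ | ⟨hl, hl'⟩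
      · rw [hi, hi'] at he ⊢
        by_contra hne
        exact h.1 i i' (fun h => hne (by rw [h])) he
      · rw [hi, hl] at he
        exact (ha' hl' i he.symm).elim
      · rw [hi, hl] at he
        exact (hb' hl' i he.symm).elim
      · rw [hk, hi'] at he
        exact (ha' hk' i' he).elim
      · rw [hk, hl]
      · rw [hk, hl] at he
        exact (h.2 he).elim
      · rw [hk, hi'] at he
        exact (hb' hk' i' he).elim
      · rw [hk, hl] at he
        exact (h.2 he.symm).elim
      · rw [hk, hl]

theorem DMmod2.mk_eq_iff {p p' : StableConfig mu} : DMmod2.mk (DM.mk p) = DMmod2.mk (DM.mk p') ↔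
    ∃ (τ : Equiv.Perm (Fin 2)) (g : SL(2, ℂ)), g • permute (Equiv.sumCongr 1 τ) p.1 = p'.1 := by
  constructor
  · intro h
    obtain ⟨τ, hτ⟩ := (Quotient.exact (s := MulAction.orbitRel _ _) h.symm :
      (MulAction.orbitRel (Equiv.Perm (Fin 2)) (DM mu)) (DM.mk p') (DM.mk p))
    obtain ⟨g, hg⟩ := (Quotient.exact (s := stableSetoid mu) hτ.symm :
      (stableSetoid mu) p' (((1, τ) : Equiv.Perm (Fin 5) × Equiv.Perm (Fin 2)) • p))
    exact ⟨τ, g, hg⟩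
  · rintro ⟨τ, g, hg⟩
    refine (Quotient.sound (s := MulAction.orbitRel _ _) ⟨τ, ?_⟩ :
      DMmod2.mk (DM.mk p') = DMmod2.mk (DM.mk p)).symm
    exact (Quotient.sound (s := stableSetoid mu) ⟨g, hg⟩ :
      DM.mk p' = DM.mk (((1, τ) : Equiv.Perm (Fin 5) × Equiv.Perm (Fin 2)) • p)).symm

theorem mk_mem_smoothStrata_iff {p : StableConfig mu} :
    DMmod2.mk (DM.mk p) ∈ smoothStrata ↔ IsSeparated p.1 := by
  constructor
  · intro h
    obtain ⟨p', hp', he⟩ : ∃ p' : StableConfig mu, IsSeparated p'.1 ∧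
        DMmod2.mk (DM.mk p) = DMmod2.mk (DM.mk p') := by
      rcases h with (⟨p', h, he⟩ | ⟨p', h, he⟩) | ⟨p', h, he⟩ <;>
        refine ⟨p', weightType_mem_iff.1 ?_, he⟩ <;> rw [h] <;> simp
    obtain ⟨τ, g, hg⟩ := DMmod2.mk_eq_iff.1 he.symm
    rw [← hg]
    exact (hp'.permute 1 τ).smul g
  · intro h
    rcases weightType_mem_iff.2 h with h | h | h
    · exact Or.inl (Or.inl ⟨p, h, rfl⟩)
    · exact Or.inl (Or.inr ⟨p, h, rfl⟩)
    · exact Or.inr ⟨p, h, rfl⟩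

theorem exists_mk_eq (y : DMmod2) : ∃ p : StableConfig mu, DMmod2.mk (DM.mk p) = y := by
  induction y using Quotient.inductionOn with
  | h x =>
    induction x using Quotient.inductionOn with
    | h p => exact ⟨p, rfl⟩

/-! ### The strata as a quotient of the cover -/

/-- The determinant of two vectors. -/
def det2 (u v : Fin 2 → ℂ) : ℂ := u 0 * v 1 - u 1 * v 0

theorem mk_eq_mk_iff_det2 {u v : Fin 2 → ℂ} (hu : u ≠ 0) (hv : v ≠ 0) :
    Projectivization.mk ℂ u hu = Projectivization.mk ℂ v hv ↔ det2 u v = 0 := by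
  rw [Projectivization.mk_eq_mk_iff']
  constructor
  · rintro ⟨c, rfl⟩
    simp [det2]
    ring
  · intro h
    unfold det2 at h
    have hv' : v 0 ≠ 0 ∨ v 1 ≠ 0 := by
      by_contra! h0
      exact hv (funext fun k => by fin_cases k <;> simp [h0])
    rcases hv' with h0 | h0
    · refine ⟨u 0 / v 0, funext fun k => ?_⟩
      fin_cases k
      · simp [h0]
      · simp
        field_simp
        linear_combination h
    · refine ⟨u 1 / v 1, funext fun k => ?_⟩
      fin_cases k
      · simp
        field_simp
        linear_combination -h
      · simp [h0]

theorem isSeparated_toConfig_iff {u : VecConfig SevenLabels 2} : IsSeparated u.toConfig ↔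
    (∀ i j, i ≠ j → det2 (u.1 (Sum.inl i)) (u.1 (Sum.inl j)) ≠ 0) ∧
      det2 (u.1 (Sum.inr 0)) (u.1 (Sum.inr 1)) ≠ 0 := by
  simp only [IsSeparated, VecConfig.toConfig, ne_eq, mk_eq_mk_iff_det2]

namespace Cover

theorem isSeparated (z : Cover) : IsSeparated z.sevenVec.toConfig := by
  rw [isSeparated_toConfig_iff]
  refine ⟨fun i j hij h => z.2.2 i j hij ?_, ?_⟩
  · have h' : z.1 i 0 * z.1 j 1 - z.1 i 1 * z.1 j 0 = 0 := h
    linear_combination h'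
  · change (1 : ℂ) * 1 - 0 * 0 ≠ 0
    norm_num

/-- The seven points on the line. -/
def toSeven (z : Cover) : StableConfig mu := ⟨z.sevenVec.toConfig, z.isSeparated.isStable⟩

/-- The class of the seven points on the line. -/
def toDM (z : Cover) : DMmod2 := DMmod2.mk (DM.mk z.toSeven)

theorem toDM_mem (z : Cover) : z.toDM ∈ smoothStrata :=
  mk_mem_smoothStrata_iff.2 z.isSeparated

end Cover

/-- The linear map with the two coordinates `det2 x v` and `det2 x u`, which moves the points `u`
and `v` to `(1, 0)` and `(0, 1)`. -/
def det2Lin (u v : Fin 2 → ℂ) : (Fin 2 → ℂ) →ₗ[ℂ] (Fin 2 → ℂ) where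
  toFun x := ![det2 x v, det2 x u]
  map_add' x y := by
    funext k
    fin_cases k <;> simp [det2] <;> ring
  map_smul' c x := by
    funext k
    fin_cases k <;> simp [det2] <;> ring

theorem det2Lin_injective {u v : Fin 2 → ℂ} (h : det2 u v ≠ 0) :
    Function.Injective (det2Lin u v) := by
  rw [← LinearMap.ker_eq_bot, LinearMap.ker_eq_bot']
  intro x hx
  have h0 : x 0 * v 1 - x 1 * v 0 = 0 := congrFun hx 0
  have h1 : x 0 * u 1 - x 1 * u 0 = 0 := congrFun hx 1
  unfold det2 at h
  funext k
  fin_cases k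
  · refine (mul_eq_zero.1 ?_).resolve_left h
    change (u 0 * v 1 - u 1 * v 0) * x 0 = 0
    linear_combination u 0 * h0 - v 0 * h1
  · refine (mul_eq_zero.1 ?_).resolve_left h
    change (u 0 * v 1 - u 1 * v 0) * x 1 = 0
    linear_combination u 1 * h0 - v 1 * h1

theorem exists_cover_of_isSeparated {u : VecConfig SevenLabels 2} (hu : IsSeparated u.toConfig)
    {s : Fin 5 → ℂ} (hs : ∀ i, s i ^ 2 = det2 (u.1 (Sum.inl i)) (u.1 (Sum.inr 1)) *
      det2 (u.1 (Sum.inl i)) (u.1 (Sum.inr 0))) :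
    ∃ z : Cover, (∀ i, z.1 i = ![det2 (u.1 (Sum.inl i)) (u.1 (Sum.inr 1)),
        det2 (u.1 (Sum.inl i)) (u.1 (Sum.inr 0)), s i]) ∧
      ∃ g : SL(2, ℂ), g • u.toConfig = z.sevenVec.toConfig := by
  obtain ⟨h1, h2⟩ := isSeparated_toConfig_iff.1 hu
  refine ⟨⟨fun i => ![det2 (u.1 (Sum.inl i)) (u.1 (Sum.inr 1)),
        det2 (u.1 (Sum.inl i)) (u.1 (Sum.inr 0)), s i], fun i => by simpa using hs i,
        fun i j hij h0 => ?_⟩, fun _ => rfl, ?_⟩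
  · refine mul_ne_zero (h1 i j hij) h2 ?_
    simp only [Matrix.cons_val, det2] at h0 ⊢
    linear_combination -h0
  · have hinj := det2Lin_injective h2
    obtain ⟨g, hg⟩ := exists_specialLinear two_ne_zero _ hinj
    refine ⟨g, funext fun l => ?_⟩
    refine (hg _ (u.2 l) ((map_ne_zero_iff _ hinj).2 (u.2 l))).trans
      ((Projectivization.mk_eq_mk_iff' ℂ _ _ _ _).2 ?_)
    rcases l with i | j
    · exact ⟨1, one_smul _ _⟩
    · fin_cases j
      · refine ⟨det2 (u.1 (Sum.inr 0)) (u.1 (Sum.inr 1)), funext fun k => ?_⟩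
        fin_cases k <;> simp [Cover.sevenVec, det2Lin, det2]
        ring
      · refine ⟨det2 (u.1 (Sum.inr 1)) (u.1 (Sum.inr 0)), funext fun k => ?_⟩
        fin_cases k <;> simp [Cover.sevenVec, det2Lin, det2]
        ring

theorem Cover.exists_toDM_eq {p : StableConfig mu} (hp : IsSeparated p.1) :
    ∃ z : Cover, z.toDM = DMmod2.mk (DM.mk p) := by
  obtain ⟨u, hu⟩ := exists_toConfig_eq p.1
  rw [← hu] at hp
  choose s hs using fun i => IsAlgClosed.exists_pow_nat_eq
    (det2 (u.1 (Sum.inl i)) (u.1 (Sum.inr 1)) * det2 (u.1 (Sum.inl i)) (u.1 (Sum.inr 0))) two_pos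
  obtain ⟨z, -, g, hg⟩ := exists_cover_of_isSeparated hp hs
  refine ⟨z, (DMmod2.mk_eq_iff.2 ⟨1, g, ?_⟩).symm⟩
  refine Eq.trans ?_ hg
  rw [hu]
  congr 1
  funext l
  rcases l with l | l <;> rfl

theorem Cover.range_toDM : Set.range Cover.toDM = smoothStrata := by
  refine Set.Subset.antisymm ?_ fun y hy => ?_
  · rintro _ ⟨z, rfl⟩
    exact z.toDM_mem
  · obtain ⟨p, rfl⟩ := exists_mk_eq y
    exact exists_toDM_eq (mk_mem_smoothStrata_iff.1 hy)

/-- The projection from the stable configurations. -/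
theorem isQuotientOf_dmMod2 : IsQuotientOf
    ((configSpace SevenLabels 2).induced (Subtype.val : StableConfig mu → _)) dmMod2Space
    (DMmod2.mk ∘ DM.mk) :=
  (isQuotientOf_coinduced (S := dmSpace mu) DMmod2.mk).comp (isQuotientOf_coinduced DM.mk)

namespace Cover

theorem isMorphism_sevenVec :
    IsMorphism space ((affine (SevenLabels × Fin 2)).induced vecCoord) sevenVec := by
  refine isMorphism_of_isPoly (fun l x => Sum.elim
    (fun i => (![x (i, 0), x (i, 1)] : Fin 2 → ℂ) l.2)
    (fun j => (![![1, 0], ![0, 1]] : Fin 2 → Fin 2 → ℂ) j l.2) l.1) ?_ ?_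
  · rintro ⟨i | i, k⟩
    · fin_cases k <;> exact .coord _
    · exact .const _
  · rintro z ⟨i | i, k⟩ <;> rfl

theorem isMorphism_toDM : IsMorphism space dmMod2Space toDM := by
  have h : IsMorphism space (configSpace SevenLabels 2) (Subtype.val ∘ toSeven) :=
    isMorphism_toConfig.comp isMorphism_sevenVec
  exact isQuotientOf_dmMod2.isMorphism.comp h.codRestrict

/-- The polynomial whose nonvanishing means that seven points are separated. -/
def separatedPoly (u : SevenLabels → Fin 2 → ℂ) : ℂ :=
  (∏ t : Fin 5 × Fin 5, if t.1 ≠ t.2 then det2 (u (Sum.inl t.1)) (u (Sum.inl t.2)) else 1) *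
    det2 (u (Sum.inr 0)) (u (Sum.inr 1))

theorem separatedPoly_ne_zero_iff {u : VecConfig SevenLabels 2} :
    separatedPoly u.1 ≠ 0 ↔ IsSeparated u.toConfig := by
  rw [isSeparated_toConfig_iff, separatedPoly, mul_ne_zero_iff, Finset.prod_ne_zero_iff]
  refine and_congr_left fun _ => ⟨fun h i j hij => ?_, fun h t _ => ?_⟩
  · have := h (i, j) (Finset.mem_univ _)
    rwa [if_pos hij] at this
  · split_ifs with ht
    · exact h _ _ ht
    · exact one_ne_zero

theorem isPoly_det2 {κ : Type} {u v : (κ → ℂ) → Fin 2 → ℂ} (hu : ∀ k, IsPoly fun x => u x k)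
    (hv : ∀ k, IsPoly fun x => v x k) : IsPoly fun x => det2 (u x) (v x) :=
  ((hu 0).mul (hv 1)).sub ((hu 1).mul (hv 0))

theorem isPoly_separatedPoly {κ : Type} {u : (κ → ℂ) → SevenLabels → Fin 2 → ℂ}
    (hu : ∀ i k, IsPoly fun x => u x i k) : IsPoly fun x => separatedPoly (u x) := by
  unfold separatedPoly
  refine IsPoly.mul (IsPoly.prod _ fun t => ?_) (isPoly_det2 (u := fun x => u x (Sum.inr 0))
    (v := fun x => u x (Sum.inr 1)) (hu _) (hu _))
  split_ifs
  · exact isPoly_det2 (u := fun x => u x (Sum.inl t.1)) (v := fun x => u x (Sum.inl t.2))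
      (hu _) (hu _)
  · exact .const _

/-- The cover maps onto the union of the three strata. -/
def toStrata (z : Cover) : smoothStrata := ⟨z.toDM, z.toDM_mem⟩

theorem isQuotientOf_toStrata :
    IsQuotientOf space (dmMod2Space.induced Subtype.val) toStrata := by
  classical
  refine ⟨IsMorphism.codRestrict isMorphism_toDM, fun U f hU hf => ?_⟩
  -- the functions on the strata are extended by zero
  let F : DMmod2 → ℂ := fun y => if h : y ∈ smoothStrata then f ⟨y, h⟩ else 0
  obtain ⟨hV, hF⟩ : IsOpen[dmMod2Space.top] (Subtype.val '' U) ∧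
      dmMod2Space.regular (Subtype.val '' U) F := by
    refine IsQuotientOf.descend_vecConfig isQuotientOf_dmMod2 ?_
    refine (locPoly_of_regular hf).transfer (ι := Fin 5)
      (K := fun i x => det2 (fun k => x (Sum.inl i, k)) (fun k => x (Sum.inr 1, k)) *
        det2 (fun k => x (Sum.inl i, k)) (fun k => x (Sum.inr 0, k))) ?_ ?_
    · intro i
      exact (isPoly_det2 (u := fun x k => x (Sum.inl i, k)) (v := fun x k => x (Sum.inr 1, k))
        (fun _ => .coord _) (fun _ => .coord _)).mul
        (isPoly_det2 (u := fun x k => x (Sum.inl i, k)) (v := fun x k => x (Sum.inr 0, k))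
        (fun _ => .coord _) (fun _ => .coord _))
    · rintro v ⟨hv, hvU⟩
      refine ⟨fun x => separatedPoly fun i k => x (Sum.inl (i, k)), fun l x =>
        (![det2 (fun k => x (Sum.inl (Sum.inl l.1, k))) (fun k => x (Sum.inl (Sum.inr 1, k))),
          det2 (fun k => x (Sum.inl (Sum.inl l.1, k))) (fun k => x (Sum.inl (Sum.inr 0, k))),
          x (Sum.inr l.1)] : Fin 3 → ℂ) l.2, ?_, ?_, ?_, ?_⟩
      · exact isPoly_separatedPoly (u := fun x i k => x (Sum.inl (i, k))) fun _ _ => .coord _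
      · rintro ⟨i, k⟩
        fin_cases k
        · exact isPoly_det2 (u := fun x k => x (Sum.inl (Sum.inl i, k)))
            (v := fun x k => x (Sum.inl (Sum.inr 1, k))) (fun _ => .coord _) (fun _ => .coord _)
        · exact isPoly_det2 (u := fun x k => x (Sum.inl (Sum.inl i, k)))
            (v := fun x k => x (Sum.inl (Sum.inr 0, k))) (fun _ => .coord _) (fun _ => .coord _)
        · exact .coord _
      · intro s _
        refine separatedPoly_ne_zero_iff.2 ?_
        obtain ⟨y, -, hy⟩ := hvU
        have hy' := y.2
        rw [hy] at hy'
        exact mk_mem_smoothStrata_iff.1 hy'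
      · intro y s hs hD
        have hy : IsSeparated y.toConfig := separatedPoly_ne_zero_iff.1 hD
        obtain ⟨z, hz, g, hg⟩ := exists_cover_of_isSeparated hy hs
        have hcls : (DMmod2.mk ∘ DM.mk) ⟨y.toConfig, hy.isStable⟩ = z.toDM := by
          refine DMmod2.mk_eq_iff.2 ⟨1, g, Eq.trans ?_ hg⟩
          congr 1
          funext l
          rcases l with l | l <;> rfl
        refine ⟨z, fun l => congrFun (hz l.1) l.2, ?_, ?_⟩
        · constructor
          · rintro ⟨h, y', hy', he⟩
            rw [hcls] at he
            have : y' = z.toStrata := Subtype.ext he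
            rwa [this] at hy'
          · exact fun h => ⟨hy.isStable, z.toStrata, h, hcls.symm⟩
        · rw [dif_pos hy.isStable, hcls]
          exact dif_pos z.toDM_mem
  have hval := isMorphism_induced (T := dmMod2Space) (Subtype.val : smoothStrata → _)
  have hpre : Subtype.val ⁻¹' (Subtype.val '' U) = U :=
    Set.preimage_image_eq U Subtype.val_injective
  have hfun : F ∘ Subtype.val = f := by
    funext y
    exact dif_pos y.2
  constructor
  · rw [← hpre]
    exact @IsOpen.preimage _ _ (dmMod2Space.induced Subtype.val).top dmMod2Space.top _
      hval.continuous _ hV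
  · rw [← hpre, ← hfun]
    exact hval.regular _ hV F hF

end Cover

/-! ### The projection from the sixth point -/

theorem IsProjection.of_smul {m : Config SixLabels 3} {p : Config SevenLabels 2} {g : SL(3, ℂ)}
    (h : IsProjection (g • m) p) : IsProjection m p := by
  obtain ⟨q, t, π, hq, hqm, ht, htq, hker, hp5, hp2⟩ := h
  refine ⟨q.comp (slLin g), fun j => g⁻¹ • t j, π.comp (slLin g), comp_slLin_ne_zero g hq,
    fun i => (onConic_smul g _).1 (hqm i), fun h => ht (smul_left_cancel _ h), fun j => ?_, ?_,
    fun i => ?_, fun j => ?_⟩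
  · rw [← onConic_smul, ← tangentThrough_smul, smul_inv_smul]
    exact htq j
  · rw [LinearMap.ker_comp, hker, Pi.smul_apply, smul_submodule,
      Submodule.comap_map_eq_of_injective (slLin_injective g)]
  · rw [hp5, Pi.smul_apply, smul_submodule, Submodule.map_comp]
  · rw [hp2, Submodule.map_comp, ← smul_submodule, smul_inv_smul]

/-- The linear projection to the first two coordinates. -/
def planeProj : (Fin 3 → ℂ) →ₗ[ℂ] (Fin 2 → ℂ) where
  toFun x := ![x 0, x 1]
  map_add' x y := by
    funext k
    fin_cases k <;> simp
  map_smul' c x := by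
    funext k
    fin_cases k <;> simp

/-- The section of the linear projection to the first two coordinates. -/
def planeSection : (Fin 2 → ℂ) →ₗ[ℂ] (Fin 3 → ℂ) where
  toFun x := ![x 0, x 1, 0]
  map_add' x y := by
    funext k
    fin_cases k <;> simp
  map_smul' c x := by
    funext k
    fin_cases k <;> simp

theorem planeProj_eq_zero_iff {x : Fin 3 → ℂ} :
    planeProj x = 0 ↔ x ∈ Submodule.span ℂ {(![0, 0, 1] : Fin 3 → ℂ)} := by
  rw [Submodule.mem_span_singleton]
  constructor
  · intro h
    have h0 : x 0 = 0 := congrFun h 0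
    have h1 : x 1 = 0 := congrFun h 1
    exact ⟨x 2, funext fun k => by fin_cases k <;> simp [h0, h1]⟩
  · rintro ⟨c, rfl⟩
    funext k
    fin_cases k <;> simp [planeProj]

namespace Cover

/-- The points of contact of the two tangents from `(0, 0, 1)` to the conic `x y = z ^ 2`. -/
def contact (j : Fin 2) : ℙ ℂ (Fin 3 → ℂ) :=
  Projectivization.mk ℂ (planeSection ((![![1, 0], ![0, 1]] : Fin 2 → Fin 2 → ℂ) j)) (by
    intro h
    fin_cases j
    · exact one_ne_zero (congrFun h 0)
    · exact one_ne_zero (congrFun h 1))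

theorem contact_submodule (j : Fin 2) : (contact j).submodule = Submodule.span ℂ
    {planeSection ((![![1, 0], ![0, 1]] : Fin 2 → Fin 2 → ℂ) j)} :=
  Projectivization.submodule_mk _ _

theorem planeProj_planeSection (x : Fin 2 → ℂ) : planeProj (planeSection x) = x := by
  funext k
  fin_cases k <;> rfl

theorem isProjection (z : Cover) : IsProjection z.sixVec.toConfig z.sevenVec.toConfig := by
  refine ⟨conic, contact, planeProj, conic_ne_zero, z.onConic_sixVec, ?_, fun j => ?_, ?_,
    fun i => ?_, fun j => ?_⟩
  · intro h
    have h1 := congrArg Projectivization.submodule h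
    rw [contact_submodule, contact_submodule] at h1
    have h2 := Submodule.mem_span_singleton_self (R := ℂ)
      (planeSection ((![![1, 0], ![0, 1]] : Fin 2 → Fin 2 → ℂ) 0))
    rw [h1] at h2
    obtain ⟨c, hc⟩ := Submodule.mem_span_singleton.1 h2
    simpa [planeSection] using congrFun hc 0
  · refine ⟨(onConic_mk _).2 ?_, (tangentThrough_mk _ _).2 ?_⟩
    · fin_cases j <;> simp [conic_apply, planeSection]
    · rw [polar_conic]
      fin_cases j <;> simp [planeSection, sixVec]
  · rw [VecConfig.toConfig, Projectivization.submodule_mk]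
    ext x
    rw [LinearMap.mem_ker]
    exact planeProj_eq_zero_iff
  · simp only [VecConfig.toConfig, Projectivization.submodule_mk]
    rw [Submodule.map_span, Set.image_singleton]
    rfl
  · simp only [VecConfig.toConfig]
    rw [contact_submodule, Projectivization.submodule_mk, Submodule.map_span,
      Set.image_singleton, planeProj_planeSection]
    rfl

theorem eq_contact {c : ℂ} (hc : c ≠ 0) {t w : ℙ ℂ (Fin 3 → ℂ)} (h : OnConic (c • conic) t)
    (hw : w.submodule = Submodule.span ℂ {(![0, 0, 1] : Fin 3 → ℂ)})
    (h' : TangentThrough (c • conic) t w) : t = contact 0 ∨ t = contact 1 := by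
  have h001 : (![0, 0, 1] : Fin 3 → ℂ) ≠ 0 := fun h => one_ne_zero (congrFun h 2)
  obtain rfl : w = Projectivization.mk ℂ ![0, 0, 1] h001 :=
    Projectivization.submodule_injective (by rw [hw, Projectivization.submodule_mk])
  induction t using Projectivization.ind with
  | h u hu =>
    rw [onConic_mk, _root_.smul_apply, smul_eq_mul, mul_eq_zero, or_iff_right hc,
      conic_apply] at h
    rw [tangentThrough_mk] at h'
    have h2 : c * (u 0 * 0 + u 1 * 0 - 2 * u 2 * 1) = 0 := by
      refine Eq.trans ?_ h'
      have := polar_conic u ![0, 0, 1]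
      simp only [Matrix.cons_val] at this
      rw [← this]
      simp only [QuadraticMap.polar, _root_.smul_apply, smul_eq_mul]
      ring
    have h20 : u 2 = 0 := by
      have := (mul_eq_zero.1 h2).resolve_left hc
      linear_combination -this / 2
    rw [h20, mul_zero, sub_zero, mul_eq_zero] at h
    rcases h with h | h
    · refine Or.inr ((Projectivization.mk_eq_mk_iff' ℂ _ _ _ _).2 ⟨u 1, funext fun k => ?_⟩)
      fin_cases k <;> simp [planeSection, h, h20]
    · refine Or.inl ((Projectivization.mk_eq_mk_iff' ℂ _ _ _ _).2 ⟨u 0, funext fun k => ?_⟩)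
      fin_cases k <;> simp [planeSection, h, h20]

/-- A projection of the six points is determined up to the choice of coordinates on the line and the
order of the two points of contact. -/
theorem exists_of_isProjection {z : Cover} {p : Config SevenLabels 2}
    (h : IsProjection z.sixVec.toConfig p) : ∃ (τ : Equiv.Perm (Fin 2)) (g : SL(2, ℂ)),
      g • CubicDM.permute (Equiv.sumCongr 1 τ) z.sevenVec.toConfig = p := by
  obtain ⟨q, t, π, hq, hqz, ht, htq, hker, hp5, hp2⟩ := h
  obtain ⟨c, rfl⟩ := z.exists_eq_smul_conic fun i => (onConic_mk (z.ne_zero i)).1 (hqz i)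
  have hc : c ≠ 0 := by
    rintro rfl
    exact hq (zero_smul _ _)
  have hw : (z.sixVec.toConfig (Sum.inr 0)).submodule =
      Submodule.span ℂ {(![0, 0, 1] : Fin 3 → ℂ)} := Projectivization.submodule_mk _ _
  rw [hw] at hker
  have hπ : ∀ x, π x = π (planeSection (planeProj x)) := by
    intro x
    rw [← sub_eq_zero, ← map_sub, ← LinearMap.mem_ker, hker, ← planeProj_eq_zero_iff, map_sub,
      planeProj_planeSection, sub_self]
  have hinj : Function.Injective (π.comp planeSection) := by
    rw [← LinearMap.ker_eq_bot, LinearMap.ker_eq_bot']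
    intro x hx
    rw [LinearMap.comp_apply, ← LinearMap.mem_ker, hker, ← planeProj_eq_zero_iff,
      planeProj_planeSection] at hx
    exact hx
  obtain ⟨g, hg⟩ := exists_specialLinear two_ne_zero _ hinj
  have hg' : ∀ (v : Fin 2 → ℂ) (hv : v ≠ 0), (g • Projectivization.mk ℂ v hv).submodule =
      Submodule.span ℂ {π (planeSection v)} := by
    intro v hv
    rw [hg v hv ((map_ne_zero_iff _ hinj).2 hv), Projectivization.submodule_mk]
    rfl
  have h5 : ∀ i, g • z.sevenVec.toConfig (Sum.inl i) = p (Sum.inl i) := by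
    intro i
    apply Projectivization.submodule_injective
    rw [hp5]
    simp only [VecConfig.toConfig, Projectivization.submodule_mk]
    rw [Submodule.map_span, Set.image_singleton, hg', hπ (z.sixVec.1 (Sum.inl i))]
    rfl
  have h2 : ∀ j k, t j = contact k → g • z.sevenVec.toConfig (Sum.inr k) = p (Sum.inr j) := by
    intro j k hjk
    apply Projectivization.submodule_injective
    rw [hp2, hjk, contact_submodule]
    simp only [VecConfig.toConfig]
    rw [Submodule.map_span, Set.image_singleton, hg']
    rfl
  have key : ∃ τ : Equiv.Perm (Fin 2), ∀ j, t j = contact (τ.symm j) := by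
    rcases eq_contact hc (htq 0).1 hw (htq 0).2 with h0 | h0 <;>
      rcases eq_contact hc (htq 1).1 hw (htq 1).2 with h1 | h1
    · exact (ht (h0.trans h1.symm)).elim
    · refine ⟨1, fun j => ?_⟩
      fin_cases j
      · exact h0
      · exact h1
    · refine ⟨Equiv.swap 0 1, fun j => ?_⟩
      fin_cases j
      · exact h0
      · exact h1
    · exact (ht (h0.trans h1.symm)).elim
  obtain ⟨τ, hτ⟩ := key
  refine ⟨τ, g, funext ?_⟩
  rintro (i | j)
  · exact h5 i
  · exact h2 j _ (hτ j)

theorem toDM_eq_of_isProjection {z : Cover} {p : Config SevenLabels 2}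
    (h : IsProjection z.sixVec.toConfig p) :
    ∃ hp : IsStable mu p, z.toDM = DMmod2.mk (DM.mk ⟨p, hp⟩) := by
  obtain ⟨τ, g, hg⟩ := exists_of_isProjection h
  have hp : IsStable mu p := by
    rw [← hg]
    exact ((z.isSeparated.permute 1 τ).smul g).isStable
  exact ⟨hp, DMmod2.mk_eq_iff.2 ⟨τ, g, hg⟩⟩

theorem toDM_congr {z z' : Cover} (h : z.toMarked = z'.toMarked) : z.toDM = z'.toDM := by
  obtain ⟨g, hg⟩ := MarkedCubics.exists_smul_eq h
  have h1 : IsProjection (g • z.sixVec.toConfig) z'.sevenVec.toConfig := by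
    have h2 : g • z.sixVec.toConfig = z'.sixVec.toConfig := hg
    rw [h2]
    exact z'.isProjection
  exact (toDM_eq_of_isProjection h1.of_smul).2

/-- The seven points do not involve the third coordinates. -/
theorem toDM_switch (ε : Fin 5 → ZMod 2) (z : Cover) : (switch ε z).toDM = z.toDM := rfl

/-! ### Injectivity -/

/-- If the ratios `a : b` of two points of the cover are related by a diagonal matrix, then the
third coordinates, which are determined by the ratios up to sign, are related up to signs. -/
theorem exists_switch_of_diagonal {z z' : Cover} {x y : ℂ} (hx : x ≠ 0) (hy : y ≠ 0)
    (h : ∀ i, ∃ c : ℂ, c * z'.1 i 0 = x * z.1 i 0 ∧ c * z'.1 i 1 = y * z.1 i 1) :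
    ∃ ε, (switch ε z).toMarked = z'.toMarked := by
  classical
  choose c hc0 hc1 using h
  obtain ⟨r, hr⟩ := IsAlgClosed.exists_pow_nat_eq (x * y) two_pos
  have hr0 : r ≠ 0 := by
    rintro rfl
    exact mul_ne_zero hx hy (by rw [← hr]; ring)
  let f : (Fin 3 → ℂ) →ₗ[ℂ] (Fin 3 → ℂ) :=
    { toFun := fun v => ![x * v 0, y * v 1, r * v 2]
      map_add' := fun v w => by
        funext k
        fin_cases k <;> simp [mul_add]
      map_smul' := fun d v => by
        funext k
        fin_cases k <;> simp <;> ring }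
  have hf : Function.Injective f := by
    intro v w hvw
    have h0 : x * v 0 = x * w 0 := congrFun hvw 0
    have h1 : y * v 1 = y * w 1 := congrFun hvw 1
    have h2 : r * v 2 = r * w 2 := congrFun hvw 2
    funext k
    fin_cases k
    · exact mul_left_cancel₀ hx h0
    · exact mul_left_cancel₀ hy h1
    · exact mul_left_cancel₀ hr0 h2
  have hsq : ∀ i, r * z.1 i 2 = c i * z'.1 i 2 ∨ r * z.1 i 2 = -(c i * z'.1 i 2) := by
    intro i
    rw [← sq_eq_sq_iff_eq_or_eq_neg, mul_pow, mul_pow, z.2.1, z'.2.1, hr]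
    linear_combination -y * z.1 i 1 * hc0 i - c i * z'.1 i 0 * hc1 i
  refine ⟨fun i => if r * z.1 i 2 = c i * z'.1 i 2 then 0 else 1,
    toMarked_eq_of_linearMap f hf (fun i => ⟨c i, ?_⟩) ⟨r, ?_⟩⟩
  · funext k
    fin_cases k
    · exact hc0 i
    · exact hc1 i
    · by_cases hi : r * z.1 i 2 = c i * z'.1 i 2
      · simp [f, switch_apply, hi]
      · have h2 := (hsq i).resolve_left hi
        change c i * z'.1 i 2 = r * (if (if r * z.1 i 2 = c i * z'.1 i 2 then 0 else 1 : ZMod 2) = 0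
          then z.1 i 2 else -z.1 i 2)
        rw [if_neg hi, if_neg one_ne_zero]
        linear_combination h2
  · funext k
    fin_cases k <;> simp [f]

/-- Exchange of the first two coordinates. -/
def swap (z : Cover) : Cover :=
  ⟨fun i => ![z.1 i 1, z.1 i 0, z.1 i 2], fun i => by
    have := z.2.1 i
    simp only [Matrix.cons_val]
    rw [this, mul_comm], fun i j hij h => z.2.2 i j hij (by
      simp only [Matrix.cons_val] at h
      linear_combination -h)⟩

theorem swap_apply (z : Cover) (i : Fin 5) : z.swap.1 i = ![z.1 i 1, z.1 i 0, z.1 i 2] := rfl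

theorem toMarked_swap (z : Cover) : z.swap.toMarked = z.toMarked := by
  let f : (Fin 3 → ℂ) →ₗ[ℂ] (Fin 3 → ℂ) :=
    { toFun := fun v => ![v 1, v 0, v 2]
      map_add' := fun v w => by
        funext k
        fin_cases k <;> simp
      map_smul' := fun d v => by
        funext k
        fin_cases k <;> simp }
  have hf : ∀ x, f (f x) = x := fun x => by
    funext k
    fin_cases k <;> simp [f]
  refine toMarked_eq_of_linearMap f (Function.LeftInverse.injective hf) (fun i => ⟨1, ?_⟩)
    ⟨1, ?_⟩
  · funext k
    fin_cases k <;> simp [f, swap_apply]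
  · funext k
    fin_cases k <;> simp [f]

/-- A projective transformation of the line that preserves the pair of points `(1, 0)`, `(0, 1)` is
diagonal or antidiagonal. -/
theorem exists_switch_of_toDM_eq {z z' : Cover} (h : z.toDM = z'.toDM) :
    ∃ ε, (switch ε z).toMarked = z'.toMarked := by
  obtain ⟨τ, g, hg⟩ := DMmod2.mk_eq_iff.1 h
  have hlin : ∀ (a b : ℂ), slLin g ![a, b] = a • slLin g ![1, 0] + b • slLin g ![0, 1] := by
    intro a b
    rw [← map_smul, ← map_smul, ← map_add]
    congr 1
    funext k
    fin_cases k <;> simp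
  have hmk : ∀ l, ∃ c : ℂ, c • z'.sevenVec.1 l =
      slLin g (z.sevenVec.1 ((Equiv.sumCongr 1 τ).symm l)) := fun l =>
    (Projectivization.mk_eq_mk_iff' ℂ _ _ ((map_ne_zero_iff _ (slLin_injective g)).2
      (z.sevenVec.2 _)) (z'.sevenVec.2 l)).1 (congrFun hg l)
  have h5 : ∀ i, ∃ c : ℂ, c • ![z'.1 i 0, z'.1 i 1] =
      z.1 i 0 • slLin g ![1, 0] + z.1 i 1 • slLin g ![0, 1] := by
    intro i
    obtain ⟨c, hc⟩ := hmk (Sum.inl i)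
    exact ⟨c, hc.trans (hlin _ _)⟩
  have hne : ∀ {v w : Fin 2 → ℂ} {c : ℂ}, v ≠ 0 → c • w = slLin g v → c ≠ 0 := by
    rintro v w c hv hc rfl
    rw [zero_smul] at hc
    exact (map_ne_zero_iff _ (slLin_injective g)).2 hv hc.symm
  obtain ⟨x, hx⟩ := hmk (Sum.inr 0)
  obtain ⟨y, hy⟩ := hmk (Sum.inr 1)
  have hx0 := hne (z.sevenVec.2 _) hx
  have hy0 := hne (z.sevenVec.2 _) hy
  have hperm : ∀ τ : Equiv.Perm (Fin 2), τ = 1 ∨ τ = Equiv.swap 0 1 := by decide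
  rcases hperm τ with rfl | rfl
  · have hx' : x • ![1, 0] = slLin g ![1, 0] := hx
    have hy' : y • ![0, 1] = slLin g ![0, 1] := hy
    refine exists_switch_of_diagonal hx0 hy0 fun i => ?_
    obtain ⟨c, hc⟩ := h5 i
    rw [← hx', ← hy'] at hc
    have hc0 := congrFun hc 0
    have hc1 := congrFun hc 1
    simp at hc0 hc1
    exact ⟨c, by rw [hc0, mul_comm], by rw [hc1, mul_comm]⟩
  · have hx' : x • ![1, 0] = slLin g ![0, 1] := hx
    have hy' : y • ![0, 1] = slLin g ![1, 0] := hy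
    obtain ⟨ε, hε⟩ := exists_switch_of_diagonal (z := z.swap) (z' := z') hx0 hy0 fun i => by
      obtain ⟨c, hc⟩ := h5 i
      rw [← hx', ← hy'] at hc
      have hc0 := congrFun hc 0
      have hc1 := congrFun hc 1
      simp at hc0 hc1
      refine ⟨c, ?_, ?_⟩
      · rw [hc0, mul_comm]
        rfl
      · rw [hc1, mul_comm]
        rfl
    exact ⟨ε, (toMarked_switch_congr z.toMarked_swap ε).symm.trans hε⟩

/-! ### Density of the strata -/

theorem exists_separatedPoly_ne_zero : ∃ u, separatedPoly u ≠ 0 := by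
  -- the points `(1, i ^ 2, i)` for `i = 0, …, 4`
  have h : ∀ i j : Fin 5, i ≠ j → ((i : ℕ) : ℤ) ^ 2 ≠ ((j : ℕ) : ℤ) ^ 2 := by decide
  let z : Cover := ⟨fun i => ![1, ((i : ℕ) : ℂ) ^ 2, ((i : ℕ) : ℂ)], fun i => by simp,
    fun i j hij h0 => by
      simp only [Matrix.cons_val] at h0
      have h1 : (((i : ℕ) : ℂ)) ^ 2 = ((j : ℕ) : ℂ) ^ 2 := by linear_combination -h0
      exact h i j hij (by exact_mod_cast h1)⟩
  exact ⟨z.sevenVec.1, separatedPoly_ne_zero_iff.2 z.isSeparated⟩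

theorem ne_zero_of_separatedPoly {u : SevenLabels → Fin 2 → ℂ} (h : separatedPoly u ≠ 0)
    (l : SevenLabels) : u l ≠ 0 := by
  have hl : ∀ v w : Fin 2 → ℂ, det2 v w ≠ 0 → v ≠ 0 ∧ w ≠ 0 := by
    refine fun v w h => ⟨?_, ?_⟩ <;> rintro rfl <;> simp [det2] at h
  have h1 := Finset.prod_ne_zero_iff.1 (left_ne_zero_of_mul h)
  have h2 := hl _ _ (right_ne_zero_of_mul h)
  rcases l with i | j
  · obtain ⟨k, hk⟩ := exists_ne i
    have := h1 (i, k) (Finset.mem_univ _)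
    rw [if_pos hk.symm] at this
    exact (hl _ _ this).1
  · fin_cases j
    · exact h2.1
    · exact h2.2

end Cover

/-- The configurations of seven points form an irreducible space: two nonzero polynomials in the
homogeneous coordinates have a common point of nonvanishing. -/
theorem dense_smoothStrata : @Dense DMmod2 dmMod2Space.top smoothStrata := by
  refine (@dense_iff_inter_open _ dmMod2Space.top _).2 fun U hU hne => ?_
  obtain ⟨y, hy⟩ := hne
  obtain ⟨p, rfl⟩ := exists_mk_eq y
  obtain ⟨V, hV, hVU⟩ : ∃ V, IsOpen[(configSpace SevenLabels 2).top] V ∧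
      (Subtype.val : StableConfig mu → _) ⁻¹' V = DMmod2.mk ∘ DM.mk ⁻¹' U :=
    @IsOpen.preimage _ _ ((configSpace SevenLabels 2).induced Subtype.val).top dmMod2Space.top _
      isQuotientOf_dmMod2.isMorphism.continuous _ hU
  have hV' : LocPoly vecCoord (VecConfig.toConfig ⁻¹' V) (fun _ => 0) :=
    locPoly_of_regular (((affine (SevenLabels × Fin 2)).induced vecCoord).regular_const _ hV 0)
  obtain ⟨v, hv⟩ := exists_toConfig_eq p.1
  have hpV : p ∈ (Subtype.val : StableConfig mu → _) ⁻¹' V := by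
    rw [hVU]
    exact hy
  obtain ⟨H, _, ⟨P, hP⟩, -, h1, h2⟩ := hV' v (by rwa [Set.mem_preimage, hv])
  obtain ⟨R, hR⟩ := Cover.isPoly_separatedPoly (κ := SevenLabels × Fin 2)
    (u := fun x i k => x (i, k)) fun _ _ => .coord _
  have hP0 : P ≠ 0 := by
    rintro rfl
    exact h1 (by rw [← hP, map_zero])
  have hR0 : R ≠ 0 := by
    rintro rfl
    obtain ⟨u, hu⟩ := Cover.exists_separatedPoly_ne_zero
    exact hu ((hR fun k => u k.1 k.2).symm.trans (map_zero _))
  obtain ⟨x, hx⟩ : ∃ x, eval x (P * R) ≠ 0 := by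
    by_contra! h
    exact mul_ne_zero hP0 hR0 (MvPolynomial.funext fun x => by rw [h, map_zero])
  rw [map_mul, hP, hR] at hx
  have hsep := right_ne_zero_of_mul hx
  let u : VecConfig SevenLabels 2 := ⟨fun i k => x (i, k), Cover.ne_zero_of_separatedPoly hsep⟩
  have hu : IsSeparated u.toConfig := Cover.separatedPoly_ne_zero_iff.1 hsep
  refine ⟨DMmod2.mk (DM.mk ⟨u.toConfig, hu.isStable⟩), ?_, mk_mem_smoothStrata_iff.2 hu⟩
  have huV : (⟨u.toConfig, hu.isStable⟩ : StableConfig mu) ∈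
      (Subtype.val : StableConfig mu → _) ⁻¹' V := (h2 u (left_ne_zero_of_mul hx)).1
  rw [hVU] at huV
  exact huV

/-! ### The quotient by the switches -/

/-- The map from six points in the plane to seven points on the line, on classes. -/
def projectMarked (x : MarkedCubics) : DMmod2 :=
  (Function.surjInv Cover.toMarked_surjective x).toDM

theorem projectMarked_toMarked (z : Cover) : projectMarked z.toMarked = z.toDM :=
  Cover.toDM_congr (Function.surjInv_eq _ _)

theorem isPhi_projectMarked : IsPhi projectMarked := by
  intro m
  obtain ⟨z, g, hg⟩ := exists_cover_of_isGeneric m.2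
  have hm : MarkedCubics.mk m = z.toMarked := MarkedCubics.mk_eq_of_smul_eq g hg
  refine ⟨⟨z.sevenVec.toConfig, IsProjection.of_smul (g := g) ?_⟩, fun p hp => ?_⟩
  · rw [hg]
    exact z.isProjection
  · rw [hm, projectMarked_toMarked]
    refine Cover.toDM_eq_of_isProjection (IsProjection.of_smul (g := g⁻¹) ?_)
    rwa [← hg, inv_smul_smul]

namespace Cover

/-- Relabelling of the five points. -/
def relabel (σ : Equiv.Perm (Fin 5)) (z : Cover) : Cover :=
  ⟨fun i => z.1 (σ.symm i), fun i => z.2.1 _, fun i j hij => z.2.2 _ _ (by simpa)⟩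

theorem toMarked_relabel (σ : Equiv.Perm (Fin 5)) (z : Cover) :
    (relabel σ z).toMarked = σ • z.toMarked := by
  refine congrArg MarkedCubics.mk (Subtype.ext (funext fun l => ?_))
  rcases l with i | i <;> rfl

theorem toDM_relabel (σ : Equiv.Perm (Fin 5)) (z : Cover) :
    (relabel σ z).toDM = σ • z.toDM := by
  refine congrArg (fun p => DMmod2.mk (DM.mk p)) (Subtype.ext (funext fun l => ?_))
  rcases l with i | i <;> rfl

theorem relabel_switch (σ : Equiv.Perm (Fin 5)) (ε : Fin 5 → ZMod 2) (z : Cover) :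
    relabel σ (switch ε z) = switch (fun i => ε (σ.symm i)) (relabel σ z) := rfl

end Cover

theorem smul_switchMarked (σ : Equiv.Perm (Fin 5)) (ε : Fin 5 → ZMod 2) (x : MarkedCubics) :
    σ • switchMarked ε x = switchMarked (fun i => ε (σ.symm i)) (σ • x) := by
  obtain ⟨z, rfl⟩ := Cover.toMarked_surjective x
  rw [switchMarked_toMarked, ← Cover.toMarked_relabel, Cover.relabel_switch,
    ← Cover.toMarked_relabel, switchMarked_toMarked]

theorem smul_projectMarked (σ : Equiv.Perm (Fin 5)) (x : MarkedCubics) :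
    projectMarked (σ • x) = σ • projectMarked x := by
  obtain ⟨z, rfl⟩ := Cover.toMarked_surjective x
  rw [← Cover.toMarked_relabel, projectMarked_toMarked, projectMarked_toMarked,
    Cover.toDM_relabel]

theorem projectMarked_eq_iff {x y : MarkedCubics} :
    projectMarked x = projectMarked y ↔ ∃ ε, switchMarked ε x = y := by
  obtain ⟨z, rfl⟩ := Cover.toMarked_surjective x
  constructor
  · obtain ⟨z', rfl⟩ := Cover.toMarked_surjective y
    simp only [projectMarked_toMarked, switchMarked_toMarked]
    exact Cover.exists_switch_of_toDM_eq
  · rintro ⟨ε, rfl⟩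
    rw [switchMarked_toMarked, projectMarked_toMarked, projectMarked_toMarked, Cover.toDM_switch]

section Quotient

attribute [local instance] switchAction

theorem CubicsModSwitch.mk_eq_iff {x y : MarkedCubics} :
    CubicsModSwitch.mk x = CubicsModSwitch.mk y ↔ ∃ ε, switchMarked ε x = y := by
  constructor
  · intro h
    obtain ⟨a, ha⟩ := (Quotient.exact (s := AddAction.orbitRel _ _) h.symm :
      (AddAction.orbitRel SwitchGroup MarkedCubics) y x)
    induction a using Quotient.inductionOn' with
    | h ε => exact ⟨ε, ha⟩
  · rintro ⟨ε, rfl⟩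
    exact (Quotient.sound (s := AddAction.orbitRel _ _) ⟨QuotientAddGroup.mk ε, rfl⟩ :
      CubicsModSwitch.mk (switchMarked ε x) = CubicsModSwitch.mk x).symm

theorem CubicsModSwitch.mk_surjective : Function.Surjective CubicsModSwitch.mk :=
  Quotient.mk_surjective

/-- The map induced on the quotient by the switches. -/
def projectQuotient : CubicsModSwitch → DMmod2 :=
  Quotient.lift projectMarked fun _ _ h =>
    projectMarked_eq_iff.2 (CubicsModSwitch.mk_eq_iff.1 (Quotient.sound h))

theorem projectQuotient_mk (x : MarkedCubics) :
    projectQuotient (CubicsModSwitch.mk x) = projectMarked x := rfl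

theorem projectQuotient_injective : Function.Injective projectQuotient := by
  intro x y h
  obtain ⟨x, rfl⟩ := CubicsModSwitch.mk_surjective x
  obtain ⟨y, rfl⟩ := CubicsModSwitch.mk_surjective y
  exact CubicsModSwitch.mk_eq_iff.2 (projectMarked_eq_iff.1 h)

/-- The class in the quotient by the switches. -/
def Cover.toQuotient (z : Cover) : CubicsModSwitch := CubicsModSwitch.mk z.toMarked

theorem Cover.toQuotient_surjective : Function.Surjective Cover.toQuotient :=
  CubicsModSwitch.mk_surjective.comp Cover.toMarked_surjective

theorem Cover.projectQuotient_toQuotient (z : Cover) : projectQuotient z.toQuotient = z.toDM :=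
  projectMarked_toMarked z

theorem range_projectQuotient : Set.range projectQuotient = smoothStrata := by
  rw [← Cover.range_toDM, ← Cover.toQuotient_surjective.range_comp]
  congr 1
  funext z
  exact z.projectQuotient_toQuotient

theorem Cover.isQuotientOf_toQuotient :
    IsQuotientOf Cover.space cubicsModSwitchSpace Cover.toQuotient :=
  (isQuotientOf_coinduced CubicsModSwitch.mk).comp Cover.isQuotientOf_toMarked

/-- The action of `S₅` on the quotient by the switches. -/
@[reducible] def quotientMulAction : MulAction (Equiv.Perm (Fin 5)) CubicsModSwitch where
  smul σ := Quotient.map (σ • ·) fun x y h => Quotient.exact (CubicsModSwitch.mk_eq_iff.2 (by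
    obtain ⟨ε, rfl⟩ := CubicsModSwitch.mk_eq_iff.1 (Quotient.sound h)
    exact ⟨_, (smul_switchMarked σ ε x).symm⟩))
  one_smul y := by
    induction y using Quotient.inductionOn with
    | h x => exact congrArg CubicsModSwitch.mk (one_smul _ x)
  mul_smul σ τ y := by
    induction y using Quotient.inductionOn with
    | h x => exact congrArg CubicsModSwitch.mk (mul_smul σ τ x)

/-- The bijection onto the union of the three strata. -/
def quotientEquiv : CubicsModSwitch ≃ smoothStrata :=
  (Equiv.ofInjective _ projectQuotient_injective).trans (Equiv.setCongr range_projectQuotient)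

theorem coe_quotientEquiv (y : CubicsModSwitch) : (quotientEquiv y : DMmod2) = projectQuotient y :=
  rfl

theorem quotientEquiv_toQuotient (z : Cover) : quotientEquiv z.toQuotient = z.toStrata :=
  Subtype.ext z.projectQuotient_toQuotient

theorem isMorphism_quotientEquiv :
    IsMorphism cubicsModSwitchSpace (dmMod2Space.induced Subtype.val) quotientEquiv := by
  refine Cover.isQuotientOf_toQuotient.isMorphism_of_comp ?_
  have h : quotientEquiv ∘ Cover.toQuotient = Cover.toStrata := funext quotientEquiv_toQuotient
  rw [h]
  exact Cover.isQuotientOf_toStrata.isMorphism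

theorem isMorphism_quotientEquiv_symm :
    IsMorphism (dmMod2Space.induced Subtype.val) cubicsModSwitchSpace quotientEquiv.symm := by
  refine Cover.isQuotientOf_toStrata.isMorphism_of_comp ?_
  have h : quotientEquiv.symm ∘ Cover.toStrata = Cover.toQuotient :=
    funext fun z => (Equiv.symm_apply_eq _).2 (quotientEquiv_toQuotient z).symm
  rw [h]
  exact Cover.isQuotientOf_toQuotient.isMorphism

theorem isMorphism_projectQuotient :
    IsMorphism cubicsModSwitchSpace dmMod2Space projectQuotient :=
  (isMorphism_induced Subtype.val).comp isMorphism_quotientEquiv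

end Quotient

end CubicDM

end

theorem mainTheorem2 :
    -- the group `(ℤ/2)⁴` acts on the moduli space of smooth marked cubic surfaces
    ∃ act : AddAction SwitchGroup MarkedCubics,
      IsSwitchAction act ∧
      (∀ a : SwitchGroup, IsMorphism markedCubicsSpace markedCubicsSpace (fun x => a +ᵥ x)) ∧
      -- the map from six points in the plane to seven points on the line descends to `φ`
      ∃ (Φ : MarkedCubics → DMmod2) (φ : CubicsModSwitch → DMmod2),
        IsPhi Φ ∧
        (∀ x : MarkedCubics, φ (CubicsModSwitch.mk x) = Φ x) ∧
        -- `φ` is an injective dominant morphism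
        IsMorphism cubicsModSwitchSpace dmMod2Space φ ∧
        Function.Injective φ ∧
        IsDominant dmMod2Space φ ∧
        -- `φ` is equivariant for the action of `S₅`, which descends to the quotient
        (∃ _ : MulAction (Equiv.Perm (Fin 5)) CubicsModSwitch,
          (∀ (σ : Equiv.Perm (Fin 5)) (x : MarkedCubics),
            σ • CubicsModSwitch.mk x = CubicsModSwitch.mk (σ • x)) ∧
          ∀ (σ : Equiv.Perm (Fin 5)) (y : CubicsModSwitch), φ (σ • y) = σ • φ y) ∧
        -- the image is the union of the three strata, and `φ` is an isomorphism onto it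
        Set.range φ = smoothStrata ∧
        ∃ e : CubicsModSwitch ≃ smoothStrata,
          (∀ y, (e y : DMmod2) = φ y) ∧
          IsMorphism cubicsModSwitchSpace (dmMod2Space.induced Subtype.val) e ∧
          IsMorphism (dmMod2Space.induced Subtype.val) cubicsModSwitchSpace e.symm := by
  refine ⟨switchAction, isSwitchAction_switchAction, fun a => ?_, projectMarked, projectQuotient,
    isPhi_projectMarked, projectQuotient_mk, isMorphism_projectQuotient,
    projectQuotient_injective, ?_, ⟨quotientMulAction, fun _ _ => rfl, fun σ y => ?_⟩,
    range_projectQuotient, quotientEquiv, coe_quotientEquiv, isMorphism_quotientEquiv,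
    isMorphism_quotientEquiv_symm⟩
  · induction a using Quotient.inductionOn' with
    | h ε => exact isMorphism_switchMarked ε
  · unfold IsDominant
    rw [range_projectQuotient]
    exact dense_smoothStrata
  · induction y using Quotient.inductionOn with
    | h x => exact smul_projectMarked σ x
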